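/- **Setting.** Let $\Omega=M\times(-h,0)\subset\mathbb R^3$, $h>0$, with $M\subset\mathbb R^2$ a bounded domain with $C^2$ boundary; write $\nabla_h=(\partial_x,\partial_y)$, $\nabla_3=(\partial_x,\partial_y,\partial_z)$. *Density.* $\rho(\theta,S,p_{st})=\big(\sum_{i\le 7,\,j\le 6,\,k\le 5}c_{ijk}S^i\theta^jp_{st}^k\big)^{-1}$ with $p_{st}(z)=-g\rho_0z$, $g,\rho_0>0$. The coefficients $c_{ijk}\in\mathbb R$ are such that $\rho\in I_\rho=[R_1,R_2]$, $R_1>0$, whenever $\theta\in I_\theta=[-K_1,K_2]$, $S\in I_S=[L_1,L_2]$ and $p_{st}\in I_p=[M_1,M_2]$, where the interval $I_p$ contains the values $p_{st}(z)$, $-h<z<0$. *Cut-off.* Let $\eta>0$ and let $d$ be a continuous function on $\Omega$ with $a\,\mathrm{dist}(x,\partial\Omega)\le d(x)\le\mathrm{dist}(x,\partial\Omega)$ for some $a>0$ (the distance to the boundary itself, or a regularized distance). Let $\xi\in C^\infty$ be nondecreasing with $\xi=0$ on $[0,1)$ and $\xi=1$ on $[2,\infty)$, and $\pi:=\xi(d/\eta)$.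 *Regularized density.* Let $0\le j\in C^\infty(\mathbb R^3)$ vanish outside the unit ball, $\int j=1$, $j_\eta(x)=\eta^{-3}j(2x/\eta)$. Put $\tilde\rho(x)=\int_\Omega j_\eta(x-\tilde x)\rho(\tilde x)\,d\tilde x$ if $x\in\Omega$, $d(x)>\eta/2$, and $\tilde\rho(x)=0$ otherwise. *Slope.* Let $s_0>\epsilon_0>0$ and let $\Pi\in C^\infty$ be nondecreasing, $\Pi=0$ on $[0,s_0-\epsilon_0]$, $\Pi=1$ on $[s_0,\infty)$. Put $$\mathbf L(\tilde\rho)=-\frac{\nabla_h\tilde\rho}{\partial_z\tilde\rho}\,\pi\,\Pi(|\partial_z\tilde\rho|)\quad\text{where }|\partial_z\tilde\rho|>s_0-\epsilon_0,\qquad \mathbf L(\tilde\rho)=0\text{ elsewhere in }\Omega.$$ *Tracer spaces.* $V_\theta$ is the closure in $H^1(\Omega)$ of the $\phi\in C^\infty(\overline\Omega)$ with $\partial_z\phi=-k_\theta\phi$ on $z=0$, $\partial_z\phi=0$ on $z=-h$, $\partial_n\phi=0$ on $\partial M\times[-h,0]$. For $m\in\mathbb R$, $V_S^m$ is the closure in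 $H^1(\Omega)$ of the $\phi\in C^\infty(\overline\Omega)$ satisfying these conditions with $k_\theta=0$ and $\int_\Omega\phi=m$; $V_S:=V_S^0$. *Velocity space.* $V_v$ is the closure in $H^1(\Omega)^2$ of the $v\in C^\infty(\overline\Omega)^2$ with $\partial_zv=0$, $w=0$ on $z=0$ and $z=-h$, and $v\cdot n=0$, $\partial_nv\times n=0$, $w=0$ on $\partial M\times[-h,0]$, where $w=-\int_{-h}^z\nabla_h\cdot v\,d\zeta$. *Strong solutions.* With $\mathbf L=(L_x,L_y)$, $\delta=K_D/K_I$, $K_I,K_D,\kappa>0$, let $$\mathbb K_{iso}=\tfrac{K_I}{1+|\mathbf L|^2}\begin{pmatrix}1+\delta L_x^2+L_y^2&(\delta-1)L_xL_y&(1-\delta)L_x\\(\delta-1)L_xL_y&1+L_x^2+\delta L_y^2&(1-\delta)L_y\\(1-\delta)L_x&(1-\delta)L_y&\delta+|\mathbf L|^2\end{pmatrix},\quad \mathbb K_{GM}=\kappa\begin{pmatrix}0&0&-L_x\\0&0&-L_y\\L_x&L_y&0\end{pmatrix}.$$ Let $Re_1,Re_2>0$ and let $f$ be a continuous function of $(x,y)$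 (the Coriolis parameter). A strong solution on $[0,T]$ is a triple $(v,\theta,S)$ with $v\in C([0,T],V_v)$, $\theta\in C([0,T],V_\theta)$, $S\in C([0,T],V_S^m)$, all three in $L^2([0,T],H^2(\Omega))$, with time derivatives in $L^1([0,T],L^2(\Omega))$, such that for a.e. $t$ and all $\Phi\in V_v$, $\phi\in V_\theta$, $\psi\in V_S$ (with $\rho=\rho(\theta,S,p_{st})$ and $w=-\int_{-h}^z\nabla_h\cdot v\,d\zeta$) $$\int_\Omega\big(\partial_tv+(v\cdot\nabla_h)v+w\partial_zv+f\,(-v_2,v_1)\big)\cdot\Phi+\Big(\int_{-h}^zg\rho\,d\zeta\Big)\nabla_h\cdot\Phi+\tfrac1{Re_1}\nabla_hv\cdot\nabla_h\Phi+\tfrac1{Re_2}\partial_zv\cdot\partial_z\Phi=0,$$ $$\int_\Omega(\partial_t\theta+v\cdot\nabla_h\theta+w\partial_z\theta)\phi+(\mathbb K_{iso}+\mathbb K_{GM})\nabla_3\theta\cdot\nabla_3\phi+k_\theta\int_{M\times\{0\}}\theta\phi\,dx\,dy=0,$$ $$\int_\Omega(\partial_tS+v\cdot\nabla_hS+w\partial_zS)\psi+(\mathbb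 K_{iso}+\mathbb K_{GM})\nabla_3S\cdot\nabla_3\psi=0.$$ **Lemma.** Let $T>0$, $m\in\mathbb R$, $\theta\in L^2([0,T],V_\theta)$ with $\theta\in I_\theta$ a.e., $S\in L^2([0,T],V_S^m)$ with $S\in I_S$ a.e., and $\mathbf L=\mathbf L(\tilde\rho)$ for $\rho=\rho(\theta,S,p_{st})$. (i) If the cut-off function $\pi$ is of class $C^2$ on $\Omega$, then $\mathbf L\in L^\infty([0,T],H^2(\Omega))$ and, for a.e. $t\in[0,T]$, $$\|\mathbf L(t)\|_{H^2(\Omega)}\le C\|\rho(t)\|_{L^2(\Omega)}^2 ,$$ with $C$ depending only on $\Omega,\eta,j,d,\xi,s_0,\epsilon_0,\Pi$ and $I_\rho$. (ii) If in addition $(v,\theta,S)$ is a strong solution, then $\partial_t\mathbf L\in L^\infty([0,T],L^2(\Omega))$. Here, and in (iii), $\pi$ need not be $C^2$. (iii) Let $(\theta_1,S_1)$, $(\theta_2,S_2)$ be two pairs as above (with possibly different $m$), with densities $\rho_1,\rho_2$. If $\epsilon_0\le r s_0$ with $r<1$ and $s_0\sup|\Pi'|\le B$, then for a.e. $t\in[0,T]$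 $$\|\mathbf L(\tilde\rho_1)(t)-\mathbf L(\tilde\rho_2)(t)\|_{L^\infty(\Omega)}\le C\Big(\frac1{s_0}+\frac1{s_0^2}\Big)|I_\rho|\,\|\rho_1(t)-\rho_2(t)\|_{L^2(\Omega)},\qquad |I_\rho|=R_2-R_1,$$ with $C$ depending only on $\Omega,\eta,j,r,B$. -/

import Mathlib

open MeasureTheory Set Filter
open scoped Topology ContDiff

noncomputable section

namespace Ocean

/-- The horizontal plane. -/
abbrev E2 := EuclideanSpace ℝ (Fin 2)

/-- Physical space, with coordinates `x 0 = x`, `x 1 = y`, `x 2 = z`. -/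
abbrev E3 := EuclideanSpace ℝ (Fin 3)

/-- The horizontal part `(x, y)` of a point `(x, y, z)`. -/
def hor (x : E3) : E2 := !₂[x 0, x 1]

/-- The point `(p, z)`. -/
def lift3 (p : E2) (z : ℝ) : E3 := !₂[p 0, p 1, z]

/-! ### The domain -/

/-- `ψ` is a `C²` local defining function of `M` near `p`: near `p` the set `M` is `{ψ < 0}`
and the gradient of `ψ` does not vanish. -/
def IsLocalDefining (M : Set E2) (p : E2) (ψ : E2 → ℝ) : Prop :=
  ∃ U : Set E2, IsOpen U ∧ p ∈ U ∧ ContDiffOn ℝ 2 ψ U ∧ (∀ q ∈ U, gradient ψ q ≠ 0) ∧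
    M ∩ U = {q ∈ U | ψ q < 0}

/-- `n` is the outer unit normal of `M` at `p`. -/
def IsOuterNormal (M : Set E2) (p n : E2) : Prop :=
  ∃ ψ : E2 → ℝ, IsLocalDefining M p ψ ∧ n = ‖gradient ψ p‖⁻¹ • gradient ψ p

/-- The cylinder `M × (-h, 0)` over a bounded planar domain `M` with `C²` boundary. -/
structure Domain where
  M : Set E2
  h : ℝ
  h_pos : 0 < h
  isOpen_M : IsOpen M
  isConnected_M : IsConnected M
  isBounded_M : Bornology.IsBounded M
  boundary_M : ∀ p ∈ frontier M, ∃ ψ : E2 → ℝ, IsLocalDefining M p ψ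

namespace Domain

/-- The set `Ω = M × (-h, 0)`. -/
def Ω (D : Domain) : Set E3 := {x | hor x ∈ D.M ∧ -D.h < x 2 ∧ x 2 < 0}

/-- Lebesgue measure on `Ω`. -/
abbrev μ (D : Domain) : Measure E3 := volume.restrict D.Ω

/-- Lebesgue measure on `M`. -/
abbrev μM (D : Domain) : Measure E2 := volume.restrict D.M

end Domain

/-! ### Sobolev spaces -/

/-- The classical partial derivative `∂ᵢ f`. -/
def pd (i : Fin 3) (f : E3 → ℝ) : E3 → ℝ := fun x => fderiv ℝ f x (EuclideanSpace.single i 1)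

/-- Multi-indices of order at most `k`. -/
abbrev MultiIdx (k : ℕ) := {α : Fin 3 → Fin (k + 1) // ∑ i, (α i : ℕ) ≤ k}

/-- The order `|α|`. -/
def MultiIdx.order {k : ℕ} (α : MultiIdx k) : ℕ := ∑ i, (α.1 i : ℕ)

/-- The multi-index `0`. -/
def MultiIdx.zero (k : ℕ) : MultiIdx k := ⟨fun _ => 0, by simp⟩

/-- The multi-index `eᵢ` of order one. -/
def MultiIdx.unit (i : Fin 3) : MultiIdx 1 :=
  ⟨fun l => if l = i then 1 else 0, by fin_cases i <;> decide⟩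

/-- The classical derivative `D^α f`. -/
def mpd {k : ℕ} (α : MultiIdx k) (f : E3 → ℝ) : E3 → ℝ :=
  (pd 0)^[α.1 0] ((pd 1)^[α.1 1] ((pd 2)^[α.1 2] f))

/-- `L²(Ω)`. -/
abbrev L2 (D : Domain) := Lp ℝ 2 D.μ

/-- Families `(u_α)`, `|α| ≤ k`, of `L²(Ω)` functions, with the norm `(∑ ‖u_α‖²)^(1/2)`. The
space `H^k(Ω)` is the closed subspace in which `u_α` is the weak derivative `D^α u_0`. -/
abbrev Jet (k : ℕ) (D : Domain) := PiLp 2 fun _ : MultiIdx k => L2 D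

/-- The function underlying a jet. -/
def Jet.val {k : ℕ} {D : Domain} (u : Jet k D) : L2 D := u (MultiIdx.zero k)

/-- The first-order weak derivative stored in a jet. -/
def Jet.grad {D : Domain} (u : Jet 1 D) (i : Fin 3) : L2 D := u (MultiIdx.unit i)

/-- Test functions `C_c^∞(U)`. -/
def IsTest (U : Set E3) (φ : E3 → ℝ) : Prop :=
  ContDiff ℝ ∞ φ ∧ HasCompactSupport φ ∧ tsupport φ ⊆ U

/-- The Sobolev space `H^k(Ω)`, a function being given together with its weak derivatives of
order at most `k`; the norm of the jet is the usual `H^k` norm. -/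
def Sobolev (k : ℕ) (D : Domain) : Set (Jet k D) :=
  {u | ∀ α : MultiIdx k, ∀ φ : E3 → ℝ, IsTest D.Ω φ →
    ∫ x, u.val x * mpd α φ x ∂D.μ = (-1) ^ α.order * ∫ x, u α x * φ x ∂D.μ}

/-- The jet `u` is that of the smooth function `f`, restricted to `Ω`. -/
def IsJetOf {k : ℕ} {D : Domain} (u : Jet k D) (f : E3 → ℝ) : Prop :=
  ∀ α : MultiIdx k, u α =ᵐ[D.μ] mpd α f

/-- Pairs of jets: horizontal vector fields. -/
abbrev VJet (k : ℕ) (D : Domain) := PiLp 2 fun _ : Fin 2 => Jet k D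

/-- `L²(Ω)²`. -/
abbrev VL2 (D : Domain) := PiLp 2 fun _ : Fin 2 => L2 D

/-- `u' ∈ L¹([0,T], X)` is the weak time derivative of `u`. -/
def HasWeakTimeDeriv {X : Type*} [NormedAddCommGroup X] [NormedSpace ℝ X] (T : ℝ)
    (u u' : ℝ → X) : Prop :=
  IntegrableOn u (Icc 0 T) ∧ IntegrableOn u' (Icc 0 T) ∧
    ∀ φ : ℝ → ℝ, ContDiff ℝ ∞ φ → HasCompactSupport φ → tsupport φ ⊆ Ioo 0 T →
      ∫ t in Icc 0 T, deriv φ t • u t = -∫ t in Icc 0 T, φ t • u' t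

/-- `τ ∈ L²(M)` is the trace of `u ∈ H¹(Ω)` on the surface `z = 0`, characterized by
integration by parts in `z`. -/
def IsSurfaceTrace (D : Domain) (u : Jet 1 D) (τ : E2 → ℝ) : Prop :=
  MemLp τ 2 D.μM ∧ ∀ φ : E3 → ℝ, IsTest {x | hor x ∈ D.M ∧ -D.h < x 2} φ →
    ∫ p, τ p * φ (lift3 p 0) ∂D.μM =
      ∫ x, (u.grad 2 x * φ x + u.val x * pd 2 φ x) ∂D.μ

/-! ### Boundary conditions and the spaces of tracers and velocities -/

/-- Homogenized boundary conditions for temperature. -/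
def TempBC (D : Domain) (kθ : ℝ) (f : E3 → ℝ) : Prop :=
  (∀ p ∈ closure D.M, pd 2 f (lift3 p 0) = -kθ * f (lift3 p 0)) ∧
  (∀ p ∈ closure D.M, pd 2 f (lift3 p (-D.h)) = 0) ∧
  ∀ p ∈ frontier D.M, ∀ n, IsOuterNormal D.M p n → ∀ z ∈ Icc (-D.h) 0,
    pd 0 f (lift3 p z) * n 0 + pd 1 f (lift3 p z) * n 1 = 0

/-- Boundary conditions for salinity: no flux through any part of the boundary. -/
def SalBC (D : Domain) (f : E3 → ℝ) : Prop := TempBC D 0 f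

/-- The space `V_θ`. -/
def Vθ (D : Domain) (kθ : ℝ) : Set (Jet 1 D) :=
  closure {u | ∃ f : E3 → ℝ, ContDiff ℝ ∞ f ∧ TempBC D kθ f ∧ IsJetOf u f}

/-- The (affine) space `V_S` of salinities with total salt content `m`; the linear space `V_S`
of test functions is the case `m = 0`. -/
def VS (D : Domain) (m : ℝ) : Set (Jet 1 D) :=
  closure {u | ∃ f : E3 → ℝ, ContDiff ℝ ∞ f ∧ SalBC D f ∧ ∫ x, f x ∂D.μ = m ∧ IsJetOf u f}

/-- The vertical velocity `-∫_{-h}^z ∇_h · v` of a smooth horizontal velocity. -/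
def wSmooth (D : Domain) (f : Fin 2 → E3 → ℝ) (x : E3) : ℝ :=
  -∫ ζ in (-D.h)..(x 2), (pd 0 (f 0) (lift3 (hor x) ζ) + pd 1 (f 1) (lift3 (hor x) ζ))

/-- Homogenized boundary conditions for velocity: stress-free and `w = 0` at top and bottom;
no penetration, no tangential stress, and `w = 0` at the lateral boundary. -/
def VelBC (D : Domain) (f : Fin 2 → E3 → ℝ) : Prop :=
  (∀ p ∈ closure D.M, (∀ i, pd 2 (f i) (lift3 p 0) = 0) ∧ wSmooth D f (lift3 p 0) = 0) ∧
  (∀ p ∈ closure D.M, (∀ i, pd 2 (f i) (lift3 p (-D.h)) = 0) ∧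
    wSmooth D f (lift3 p (-D.h)) = 0) ∧
  ∀ p ∈ frontier D.M, ∀ n, IsOuterNormal D.M p n → ∀ z ∈ Icc (-D.h) 0,
    f 0 (lift3 p z) * n 0 + f 1 (lift3 p z) * n 1 = 0 ∧
    (pd 0 (f 0) (lift3 p z) * n 0 + pd 1 (f 0) (lift3 p z) * n 1) * n 1 -
      (pd 0 (f 1) (lift3 p z) * n 0 + pd 1 (f 1) (lift3 p z) * n 1) * n 0 = 0 ∧
    wSmooth D f (lift3 p z) = 0

/-- The space `V_v`. -/
def Vv (D : Domain) : Set (VJet 1 D) :=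
  closure {u | ∃ f : Fin 2 → E3 → ℝ, (∀ i, ContDiff ℝ ∞ (f i)) ∧ VelBC D f ∧
    ∀ i, IsJetOf (u i) (f i)}

/-! ### Equation of state -/

/-- The equation of state (specific volume polynomial in salinity, temperature and static
pressure), with its admissible ranges `I_θ = [-K₁, K₂]`, `I_S = [L₁, L₂]`, `I_p = [M₁, M₂]`
and `I_ρ = [R₁, R₂]`. -/
structure EOS (D : Domain) where
  c : Fin 8 → Fin 7 → Fin 6 → ℝ
  g : ℝ
  g_pos : 0 < g
  ρ₀ : ℝ
  ρ₀_pos : 0 < ρ₀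
  K₁ : ℝ
  K₂ : ℝ
  L₁ : ℝ
  L₂ : ℝ
  M₁ : ℝ
  M₂ : ℝ
  R₁ : ℝ
  R₂ : ℝ
  R₁_pos : 0 < R₁
  pressure_range : ∀ z ∈ Ioo (-D.h) 0, -g * ρ₀ * z ∈ Icc M₁ M₂
  density_range : ∀ θ ∈ Icc (-K₁) K₂, ∀ S ∈ Icc L₁ L₂, ∀ p ∈ Icc M₁ M₂,
    (∑ i, ∑ j, ∑ k, c i j k * S ^ (i : ℕ) * θ ^ (j : ℕ) * p ^ (k : ℕ))⁻¹ ∈ Icc R₁ R₂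

namespace EOS

variable {D : Domain}

/-- The density as a function of temperature, salinity and pressure. -/
def rho (e : EOS D) (θ S p : ℝ) : ℝ :=
  (∑ i, ∑ j, ∑ k, e.c i j k * S ^ (i : ℕ) * θ ^ (j : ℕ) * p ^ (k : ℕ))⁻¹

/-- The static pressure. -/
def pst (e : EOS D) (z : ℝ) : ℝ := -e.g * e.ρ₀ * z

/-- The density field of a temperature field and a salinity field. -/
def density (e : EOS D) (θ S : Jet 1 D) : E3 → ℝ :=
  fun x => e.rho (θ.val x) (S.val x) (e.pst (x 2))

end EOS

/-- `θ ∈ L²([0,T], V_θ ∩ L^∞_{I_θ}(Ω))`. -/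
def IsTemperature {D : Domain} (e : EOS D) (kθ T : ℝ) (θ : ℝ → Jet 1 D) : Prop :=
  MemLp θ 2 (volume.restrict (Icc 0 T)) ∧ ∀ᵐ t ∂volume.restrict (Icc 0 T),
    θ t ∈ Vθ D kθ ∧ ∀ᵐ x ∂D.μ, (θ t).val x ∈ Icc (-e.K₁) e.K₂

/-- `S ∈ L²([0,T], V_S ∩ L^∞_{I_S}(Ω))`, with total salt content `m`. -/
def IsSalinity {D : Domain} (e : EOS D) (m T : ℝ) (S : ℝ → Jet 1 D) : Prop :=
  MemLp S 2 (volume.restrict (Icc 0 T)) ∧ ∀ᵐ t ∂volume.restrict (Icc 0 T),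
    S t ∈ VS D m ∧ ∀ᵐ x ∂D.μ, (S t).val x ∈ Icc e.L₁ e.L₂

/-! ### Regularized density and isoneutral slope -/

/-- A regularizing kernel `j` supported in the unit ball, and the regularization length `η`. -/
structure Kernel where
  η : ℝ
  η_pos : 0 < η
  j : E3 → ℝ
  smooth : ContDiff ℝ ∞ j
  nonneg : ∀ x, 0 ≤ j x
  support : ∀ x, 1 ≤ ‖x‖ → j x = 0
  integral_eq : ∫ x, j x = 1

/-- The rescaled kernel `j_η(x) = η⁻³ j(2x/η)`, supported in the ball of radius `η/2`. -/
def Kernel.jη (k : Kernel) (x : E3) : ℝ := (k.η ^ 3)⁻¹ * k.j ((2 / k.η) • x)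

/-- The data of the cut-off near the boundary and of the tapering: a distance to the boundary
`d` (the Euclidean one, or a regularized one that is comparable to it from below), the cut-off
profile `ξ`, the minimal stratification `s₀`, the transition width `ε₀` and the tapering function
`P`. The profiles are extended by zero to the negative axis. -/
structure Limiter (D : Domain) where
  d : E3 → ℝ
  d_cont : ContinuousOn d D.Ω
  d_le : ∀ x ∈ D.Ω, d x ≤ Metric.infDist x (frontier D.Ω)
  le_d : ∃ a > 0, ∀ x ∈ D.Ω, a * Metric.infDist x (frontier D.Ω) ≤ d x
  ξ : ℝ → ℝ
  ξ_smooth : ContDiff ℝ ∞ ξ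
  ξ_mono : Monotone ξ
  ξ_zero : ∀ s < 1, ξ s = 0
  ξ_one : ∀ s, 2 ≤ s → ξ s = 1
  s₀ : ℝ
  ε₀ : ℝ
  ε₀_pos : 0 < ε₀
  ε₀_lt : ε₀ < s₀
  P : ℝ → ℝ
  P_smooth : ContDiff ℝ ∞ P
  P_mono : Monotone P
  P_zero : ∀ s ≤ s₀ - ε₀, P s = 0
  P_one : ∀ s, s₀ ≤ s → P s = 1

section Slope

variable {D : Domain}

/-- The cut-off function `ξ(d/η)`. -/
def cutoff (k : Kernel) (l : Limiter D) (x : E3) : ℝ := l.ξ (l.d x / k.η)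

open Classical in
/-- The regularized density `ρ̃`: the convolution `j_η * ρ` on `{x ∈ Ω : d(x) > η/2}`, zero
elsewhere. -/
def regDensity (k : Kernel) (l : Limiter D) (ρ : E3 → ℝ) (x : E3) : ℝ :=
  if x ∈ D.Ω ∧ k.η / 2 < l.d x then ∫ y, k.jη (x - y) * ρ y ∂D.μ else 0

open Classical in
/-- The components of the isoneutral density slope `L(ρ̃)` associated with the density `ρ`. -/
def slope (k : Kernel) (l : Limiter D) (ρ : E3 → ℝ) (i : Fin 2) (x : E3) : ℝ :=
  if x ∈ D.Ω ∧ l.s₀ - l.ε₀ < |pd 2 (regDensity k l ρ) x| then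
    -(pd i.castSucc (regDensity k l ρ) x / pd 2 (regDensity k l ρ) x) *
      cutoff k l x * l.P |pd 2 (regDensity k l ρ) x|
  else 0

/-- The isoneutral density slope as a vector field with values in the Euclidean plane. -/
def slopeVec (k : Kernel) (l : Limiter D) (ρ : E3 → ℝ) (x : E3) : E2 :=
  WithLp.toLp 2 fun i => slope k l ρ i x

end Slope

/-! ### Eddy tensors and strong solutions -/

/-- Reynolds numbers, diffusivities, eddy advection parameter, surface relaxation coefficient and
Coriolis parameter. -/
structure Params where
  Re₁ : ℝ
  Re₂ : ℝ
  KI : ℝ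
  KD : ℝ
  κ : ℝ
  kθ : ℝ
  f : E2 → ℝ
  Re₁_pos : 0 < Re₁
  Re₂_pos : 0 < Re₂
  KI_pos : 0 < KI
  KD_pos : 0 < KD
  κ_pos : 0 < κ
  f_cont : Continuous f

/-- The isoneutral mixing tensor for the slope `(a, b)`. -/
def Kiso (p : Params) (a b : ℝ) : Matrix (Fin 3) (Fin 3) ℝ :=
  (p.KI / (1 + (a ^ 2 + b ^ 2))) •
    !![1 + p.KD / p.KI * a ^ 2 + b ^ 2, (p.KD / p.KI - 1) * a * b, (1 - p.KD / p.KI) * a;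
       (p.KD / p.KI - 1) * a * b, 1 + a ^ 2 + p.KD / p.KI * b ^ 2, (1 - p.KD / p.KI) * b;
       (1 - p.KD / p.KI) * a, (1 - p.KD / p.KI) * b, p.KD / p.KI + (a ^ 2 + b ^ 2)]

/-- The eddy advection tensor for the slope `(a, b)`. -/
def Kgm (p : Params) (a b : ℝ) : Matrix (Fin 3) (Fin 3) ℝ :=
  p.κ • !![0, 0, -a; 0, 0, -b; a, b, 0]

section Equations

variable {D : Domain}

/-- The vertical velocity `w = -∫_{-h}^z ∇_h · v`. -/
def vertVel (v : VJet 1 D) (x : E3) : ℝ :=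
  -∫ ζ in (-D.h)..(x 2),
    ((v 0).grad 0 (lift3 (hor x) ζ) + (v 1).grad 1 (lift3 (hor x) ζ))

/-- The transport `(v · ∇)u + w ∂_z u`. -/
def advect (v : VJet 1 D) (u : Jet 1 D) (x : E3) : ℝ :=
  (v 0).val x * u.grad 0 x + (v 1).val x * u.grad 1 x + vertVel v x * u.grad 2 x

/-- The quantity `(K ∇₃u) · ∇₃φ` for a tensor field `K`. -/
def fluxDot (K : E3 → Matrix (Fin 3) (Fin 3) ℝ) (u φ : Jet 1 D) (x : E3) : ℝ :=
  (K x).mulVec (fun i => u.grad i x) ⬝ᵥ fun i => φ.grad i x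

/-- The weak momentum equation at a fixed time, tested with `Φ`; `vt` is `∂_t v` and `ρ` is the
density. -/
def MomentumEq (e : EOS D) (p : Params) (ρ : E3 → ℝ) (v : VJet 1 D) (vt : VL2 D)
    (Φ : VJet 1 D) : Prop :=
  ∫ x, ∑ i, vt i x * (Φ i).val x ∂D.μ
    + ∫ x, ∑ i, advect v (v i) x * (Φ i).val x ∂D.μ
    + ∫ x, (∫ ζ in (-D.h)..(x 2), e.g * ρ (lift3 (hor x) ζ)) *
        ((Φ 0).grad 0 x + (Φ 1).grad 1 x) ∂D.μ
    + ∫ x, p.f (hor x) * (-(v 1).val x * (Φ 0).val x + (v 0).val x * (Φ 1).val x) ∂D.μ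
    + ∫ x, (1 / p.Re₁ * ∑ i, ((v i).grad 0 x * (Φ i).grad 0 x + (v i).grad 1 x * (Φ i).grad 1 x)
        + 1 / p.Re₂ * ∑ i, (v i).grad 2 x * (Φ i).grad 2 x) ∂D.μ = 0

/-- The left-hand side, without the surface term, of the weak equation of a tracer `C` at a fixed
time, tested with `φ`; `Ct` is `∂_t C` and `ρ` is the density. -/
def tracerForm (k : Kernel) (l : Limiter D) (p : Params) (ρ : E3 → ℝ)
    (v : VJet 1 D) (C : Jet 1 D) (Ct : L2 D) (φ : Jet 1 D) : ℝ :=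
  ∫ x, Ct x * φ.val x ∂D.μ
    + ∫ x, advect v C x * φ.val x ∂D.μ
    + ∫ x, fluxDot (fun y => Kiso p (slope k l ρ 0 y) (slope k l ρ 1 y)) C φ x ∂D.μ
    + ∫ x, fluxDot (fun y => Kgm p (slope k l ρ 0 y) (slope k l ρ 1 y)) C φ x ∂D.μ

/-- The field `u` (with values in `H¹`) belongs to `L²([0,T], H²(Ω))`. -/
def IsL2H2 (T : ℝ) (u : ℝ → Jet 1 D) : Prop :=
  ∃ U : ℝ → Jet 2 D, MemLp U 2 (volume.restrict (Icc 0 T)) ∧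
    ∀ᵐ t ∂volume.restrict (Icc 0 T), U t ∈ Sobolev 2 D ∧ (U t).val = (u t).val

/-- `(v, θ, S)` is a strong solution on `[0,T]` with total salt content `m`. -/
structure IsStrongSolution (k : Kernel) (l : Limiter D) (e : EOS D) (p : Params) (m T : ℝ)
    (v : ℝ → VJet 1 D) (θ S : ℝ → Jet 1 D) : Prop where
  v_cont : ContinuousOn v (Icc 0 T)
  v_mem : ∀ t ∈ Icc 0 T, v t ∈ Vv D
  v_H2 : ∀ i, IsL2H2 T fun t => v t i
  θ_cont : ContinuousOn θ (Icc 0 T)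
  θ_mem : ∀ t ∈ Icc 0 T, θ t ∈ Vθ D p.kθ
  θ_H2 : IsL2H2 T θ
  S_cont : ContinuousOn S (Icc 0 T)
  S_mem : ∀ t ∈ Icc 0 T, S t ∈ VS D m
  S_H2 : IsL2H2 T S
  equations : ∃ (vt : ℝ → VL2 D) (θt St : ℝ → L2 D),
    HasWeakTimeDeriv T (fun t => (WithLp.toLp 2 fun i => (v t i).val : VL2 D)) vt ∧
    HasWeakTimeDeriv T (fun t => (θ t).val) θt ∧
    HasWeakTimeDeriv T (fun t => (S t).val) St ∧
    ∀ᵐ t ∂volume.restrict (Icc 0 T),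
      (∀ Φ ∈ Vv D, MomentumEq e p (e.density (θ t) (S t)) (v t) (vt t) Φ) ∧
      (∃ τ, IsSurfaceTrace D (θ t) τ ∧ ∀ φ ∈ Vθ D p.kθ, ∀ σ, IsSurfaceTrace D φ σ →
        tracerForm k l p (e.density (θ t) (S t)) (v t) (θ t) (θt t) φ
          + p.kθ * ∫ q, τ q * σ q ∂D.μM = 0) ∧
      ∀ φ ∈ VS D 0, tracerForm k l p (e.density (θ t) (S t)) (v t) (S t) (St t) φ = 0

end Equations

end Ocean

end

/-!
The regularized density `ρ̃` at a point `x` away from the boundary, and its gradient, are bounded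
linear functionals of `ρ ∈ L¹(Ω)` that depend smoothly on `x` (`Kernel.form`, `gradForm`). The slope
is therefore `χ(x) F(A(x) ρ)`, where `χ` is the cut-off, `A(x)` a pair of such functionals and
`F(a, b) = -a Π(|b|) / b`, a smooth function because `Π` vanishes near `0` (`slope_eq`). The
admissible densities are bounded in `L¹`, so that `F` may be replaced by a smooth function of compact
support (`exists_slope_eq_family`).

*Spatial regularity* (`slope_mem_H2`). If `χ` is `C²`, then `x ↦ χ(x) F(A(x) ρ)` is `C²` with compact
support in `Ω`, and its derivatives are bounded uniformly for `ρ` in a ball of `L¹`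
(`exists_slope_jets`). The density is at least `R₁ > 0`, so that a bound of this kind is also a bound
by a multiple of `‖ρ‖²`.

*Lipschitz estimate* (`exists_slope_lipschitz_bound`). The derivatives of the kernel have mean zero,
so that the gradient of `ρ̃` is controlled by the oscillation `R₂ - R₁` of the density
(`Kernel.exists_abs_form_le_osc`). The function `F` is Lipschitz with a constant that is proportional
to this bound (`Limiter.abs_ratio_sub_le`).

*Time derivative* (`exists_slope_weakTimeDeriv`). The density is the composition of `(θ, S)` with a
smooth function `g` of compact support. As a map from `L² × L²` to `L¹`, this composition has a
bounded and Lipschitz derivative (`exists_superposition`), and so does the map from the density in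
`L¹` to the slope in `L²` (`exists_familySuperposition`). The chain rule for weak time derivatives
(`HasWeakTimeDeriv.comp`) then gives `∂ₜL` in `L¹(0, T; L²)`.

The time derivatives of `θ` and `S` are not bounded in `L²`, but `∂ₜL` involves them only through the
integrals `∫ ψ (∂_θ g ∂ₜθ + ∂_S g ∂ₜS)`, where `ψ` is a derivative of the translated kernel, a test
function in `Ω`. By the tracer equations, `∫ φ ∂ₜθ` is bounded by the `H¹` norms of `v` and `θ`, the
supremum of `φ` and the `L²` norm of its gradient, for test functions `φ` in `Ω`
(`abs_tracerForm_sub_le`, `abs_integral_temperatureDeriv_mul_le`). The same holds for `S`, because the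
mean of a test function can be subtracted: `∂ₜS` has mean zero
(`abs_integral_salinityDeriv_mul_le`). Approximating `θ` and `S` in `H¹` by smooth functions, one may
take `φ = ψ ∂_θ g(θ, S, p)` and `φ = ψ ∂_S g(θ, S, p)` (`abs_integral_mul_superposition_le`), which
bounds `∂ₜL` uniformly in time (`exists_form_bound`).
-/

noncomputable section

namespace Ocean

/-! ### Smooth functions with compact support -/

section CompactSupport

variable {E F : Type*} [NormedAddCommGroup E] [NormedSpace ℝ E] [NormedAddCommGroup F]
  [NormedSpace ℝ F]

/-- A single constant that serves all estimates for a `C²` function of compact support: bounds,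
Lipschitz constants, and the remainder in the first-order Taylor expansion. -/
theorem exists_taylor_bound {f : E → F} (hf : ContDiff ℝ 2 f) (hs : HasCompactSupport f) :
    ∃ C : ℝ, 0 ≤ C ∧ (∀ x, ‖f x‖ ≤ C) ∧ (∀ x, ‖fderiv ℝ f x‖ ≤ C) ∧
      (∀ x y, ‖f x - f y‖ ≤ C * ‖x - y‖) ∧
      (∀ x y, ‖fderiv ℝ f x - fderiv ℝ f y‖ ≤ C * ‖x - y‖) ∧
      ∀ x v, ‖f (x + v) - f x - fderiv ℝ f x v‖ ≤ C * ‖v‖ ^ 2 := by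
  obtain ⟨A, hA⟩ := hs.exists_bound_of_continuous hf.continuous
  obtain ⟨B, hB⟩ := (hs.fderiv ℝ).exists_bound_of_continuous (hf.continuous_fderiv (by norm_num))
  obtain ⟨L, hL⟩ := ContDiff.lipschitzWith_of_hasCompactSupport (𝕂 := ℝ) (n := 1) (hs.fderiv ℝ)
    (hf.fderiv_right (by norm_num)) (by norm_num)
  have hL' : ∀ x y, ‖fderiv ℝ f x - fderiv ℝ f y‖ ≤ L * ‖x - y‖ := fun x y => by
    simpa [dist_eq_norm] using hL.dist_le_mul x y
  have hA0 : 0 ≤ A := (norm_nonneg _).trans (hA 0)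
  have hB0 : 0 ≤ B := (norm_nonneg _).trans (hB 0)
  have hL0 : (0 : ℝ) ≤ L := L.2
  refine ⟨A + B + L, by positivity, fun x => (hA x).trans (by linarith),
    fun x => (hB x).trans (by linarith), fun x y => ?_, fun x y => ?_, fun x v => ?_⟩
  · have := convex_univ.norm_image_sub_le_of_norm_fderiv_le (𝕜 := ℝ) (f := f) (C := B) (x := y)
      (y := x) (fun z _ => hf.differentiable (by norm_num) z) (fun z _ => hB z) (mem_univ _)
      (mem_univ _)
    refine this.trans ?_
    gcongr
    linarith
  · refine (hL' x y).trans ?_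
    gcongr
    linarith
  · have := (convex_segment x (x + v)).norm_image_sub_le_of_norm_hasFDerivWithin_le' (𝕜 := ℝ)
      (f := f) (f' := fderiv ℝ f) (φ := fderiv ℝ f x) (C := L * ‖v‖) (x := x) (y := x + v)
      (fun z _ => (hf.differentiable (by norm_num) z).hasFDerivAt.hasFDerivWithinAt)
      (fun z hz => ?_) (left_mem_segment _ _ _) (right_mem_segment _ _ _)
    · rw [add_sub_cancel_left] at this
      refine this.trans ?_
      rw [mul_assoc, ← sq]
      gcongr
      linarith
    · refine (hL' z x).trans ?_
      gcongr
      obtain ⟨a, ⟨ha0, ha1⟩, rfl⟩ := (segment_eq_image' ℝ x (x + v)) ▸ hz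
      simp only [add_sub_cancel_left, norm_smul, Real.norm_eq_abs, abs_of_nonneg ha0]
      exact mul_le_of_le_one_left (norm_nonneg _) ha1

/-- A function that is smooth near a compact set agrees there with a smooth function of compact
support. -/
theorem exists_smooth_extension [FiniteDimensional ℝ E] {K U : Set E} (hK : IsCompact K)
    (hU : IsOpen U) (hKU : K ⊆ U) {f : E → ℝ} (hf : ContDiffOn ℝ ∞ f U) :
    ∃ g : E → ℝ, ContDiff ℝ ∞ g ∧ HasCompactSupport g ∧ EqOn g f K := by
  obtain ⟨L, hL, hKL, hLU⟩ := exists_compact_between hK hU hKU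
  obtain ⟨χ, h1, h0, -⟩ := exists_contMDiffMap_one_nhds_of_subset_interior (n := ⊤)
    (modelWithCornersSelf ℝ E) hK.isClosed hKL
  have hsup : tsupport χ ⊆ L := closure_minimal (fun x hx => by
    by_contra h
    exact hx (h0 x h)) hL.isClosed
  have hχ : ContDiff ℝ ∞ χ := χ.contMDiff.contDiff
  refine ⟨fun x => χ x * f x, ?_, ?_, ?_⟩
  · rw [contDiff_iff_contDiffAt]
    intro x
    by_cases hx : x ∈ U
    · exact hχ.contDiffAt.mul (hf.contDiffAt (hU.mem_nhds hx))
    · have : (fun x => χ x * f x) =ᶠ[𝓝 x] fun _ => 0 := by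
        filter_upwards [hL.isClosed.isOpen_compl.mem_nhds fun h => hx (hLU h)] with y hy
        rw [h0 y hy, zero_mul]
      exact contDiffAt_const.congr_of_eventuallyEq this
  · refine HasCompactSupport.of_support_subset_isCompact hL fun x hx => ?_
    by_contra h
    exact hx (by simp [h0 x h])
  · intro x hx
    have : χ x = 1 := h1.self_of_nhdsSet x hx
    simp [this]

end CompactSupport

/-! ### Weak time derivatives -/

section TimeDerivative

variable {H X : Type*} [NormedAddCommGroup H] [NormedSpace ℝ H] [NormedAddCommGroup X]
  [NormedSpace ℝ X] {T : ℝ}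

theorem HasWeakTimeDeriv.congr {u u' w w' : ℝ → X} (h : HasWeakTimeDeriv T u u')
    (hu : u =ᵐ[volume.restrict (Icc 0 T)] w) (hu' : u' =ᵐ[volume.restrict (Icc 0 T)] w') :
    HasWeakTimeDeriv T w w' := by
  refine ⟨h.1.congr hu, h.2.1.congr hu', fun φ h1 h2 h3 => ?_⟩
  have e1 : ∫ t in Icc 0 T, deriv φ t • w t = ∫ t in Icc 0 T, deriv φ t • u t :=
    integral_congr_ae (hu.mono fun t ht => by simp only [ht])
  have e2 : ∫ t in Icc 0 T, φ t • w' t = ∫ t in Icc 0 T, φ t • u' t :=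
    integral_congr_ae (hu'.mono fun t ht => by simp only [ht])
  rw [e1, e2, h.2.2 φ h1 h2 h3]

theorem integrable_smul_of_test {μ : Measure ℝ} {φ : ℝ → ℝ} (h1 : Continuous φ)
    (h2 : HasCompactSupport φ) {u : ℝ → X} (hu : Integrable u μ) :
    Integrable (fun t => φ t • u t) μ := by
  obtain ⟨C, hC⟩ := h2.exists_bound_of_continuous h1
  exact hu.bdd_smul C h1.aestronglyMeasurable (ae_of_all _ hC)

theorem HasWeakTimeDeriv.clm_comp [CompleteSpace H] [CompleteSpace X] {u u' : ℝ → H}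
    (h : HasWeakTimeDeriv T u u') (L : H →L[ℝ] X) :
    HasWeakTimeDeriv T (fun t => L (u t)) fun t => L (u' t) := by
  refine ⟨L.integrable_comp h.1, L.integrable_comp h.2.1, fun φ h1 h2 h3 => ?_⟩
  simp_rw [← map_smul]
  have hd : Continuous (deriv φ) := h1.continuous_deriv (by simp)
  rw [L.integral_comp_comm (integrable_smul_of_test hd h2.deriv h.1),
    L.integral_comp_comm (integrable_smul_of_test h1.continuous h2 h.2.1), h.2.2 φ h1 h2 h3,
    map_neg]

theorem HasWeakTimeDeriv.add {u u' w w' : ℝ → X}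
    (h : HasWeakTimeDeriv T u u') (k : HasWeakTimeDeriv T w w') :
    HasWeakTimeDeriv T (fun t => u t + w t) fun t => u' t + w' t := by
  refine ⟨h.1.add k.1, h.2.1.add k.2.1, fun φ h1 h2 h3 => ?_⟩
  have hd : Continuous (deriv φ) := h1.continuous_deriv (by simp)
  simp_rw [smul_add]
  rw [integral_add (integrable_smul_of_test hd h2.deriv h.1)
    (integrable_smul_of_test hd h2.deriv k.1),
    integral_add (integrable_smul_of_test h1.continuous h2 h.2.1)
    (integrable_smul_of_test h1.continuous h2 k.2.1), h.2.2 φ h1 h2 h3, k.2.2 φ h1 h2 h3, neg_add]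

theorem HasWeakTimeDeriv.prodMk [CompleteSpace H] [CompleteSpace X] {u u' : ℝ → H} {w w' : ℝ → X}
    (h : HasWeakTimeDeriv T u u') (k : HasWeakTimeDeriv T w w') :
    HasWeakTimeDeriv T (fun t => (u t, w t)) fun t => (u' t, w' t) := by
  have := (h.clm_comp (ContinuousLinearMap.inl ℝ H X)).add
    (k.clm_comp (ContinuousLinearMap.inr ℝ H X))
  simpa using this

theorem continuousOn_primitive_Icc {v : ℝ → H} (hT : 0 < T) (hv : IntegrableOn v (Icc 0 T)) :
    ContinuousOn (fun t => ∫ s in (0 : ℝ)..t, v s) (Icc 0 T) := by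
  have := intervalIntegral.continuousOn_primitive_interval (a := 0) (b := T) (f := v) (μ := volume)
    (by rwa [uIcc_of_le hT.le])
  rwa [uIcc_of_le hT.le] at this

/-- The chain rule for a primitive: the density `v` is approximated in `L¹` by continuous functions,
for which the classical chain rule holds. -/
theorem hasWeakTimeDeriv_comp_primitive [CompleteSpace H] [CompleteSpace X] (hT : 0 < T)
    {v : ℝ → H} (hv : IntegrableOn v (Icc 0 T)) (c : H) {Φ : H → X} {Φ' : H → H →L[ℝ] X}
    (hΦ : ∀ u, HasFDerivAt Φ (Φ' u) u) {C : ℝ} (hC : ∀ u, ‖Φ' u‖ ≤ C)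
    (hL : ∀ u w, ‖Φ' u - Φ' w‖ ≤ C * ‖u - w‖) :
    HasWeakTimeDeriv T (fun t => Φ (c + ∫ s in (0 : ℝ)..t, v s))
      fun t => Φ' (c + ∫ s in (0 : ℝ)..t, v s) (v t) := by
  have hC0 : 0 ≤ C := (norm_nonneg _).trans (hC 0)
  have hΦc : Continuous Φ := continuous_iff_continuousAt.2 fun u => (hΦ u).continuousAt
  have hΦ'c : Continuous Φ' :=
    (LipschitzWith.of_dist_le_mul (K := ⟨C, hC0⟩) fun u w => by
      rw [dist_eq_norm, dist_eq_norm]; exact hL u w).continuous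
  have hlip : ∀ u w, ‖Φ u - Φ w‖ ≤ C * ‖u - w‖ := fun u w =>
    convex_univ.norm_image_sub_le_of_norm_hasFDerivWithin_le (𝕜 := ℝ)
      (fun z _ => (hΦ z).hasFDerivWithinAt) (fun z _ => hC z) (mem_univ w) (mem_univ u)
  have hint : ∀ g : ℝ → H, IntegrableOn g (Icc 0 T) →
      IntegrableOn (fun t => Φ (c + ∫ s in (0 : ℝ)..t, g s)) (Icc 0 T) ∧
      IntegrableOn (fun t => Φ' (c + ∫ s in (0 : ℝ)..t, g s) (g t)) (Icc 0 T) := by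
    intro g hg
    have hVc := (continuousOn_const (c := c)).add (continuousOn_primitive_Icc hT hg)
    refine ⟨(hΦc.comp_continuousOn hVc).integrableOn_compact isCompact_Icc, ?_⟩
    refine (hg.norm.const_mul C).mono' ?_ (ae_of_all _ fun t => (Φ' _).le_of_opNorm_le (hC _) _)
    exact isBoundedBilinearMap_apply.continuous.comp_aestronglyMeasurable
      (((hΦ'c.comp_continuousOn hVc).aestronglyMeasurable measurableSet_Icc).prodMk hg.1)
  refine ⟨(hint v hv).1, (hint v hv).2, fun φ h1 h2 h3 => ?_⟩
  have hd : Continuous (deriv φ) := h1.continuous_deriv (by simp)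
  obtain ⟨B₁, hB₁⟩ := h2.exists_bound_of_continuous h1.continuous
  obtain ⟨B₂, hB₂⟩ := h2.deriv.exists_bound_of_continuous hd
  have hB₁0 : 0 ≤ B₁ := (norm_nonneg _).trans (hB₁ 0)
  have hB₂0 : 0 ≤ B₂ := (norm_nonneg _).trans (hB₂ 0)
  have hφ0 : φ 0 = 0 := image_eq_zero_of_notMem_tsupport fun h => lt_irrefl _ (h3 h).1
  have hφT : φ T = 0 := image_eq_zero_of_notMem_tsupport fun h => lt_irrefl _ (h3 h).2
  set V : ℝ → H := fun t => c + ∫ s in (0 : ℝ)..t, v s with hV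
  rw [eq_neg_iff_add_eq_zero, ← norm_le_zero_iff]
  -- Compare with the identity for the primitive `G` of a continuous `g` that is `ε`-close to `v`.
  have key : ∀ ε > 0, ‖(∫ t in Icc 0 T, deriv φ t • Φ (V t)) + ∫ t in Icc 0 T, φ t • Φ' (V t) (v t)‖
      ≤ (B₂ * C * T + B₁ * C * (1 + ∫ t in Icc 0 T, ‖v t‖)) * ε := by
    intro ε hε
    obtain ⟨g, -, hg, hgc, hgi⟩ := Integrable.exists_hasCompactSupport_integral_sub_le hv hε
    set G : ℝ → H := fun t => c + ∫ s in (0 : ℝ)..t, g s with hG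
    have hGd : ∀ t, HasDerivAt G (g t) t := fun t =>
      (intervalIntegral.integral_hasDerivAt_right (hgc.intervalIntegrable _ _)
        (hgc.stronglyMeasurableAtFilter _ _) hgc.continuousAt).const_add c
    have hGc : Continuous G := continuous_iff_continuousAt.2 fun t => (hGd t).continuousAt
    have hder : ∀ t, HasDerivAt (fun t => φ t • Φ (G t))
        (φ t • Φ' (G t) (g t) + deriv φ t • Φ (G t)) t := fun t =>
      ((h1.differentiable (by simp) t).hasDerivAt).smul ((hΦ (G t)).comp_hasDerivAt t (hGd t))
    have hzero : ∫ t in Icc 0 T, (φ t • Φ' (G t) (g t) + deriv φ t • Φ (G t)) = 0 := by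
      rw [integral_Icc_eq_integral_Ioc, ← intervalIntegral.integral_of_le hT.le,
        intervalIntegral.integral_eq_sub_of_hasDerivAt (fun t _ => hder t)]
      · simp [hφ0, hφT]
      · refine Continuous.intervalIntegrable ?_ _ _
        exact (h1.continuous.smul ((hΦ'c.comp hGc).clm_apply hgc)).add (hd.smul (hΦc.comp hGc))
    have hdiff : ∀ t ∈ Icc 0 T, ‖V t - G t‖ ≤ ε := by
      intro t ht
      have hsub : Icc 0 t ⊆ Icc 0 T := Icc_subset_Icc_right ht.2
      have i1 : IntervalIntegrable v volume 0 t :=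
        (intervalIntegrable_iff_integrableOn_Icc_of_le ht.1).2 (hv.mono_set hsub)
      simp only [hV, hG, add_sub_add_left_eq_sub]
      rw [← intervalIntegral.integral_sub i1 (hgc.intervalIntegrable _ _),
        intervalIntegral.integral_of_le ht.1, ← integral_Icc_eq_integral_Ioc]
      refine (norm_integral_le_integral_norm _).trans (le_trans ?_ hg)
      exact setIntegral_mono_set (hv.sub hgi).norm (ae_of_all _ fun _ => norm_nonneg _)
        hsub.eventuallyLE
    have i1 := integrable_smul_of_test hd h2.deriv (hint v hv).1
    have i2 := integrable_smul_of_test h1.continuous h2 (hint v hv).2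
    have i3 := integrable_smul_of_test hd h2.deriv (hint g hgi).1
    have i4 := integrable_smul_of_test h1.continuous h2 (hint g hgi).2
    have e : (∫ t in Icc 0 T, deriv φ t • Φ (V t)) + ∫ t in Icc 0 T, φ t • Φ' (V t) (v t) =
        ∫ t in Icc 0 T, (deriv φ t • Φ (V t) + φ t • Φ' (V t) (v t) -
          (φ t • Φ' (G t) (g t) + deriv φ t • Φ (G t))) := by
      have i12 : Integrable (fun t => deriv φ t • Φ (V t) + φ t • Φ' (V t) (v t))
        (volume.restrict (Icc 0 T)) := i1.add i2
      have i34 : Integrable (fun t => φ t • Φ' (G t) (g t) + deriv φ t • Φ (G t))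
        (volume.restrict (Icc 0 T)) := i4.add i3
      rw [integral_sub i12 i34, hzero, sub_zero, ← integral_add i1 i2]
    rw [e]
    have hbound : Integrable (fun t => B₂ * C * ε + (B₁ * C * ‖v t - g t‖ + B₁ * C * ε * ‖v t‖))
        (volume.restrict (Icc 0 T)) :=
      (integrable_const _).add (((hv.sub hgi).norm.const_mul _).add (hv.norm.const_mul _))
    refine (norm_integral_le_of_norm_le hbound ?_).trans ?_
    · filter_upwards [ae_restrict_mem measurableSet_Icc] with t ht
      have a1 : deriv φ t • Φ (V t) + φ t • Φ' (V t) (v t) -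
          (φ t • Φ' (G t) (g t) + deriv φ t • Φ (G t)) =
          deriv φ t • (Φ (V t) - Φ (G t)) + (φ t • Φ' (G t) (v t - g t) +
            φ t • (Φ' (V t) - Φ' (G t)) (v t)) := by
        simp only [smul_sub, map_sub, sub_apply]
        abel
      rw [a1]
      refine (norm_add_le _ _).trans (add_le_add ?_ ((norm_add_le _ _).trans (add_le_add ?_ ?_)))
      · rw [norm_smul, mul_assoc]
        exact mul_le_mul (hB₂ t) ((hlip _ _).trans (by gcongr; exact hdiff t ht))
          (norm_nonneg _) hB₂0
      · rw [norm_smul, mul_assoc]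
        exact mul_le_mul (hB₁ t) ((Φ' _).le_of_opNorm_le (hC _) _) (norm_nonneg _) hB₁0
      · rw [norm_smul, mul_assoc, mul_assoc]
        refine mul_le_mul (hB₁ t) (((Φ' (V t) - Φ' (G t)).le_of_opNorm_le (hL _ _) _).trans ?_)
          (norm_nonneg _) hB₁0
        rw [← mul_assoc]
        gcongr
        exact hdiff t ht
    · have j1 : Integrable (fun t => B₁ * C * ‖v t - g t‖) (volume.restrict (Icc 0 T)) :=
        (hv.sub hgi).norm.const_mul _
      have j2 : Integrable (fun t => B₁ * C * ε * ‖v t‖) (volume.restrict (Icc 0 T)) :=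
        hv.norm.const_mul _
      have j12 : Integrable (fun t => B₁ * C * ‖v t - g t‖ + B₁ * C * ε * ‖v t‖)
        (volume.restrict (Icc 0 T)) := j1.add j2
      rw [integral_add (integrable_const _) j12, integral_add j1 j2, integral_const,
        integral_const_mul, integral_const_mul]
      have hvol : (volume.restrict (Icc 0 T)).real univ = T := by
        simp [Measure.real, hT.le]
      rw [hvol, smul_eq_mul]
      have : B₁ * C * ∫ t in Icc 0 T, ‖v t - g t‖ ≤ B₁ * C * ε := by gcongr
      linarith
  refine le_of_forall_pos_le_add fun δ hδ => ?_
  set K := B₂ * C * T + B₁ * C * (1 + ∫ t in Icc 0 T, ‖v t‖)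
  have hK : 0 ≤ K := by
    have : 0 ≤ ∫ t in Icc 0 T, ‖v t‖ := integral_nonneg fun _ => norm_nonneg _
    positivity
  refine (key (δ / (K + 1)) (by positivity)).trans ?_
  rw [zero_add, mul_div_assoc', div_le_iff₀ (by positivity)]
  nlinarith

/-- The lemma of du Bois-Reymond: a function with vanishing weak derivative is constant. -/
theorem ae_eq_const_of_weakDeriv_zero [CompleteSpace X] (hT : 0 < T) {z : ℝ → X}
    (hz : IntegrableOn z (Icc 0 T))
    (h : ∀ φ : ℝ → ℝ, ContDiff ℝ ∞ φ → HasCompactSupport φ → tsupport φ ⊆ Ioo 0 T →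
      ∫ t in Icc 0 T, deriv φ t • z t = 0) :
    ∃ c, ∀ᵐ t ∂volume.restrict (Icc 0 T), z t = c := by
  -- A test function `g` differs from a multiple of the fixed bump `ψ` by the derivative of a test
  -- function, so that `∫ g z = (∫ g) (∫ ψ z)`.
  let b : ContDiffBump (T / 2) := ⟨T / 8, T / 4, by positivity, by linarith⟩
  set ψ := b.normed volume with hψ
  have hψ1 : ContDiff ℝ ∞ ψ := b.contDiff_normed
  have hψ2 : HasCompactSupport ψ := b.hasCompactSupport_normed
  have hψ3 : tsupport ψ ⊆ Ioo 0 T := by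
    rw [hψ, b.tsupport_normed_eq]
    intro x hx
    have : |x - T / 2| ≤ T / 4 := by simpa [Real.dist_eq] using hx
    rw [abs_le] at this
    constructor <;> linarith
  have hψ4 : ∫ x, ψ x = 1 := b.integral_normed
  set c := ∫ t in Icc 0 T, ψ t • z t with hc
  refine ⟨c, ?_⟩
  have hres : ∀ (g : ℝ → ℝ) (f : ℝ → X), tsupport g ⊆ Ioo 0 T →
      ∫ x, g x • f x = ∫ x in Icc 0 T, g x • f x := fun g f hg =>
    (setIntegral_eq_integral_of_forall_compl_eq_zero fun x hx => by
      rw [image_eq_zero_of_notMem_tsupport fun h => hx (Ioo_subset_Icc_self (hg h)),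
        zero_smul]).symm
  have key := isOpen_Ioo.ae_eq_zero_of_integral_contDiff_smul_eq_zero (μ := volume) (E := ℝ)
    (U := Ioo 0 T)
    (f := fun t => z t - c) ?_ ?_
  · rw [Measure.restrict_congr_set Ioo_ae_eq_Icc.symm, ae_restrict_iff' measurableSet_Ioo]
    filter_upwards [key] with t ht hmem using sub_eq_zero.1 (ht hmem)
  · exact ((hz.mono_set Ioo_subset_Icc_self).sub
      (integrableOn_const (by simp))).locallyIntegrableOn
  · intro g hg1 hg2 hg3
    set w : ℝ → ℝ := fun x => g x - (∫ y, g y) * ψ x with hw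
    have hw1 : ContDiff ℝ ∞ w := hg1.sub (contDiff_const.mul hψ1)
    have hw2 : HasCompactSupport w := hg2.sub hψ2.mul_left
    have hw3 : tsupport w ⊆ Ioo 0 T := by
      refine (tsupport_sub (f := g) (g := fun x => (∫ y, g y) * ψ x)).trans (union_subset hg3 ?_)
      exact (tsupport_mul_subset_right (f := fun _ => ∫ y, g y) (g := ψ)).trans hψ3
    have hgi : Integrable g := hg1.continuous.integrable_of_hasCompactSupport hg2
    have hψi : Integrable ψ := hψ1.continuous.integrable_of_hasCompactSupport hψ2
    have hwi : Integrable w := hw1.continuous.integrable_of_hasCompactSupport hw2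
    have hw4 : ∫ x, w x = 0 := by
      simp only [hw]
      rw [integral_sub hgi (hψi.const_mul _), integral_const_mul, hψ4, mul_one, sub_self]
    obtain ⟨α, β, hα, hβ, hαβ⟩ : ∃ α β : ℝ, 0 < α ∧ β < T ∧ tsupport w ⊆ Icc α β := by
      rcases (tsupport w).eq_empty_or_nonempty with he | hne
      · exact ⟨T / 2, T / 2, by linarith, by linarith, by simp [he]⟩
      · refine ⟨sInf (tsupport w), sSup (tsupport w), (hw3 (hw2.isCompact.sInf_mem hne)).1,
          (hw3 (hw2.isCompact.sSup_mem hne)).2, fun x hx => ⟨?_, ?_⟩⟩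
        · exact csInf_le hw2.isCompact.bddBelow hx
        · exact le_csSup hw2.isCompact.bddAbove hx
    set φ : ℝ → ℝ := fun x => ∫ y in (0 : ℝ)..x, w y with hφ
    have hφd : ∀ x, HasDerivAt φ (w x) x := fun x =>
      intervalIntegral.integral_hasDerivAt_right (hw1.continuous.intervalIntegrable _ _)
        (hw1.continuous.stronglyMeasurableAtFilter _ _) hw1.continuous.continuousAt
    have hφd' : deriv φ = w := funext fun x => (hφd x).deriv
    have hφ1 : ContDiff ℝ ∞ φ :=
      contDiff_infty_iff_deriv.2 ⟨fun x => (hφd x).differentiableAt, hφd' ▸ hw1⟩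
    have hw0 : ∀ x, x ∉ Icc α β → w x = 0 := fun x hx =>
      image_eq_zero_of_notMem_tsupport fun h => hx (hαβ h)
    have hφ0 : ∀ x, x ∉ Icc α β → φ x = 0 := by
      intro x hx
      rcases lt_or_ge x α with hlt | hge
      · refine (intervalIntegral.integral_congr (g := fun _ => 0) fun y hy => hw0 y fun hy' => ?_).trans
          (by simp)
        have := hy.2
        have := hy'.1
        rcases le_max_iff.1 ‹y ≤ max 0 x› with h' | h' <;> linarith
      · have hxβ : β < x := lt_of_not_ge fun h => hx ⟨hge, h⟩
        have hx0 : 0 ≤ x := by linarith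
        simp only [hφ]
        rw [intervalIntegral.integral_of_le hx0, ← hw4]
        refine setIntegral_eq_integral_of_forall_compl_eq_zero fun y hy => hw0 y fun hy' => hy ?_
        exact ⟨by linarith [hy'.1], by linarith [hy'.2]⟩
    have hφs : tsupport φ ⊆ Icc α β := closure_minimal (fun x hx => by
      by_contra hc
      exact hx (hφ0 x hc)) isClosed_Icc
    have hφ2 : HasCompactSupport φ :=
      isCompact_Icc.of_isClosed_subset (isClosed_tsupport _) hφs
    have h0 := h φ hφ1 hφ2 (hφs.trans fun x hx => ⟨by linarith [hx.1], by linarith [hx.2]⟩)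
    rw [hφd'] at h0
    have k1 := integrable_smul_of_test hg1.continuous hg2 hz
    have k2 := integrable_smul_of_test hψ1.continuous hψ2 hz
    rw [hres g _ hg3]
    simp_rw [hw, sub_smul, mul_smul] at h0
    have k3 : Integrable (fun t => (∫ y, g y) • ψ t • z t) (volume.restrict (Icc 0 T)) :=
      k2.smul (∫ y, g y)
    rw [integral_sub k1 k3, integral_smul, ← hc] at h0
    simp_rw [smul_sub]
    rw [integral_sub k1 (hgi.integrableOn.smul_const c), integral_smul_const,
      setIntegral_eq_integral_of_forall_compl_eq_zero (s := Icc 0 T) (f := g), h0]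
    exact fun x hx => image_eq_zero_of_notMem_tsupport fun h => hx (Ioo_subset_Icc_self (hg3 h))

/-- The chain rule for weak time derivatives and functions with a bounded and Lipschitz
derivative. -/
theorem HasWeakTimeDeriv.comp [CompleteSpace H] [CompleteSpace X] (hT : 0 < T)
    {u u' : ℝ → H} (hu : HasWeakTimeDeriv T u u') {Φ : H → X} {Φ' : H → H →L[ℝ] X}
    (hΦ : ∀ u, HasFDerivAt Φ (Φ' u) u) {C : ℝ} (hC : ∀ u, ‖Φ' u‖ ≤ C)
    (hL : ∀ u w, ‖Φ' u - Φ' w‖ ≤ C * ‖u - w‖) :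
    HasWeakTimeDeriv T (fun t => Φ (u t)) fun t => Φ' (u t) (u' t) := by
  have hU := hasWeakTimeDeriv_comp_primitive (Φ := fun x : H => x)
    (Φ' := fun _ => ContinuousLinearMap.id ℝ H) (C := 1) hT hu.2.1 0
    (fun u => hasFDerivAt_id u) (fun _ => ContinuousLinearMap.norm_id_le) (by simp)
  obtain ⟨c, hc⟩ := ae_eq_const_of_weakDeriv_zero hT
    (z := fun t => u t - (0 + ∫ s in (0 : ℝ)..t, u' s)) (hu.1.sub hU.1) (by
      intro φ h1 h2 h3
      have hd : Continuous (deriv φ) := h1.continuous_deriv (by simp)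
      simp_rw [smul_sub]
      rw [integral_sub (integrable_smul_of_test hd h2.deriv hu.1)
        (integrable_smul_of_test hd h2.deriv hU.1), hu.2.2 φ h1 h2 h3, hU.2.2 φ h1 h2 h3]
      simp)
  have hc' : ∀ᵐ t ∂volume.restrict (Icc 0 T), c + ∫ s in (0 : ℝ)..t, u' s = u t := by
    filter_upwards [hc] with t ht
    rw [← ht]
    simp
  refine (hasWeakTimeDeriv_comp_primitive hT hu.2.1 c hΦ hC hL).congr ?_ ?_
  · filter_upwards [hc'] with t ht
    simp only [ht]
  · filter_upwards [hc'] with t ht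
    simp only [ht]

theorem HasWeakTimeDeriv.deriv_eq_zero_of_const [CompleteSpace X] {u u' : ℝ → X}
    (hu : HasWeakTimeDeriv T u u') {c : X}
    (hc : ∀ᵐ t ∂volume.restrict (Icc 0 T), u t = c) :
    ∀ᵐ t ∂volume.restrict (Icc 0 T), u' t = 0 := by
  have key := isOpen_Ioo.ae_eq_zero_of_integral_contDiff_smul_eq_zero (μ := volume) (E := ℝ)
    (U := Ioo 0 T) (f := u') (hu.2.1.mono_set Ioo_subset_Icc_self).locallyIntegrableOn ?_
  · rw [Measure.restrict_congr_set Ioo_ae_eq_Icc.symm, ae_restrict_iff' measurableSet_Ioo]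
    exact key
  · intro g h1 h2 h3
    have hres : ∀ (g : ℝ → ℝ) (f : ℝ → X), tsupport g ⊆ Ioo 0 T →
        ∫ x, g x • f x = ∫ x in Icc 0 T, g x • f x := fun g f hg =>
      (setIntegral_eq_integral_of_forall_compl_eq_zero fun x hx => by
        rw [image_eq_zero_of_notMem_tsupport fun h => hx (Ioo_subset_Icc_self (hg h)),
          zero_smul]).symm
    have hd : Continuous (deriv g) := h1.continuous_deriv (by simp)
    have h4 : tsupport (deriv g) ⊆ Ioo 0 T := tsupport_deriv_subset.trans h3
    rw [hres g _ h3, ← neg_eq_zero, ← hu.2.2 g h1 h2 h3]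
    have e : ∫ t in Icc 0 T, deriv g t • u t = ∫ t in Icc 0 T, deriv g t • c :=
      integral_congr_ae (hc.mono fun t ht => by simp only [ht])
    rw [e, ← hres _ _ h4, integral_smul_const,
      integral_eq_zero_of_hasDerivAt_of_integrable
        (fun x => (h1.differentiable (by simp) x).hasDerivAt)
        (hd.integrable_of_hasCompactSupport h2.deriv)
        (h1.continuous.integrable_of_hasCompactSupport h2), zero_smul]

end TimeDerivative

/-! ### Partial derivatives -/

theorem contDiff_pd {m n : ℕ∞ω} {f : E3 → ℝ} (hf : ContDiff ℝ n f) (hmn : m + 1 ≤ n) (i : Fin 3) :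
    ContDiff ℝ m (pd i f) :=
  (hf.fderiv_right hmn).clm_apply contDiff_const

theorem contDiff_pd_infty {f : E3 → ℝ} (hf : ContDiff ℝ ∞ f) (i : Fin 3) :
    ContDiff ℝ ∞ (pd i f) :=
  contDiff_pd hf (by simp) i

theorem tsupport_pd_subset (f : E3 → ℝ) (i : Fin 3) : tsupport (pd i f) ⊆ tsupport f :=
  tsupport_fderiv_apply_subset ℝ _

theorem hasCompactSupport_pd {f : E3 → ℝ} (hf : HasCompactSupport f) (i : Fin 3) :
    HasCompactSupport (pd i f) :=
  hf.of_isClosed_subset (isClosed_tsupport _) (tsupport_pd_subset f i)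

theorem fderiv_apply_eq_sum (f : E3 → ℝ) (x v : E3) :
    fderiv ℝ f x v = ∑ i, v i * pd i f x := by
  have hv : v = ∑ i, v i • EuclideanSpace.single i (1 : ℝ) := by
    ext j
    simp [Pi.single_apply]
  conv_lhs => rw [hv]
  simp [pd]

theorem pd_eq_zero_of_notMem_tsupport {f : E3 → ℝ} {x : E3} (hx : x ∉ tsupport f) (i : Fin 3) :
    pd i f x = 0 :=
  image_eq_zero_of_notMem_tsupport fun h => hx (tsupport_pd_subset f i h)

theorem pd_mul {f g : E3 → ℝ} {x : E3} (hf : DifferentiableAt ℝ f x)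
    (hg : DifferentiableAt ℝ g x) (i : Fin 3) :
    pd i (fun y => f y * g y) x = f x * pd i g x + g x * pd i f x := by
  simp [pd, fderiv_fun_mul hf hg]

/-! ### Smooth families of functionals on `L¹` -/

section Translation

open BoundedContinuousFunction

/-- The translates `y ↦ φ (x - y)` of a compactly supported function, as a family of bounded
continuous functions parametrized by `x`. -/
def translate (φ : E3 → ℝ) (h : Continuous φ) (hs : HasCompactSupport φ) (x : E3) : E3 →ᵇ ℝ :=
  BoundedContinuousFunction.ofNormedAddCommGroup (fun y => φ (x - y)) (by fun_prop)
    (hs.exists_bound_of_continuous h).choose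
    fun y => (hs.exists_bound_of_continuous h).choose_spec (x - y)

/-- The derivative of a family of translates is made of the translates of the partial
derivatives. -/
theorem hasFDerivAt_translate {φ : E3 → ℝ} (h : ContDiff ℝ ∞ φ) (hs : HasCompactSupport φ)
    (x : E3) :
    HasFDerivAt (translate φ h.continuous hs)
      (∑ i, ContinuousLinearMap.smulRight (EuclideanSpace.proj i : E3 →L[ℝ] ℝ)
        (translate (pd i φ) (contDiff_pd_infty h i).continuous (hasCompactSupport_pd hs i) x)) x := by
  obtain ⟨C, hC, -, -, -, -, hT⟩ := exists_taylor_bound (h.of_le (by norm_cast)) hs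
  rw [hasFDerivAt_iff_isLittleO_nhds_zero]
  refine (Asymptotics.IsBigO.of_bound C (g := fun v : E3 => ‖v‖ ^ 2) ?_).trans_isLittleO ?_
  · refine Eventually.of_forall fun v => ?_
    rw [Real.norm_eq_abs, abs_of_nonneg (by positivity : (0 : ℝ) ≤ ‖v‖ ^ 2),
      norm_le (by positivity)]
    intro y
    have := hT (x - y) v
    rw [fderiv_apply_eq_sum] at this
    simpa [translate, add_sub_right_comm, _root_.sum_apply] using this
  · exact (Asymptotics.isLittleO_norm_pow_id one_lt_two)

theorem contDiff_translate (n : ℕ) : ∀ {φ : E3 → ℝ} (h : ContDiff ℝ ∞ φ)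
    (hs : HasCompactSupport φ), ContDiff ℝ n (translate φ h.continuous hs) := by
  induction n with
  | zero =>
    intro φ h hs
    exact contDiff_zero.2 (continuous_iff_continuousAt.2 fun x =>
      (hasFDerivAt_translate h hs x).continuousAt)
  | succ n ih =>
    intro φ h hs
    refine contDiff_succ_iff_hasFDerivAt.2 ⟨_, ?_, hasFDerivAt_translate h hs⟩
    exact ContDiff.sum fun i _ => contDiff_const.smulRight
      (ih (contDiff_pd_infty h i) (hasCompactSupport_pd hs i))

variable (μ : Measure E3)

/-- Bounded continuous functions act on `L¹` by integration. -/
def pairing : (E3 →ᵇ ℝ) →L[ℝ] Lp ℝ 1 μ →L[ℝ] ℝ :=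
  LinearMap.mkContinuous₂ (LinearMap.mk₂ ℝ (fun (ψ : E3 →ᵇ ℝ) (ρ : Lp ℝ 1 μ) => ∫ y, ψ y * ρ y ∂μ)
    (fun ψ ψ' ρ => by
      have h := fun ψ : E3 →ᵇ ℝ => (L1.integrable_coeFn ρ).bdd_mul (c := ‖ψ‖)
        ψ.continuous.aestronglyMeasurable (ae_of_all _ ψ.norm_coe_le_norm)
      simp_rw [BoundedContinuousFunction.add_apply, add_mul]
      exact integral_add (h ψ) (h ψ'))
    (fun c ψ ρ => by simp [mul_assoc, integral_const_mul])
    (fun ψ ρ ρ' => by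
      have h := fun ρ : Lp ℝ 1 μ => (L1.integrable_coeFn ρ).bdd_mul (c := ‖ψ‖)
        ψ.continuous.aestronglyMeasurable (ae_of_all _ ψ.norm_coe_le_norm)
      rw [← integral_add (h ρ) (h ρ')]
      refine integral_congr_ae ((Lp.coeFn_add ρ ρ').mono fun y hy => ?_)
      simp only
      rw [hy, Pi.add_apply, mul_add])
    (fun c ψ ρ => by
      rw [smul_eq_mul, ← integral_const_mul]
      refine integral_congr_ae ((Lp.coeFn_smul c ρ).mono fun y hy => ?_)
      simp [hy, mul_left_comm])) 1 (fun ψ ρ => by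
      rw [one_mul, L1.norm_eq_integral_norm, ← integral_const_mul]
      refine norm_integral_le_of_norm_le ((L1.integrable_coeFn ρ).norm.const_mul _)
        (ae_of_all _ fun y => ?_)
      rw [norm_mul]
      gcongr
      exact ψ.norm_coe_le_norm y)

/-- The functionals `ρ ↦ ∫ φ (x - y) ρ y`, parametrized by `x`. -/
def kernelForm (φ : E3 → ℝ) (h : ContDiff ℝ ∞ φ) (hs : HasCompactSupport φ) (x : E3) :
    Lp ℝ 1 μ →L[ℝ] ℝ :=
  pairing μ (translate φ h.continuous hs x)

variable {μ}

theorem kernelForm_apply {φ : E3 → ℝ} (h : ContDiff ℝ ∞ φ) (hs : HasCompactSupport φ) (x : E3)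
    (ρ : Lp ℝ 1 μ) : kernelForm μ φ h hs x ρ = ∫ y, φ (x - y) * ρ y ∂μ := rfl

theorem contDiff_kernelForm {φ : E3 → ℝ} (h : ContDiff ℝ ∞ φ) (hs : HasCompactSupport φ) :
    ContDiff ℝ ∞ (kernelForm μ φ h hs) :=
  contDiff_infty.2 fun n => (pairing μ).contDiff.comp (contDiff_translate n h hs)

theorem pd_kernelForm {φ : E3 → ℝ} (h : ContDiff ℝ ∞ φ) (hs : HasCompactSupport φ) (i : Fin 3)
    (ρ : Lp ℝ 1 μ) (x : E3) :
    pd i (fun x => kernelForm μ φ h hs x ρ) x =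
      kernelForm μ (pd i φ) (contDiff_pd_infty h i) (hasCompactSupport_pd hs i) x ρ := by
  have hd : HasFDerivAt (fun x => kernelForm μ φ h hs x ρ) _ x :=
    ((ContinuousLinearMap.apply ℝ ℝ ρ).comp (pairing μ)).hasFDerivAt.comp x
      (hasFDerivAt_translate h hs x)
  rw [pd, hd.fderiv]
  simp [_root_.sum_apply, kernelForm, ite_smul]

theorem exists_norm_kernelForm_le {φ : E3 → ℝ} (h : ContDiff ℝ ∞ φ) (hs : HasCompactSupport φ) :
    ∃ C, 0 ≤ C ∧ ∀ (μ : Measure E3) (x : E3), ‖kernelForm μ φ h hs x‖ ≤ C := by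
  obtain ⟨C, hC⟩ := hs.exists_bound_of_continuous h.continuous
  have hC0 : 0 ≤ C := (norm_nonneg _).trans (hC 0)
  refine ⟨C, hC0, fun μ x => ContinuousLinearMap.opNorm_le_bound _ hC0 fun ρ => ?_⟩
  rw [kernelForm_apply, L1.norm_eq_integral_norm, ← integral_const_mul]
  refine norm_integral_le_of_norm_le ((L1.integrable_coeFn ρ).norm.const_mul _)
    (ae_of_all _ fun y => ?_)
  rw [norm_mul]
  gcongr
  exact hC _

end Translation

/-! ### Geometry of the domain -/

theorem continuous_hor : Continuous hor := by
  unfold hor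
  fun_prop

namespace Domain

variable (D : Domain)

theorem isOpen_Ω : IsOpen D.Ω :=
  (D.isOpen_M.preimage continuous_hor).inter
    ((isOpen_lt continuous_const (by fun_prop : Continuous fun x : E3 => x 2)).inter
      (isOpen_lt (by fun_prop : Continuous fun x : E3 => x 2) continuous_const))

theorem nonempty_Ω : D.Ω.Nonempty := by
  obtain ⟨p, hp⟩ := D.isConnected_M.nonempty
  refine ⟨lift3 p (-D.h / 2), ?_, ?_, ?_⟩
  · convert hp
    ext i
    fin_cases i <;> rfl
  · change -D.h < -D.h / 2
    linarith [D.h_pos]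
  · change -D.h / 2 < 0
    linarith [D.h_pos]

theorem isBounded_Ω : Bornology.IsBounded D.Ω := by
  obtain ⟨R, hR⟩ := D.isBounded_M.exists_norm_le
  refine (Metric.isBounded_iff_subset_closedBall (0 : E3)).2 ⟨R + D.h, fun x hx => ?_⟩
  have h1 := hR _ hx.1
  have hR0 : 0 ≤ R := (norm_nonneg _).trans h1
  rw [EuclideanSpace.norm_eq, Real.sqrt_le_left hR0] at h1
  rw [mem_closedBall_zero_iff, EuclideanSpace.norm_eq,
    Real.sqrt_le_left (by linarith [D.h_pos])]
  simp only [Fin.sum_univ_two, Fin.sum_univ_three, Real.norm_eq_abs, sq_abs, hor] at h1 ⊢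
  have h2 := hx.2.1
  have h3 := hx.2.2
  have h4 : x 0 ^ 2 + x 1 ^ 2 ≤ R ^ 2 := by simpa using h1
  have h5 : 0 ≤ R * D.h := mul_nonneg hR0 D.h_pos.le
  nlinarith

instance isFiniteMeasure_μ : IsFiniteMeasure D.μ :=
  ⟨by simpa using D.isBounded_Ω.measure_lt_top⟩

theorem measure_univ_pos : 0 < D.μ univ := by
  simpa using D.isOpen_Ω.measure_pos volume D.nonempty_Ω

theorem ae_mem_Ω : ∀ᵐ x ∂D.μ, x ∈ D.Ω := ae_restrict_mem D.isOpen_Ω.measurableSet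

/-- The points of `Ω` at distance at least `δ` from the boundary. -/
def core (δ : ℝ) : Set E3 := {x ∈ D.Ω | δ ≤ Metric.infDist x (frontier D.Ω)}

theorem isCompact_core {δ : ℝ} (hδ : 0 < δ) : IsCompact (D.core δ) := by
  have h : D.core δ = closure D.Ω ∩ {x | δ ≤ Metric.infDist x (frontier D.Ω)} := by
    ext x
    refine ⟨fun hx => ⟨subset_closure hx.1, hx.2⟩, fun hx => ⟨?_, hx.2⟩⟩
    by_contra hΩ
    have hf : x ∈ frontier D.Ω := ⟨hx.1, fun h => hΩ (interior_subset h)⟩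
    have := hx.2
    rw [mem_ofPred_eq, Metric.infDist_zero_of_mem hf] at this
    linarith
  rw [h]
  exact D.isBounded_Ω.isCompact_closure.inter_right
    (isClosed_le continuous_const (Metric.continuous_infDist_pt _))

theorem ball_subset_Ω {x : E3} (hx : x ∈ D.Ω) :
    Metric.ball x (Metric.infDist x (frontier D.Ω)) ⊆ D.Ω := by
  intro y hy
  have hpos : 0 < Metric.infDist x (frontier D.Ω) := dist_nonneg.trans_lt hy
  have hconn : IsPreconnected (Metric.ball x (Metric.infDist x (frontier D.Ω))) :=
    (convex_ball _ _).isPreconnected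
  have hdisj : Disjoint (Metric.ball x (Metric.infDist x (frontier D.Ω))) (frontier D.Ω) :=
    Metric.disjoint_ball_infDist
  by_contra hyΩ
  refine hconn.subset_left_of_subset_union (u := D.Ω) (v := (closure D.Ω)ᶜ) D.isOpen_Ω
    isClosed_closure.isOpen_compl ?_ ?_ ⟨x, Metric.mem_ball_self hpos, hx⟩ hy |> hyΩ
  · exact disjoint_left.2 fun z hz hz' => hz' (subset_closure hz)
  · intro z hz
    by_cases hzΩ : z ∈ D.Ω
    · exact Or.inl hzΩ
    · refine Or.inr fun hc => disjoint_left.1 hdisj hz ⟨hc, fun h => hzΩ (interior_subset h)⟩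

end Domain

/-! ### The kernel, the cut-off and the slope -/

namespace Kernel

variable (k : Kernel)

theorem contDiff_jη : ContDiff ℝ ∞ k.jη :=
  contDiff_const.mul (k.smooth.comp (contDiff_const_smul _))

theorem tsupport_jη_subset : tsupport k.jη ⊆ Metric.closedBall 0 (k.η / 2) := by
  refine closure_minimal (fun x hx => ?_) Metric.isClosed_closedBall
  rw [mem_closedBall_zero_iff]
  by_contra h
  refine hx ?_
  have hη := k.η_pos
  rw [Kernel.jη, k.support, mul_zero]
  rw [norm_smul, Real.norm_eq_abs, abs_of_pos (by positivity), div_mul_eq_mul_div,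
    le_div_iff₀ hη]
  linarith [not_le.1 h]

theorem hasCompactSupport_jη : HasCompactSupport k.jη :=
  (isCompact_closedBall _ _).of_isClosed_subset (isClosed_tsupport _) k.tsupport_jη_subset

/-- The functional `ρ ↦ ∂ᵢ (j_η * ρ) (x)` on `L¹(Ω)`. -/
def form (D : Domain) (i : Fin 3) : E3 → Lp ℝ 1 D.μ →L[ℝ] ℝ :=
  kernelForm D.μ (pd i k.jη) (contDiff_pd_infty k.contDiff_jη i)
    (hasCompactSupport_pd k.hasCompactSupport_jη i)

theorem form_apply (D : Domain) (i : Fin 3) (x : E3) (ρ : Lp ℝ 1 D.μ) :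
    k.form D i x ρ = ∫ y, pd i k.jη (x - y) * ρ y ∂D.μ := rfl

theorem contDiff_form (D : Domain) (i : Fin 3) : ContDiff ℝ ∞ (k.form D i) :=
  contDiff_kernelForm _ _

theorem exists_norm_form_le : ∃ C, 0 ≤ C ∧ ∀ (D : Domain) (i : Fin 3) (x : E3),
    ‖k.form D i x‖ ≤ C := by
  choose C hC0 hC using fun i => exists_norm_kernelForm_le (contDiff_pd_infty k.contDiff_jη i)
    (hasCompactSupport_pd k.hasCompactSupport_jη i)
  refine ⟨∑ i, C i, Finset.sum_nonneg fun i _ => hC0 i, fun D i x => (hC i D.μ x).trans ?_⟩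
  exact Finset.single_le_sum (fun i _ => hC0 i) (Finset.mem_univ i)

/-- The kernel `y ↦ ∂ᵢ j_η (x - y)` for a point `x` away from the boundary is a test function. -/
theorem isTest_pd_jη {D : Domain} {x : E3} (hx : x ∈ D.core k.η) (i : Fin 3) :
    IsTest D.Ω fun y => pd i k.jη (x - y) := by
  have hsub : tsupport (fun y => pd i k.jη (x - y)) ⊆ Metric.closedBall x (k.η / 2) := by
    refine closure_minimal (fun y hy => ?_) Metric.isClosed_closedBall
    have : x - y ∈ Metric.closedBall (0 : E3) (k.η / 2) :=
      k.tsupport_jη_subset (tsupport_pd_subset _ i (subset_tsupport _ hy))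
    rw [mem_closedBall_zero_iff] at this
    rwa [Metric.mem_closedBall, dist_comm, dist_eq_norm]
  refine ⟨(contDiff_pd_infty k.contDiff_jη i).comp (contDiff_const.sub contDiff_id),
    (isCompact_closedBall _ _).of_isClosed_subset (isClosed_tsupport _) hsub,
    hsub.trans (subset_trans ?_ (D.ball_subset_Ω hx.1))⟩
  exact Metric.closedBall_subset_ball (by linarith [hx.2, k.η_pos])

end Kernel

namespace Limiter

variable {D : Domain} (l : Limiter D)

theorem ξ_at_one : l.ξ 1 = 0 := by
  have h1 : Tendsto l.ξ (𝓝[<] 1) (𝓝 (l.ξ 1)) :=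
    (l.ξ_smooth.continuous.tendsto 1).mono_left nhdsWithin_le_nhds
  have h2 : Tendsto l.ξ (𝓝[<] 1) (𝓝 0) := by
    refine tendsto_const_nhds.congr' ?_
    filter_upwards [self_mem_nhdsWithin] with s hs using (l.ξ_zero s hs).symm
  exact tendsto_nhds_unique h1 h2

theorem ξ_mem_Icc (s : ℝ) : l.ξ s ∈ Icc (0 : ℝ) 1 := by
  constructor
  · rw [← l.ξ_zero (min s 0) ((min_le_right _ _).trans_lt one_pos)]
    exact l.ξ_mono (min_le_left _ _)
  · rw [← l.ξ_one (max s 2) (le_max_right _ _)]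
    exact l.ξ_mono (le_max_left _ _)

theorem P_mem_Icc (s : ℝ) : l.P s ∈ Icc (0 : ℝ) 1 := by
  constructor
  · rw [← l.P_zero (min s (l.s₀ - l.ε₀)) (min_le_right _ _)]
    exact l.P_mono (min_le_left _ _)
  · rw [← l.P_one (max s l.s₀) (le_max_right _ _)]
    exact l.P_mono (le_max_left _ _)

/-- The factor `Π(|b|) / b` of the slope. -/
def taper (b : ℝ) : ℝ := l.P |b| / b

theorem contDiff_taper : ContDiff ℝ ∞ l.taper := by
  rw [contDiff_iff_contDiffAt]
  intro b
  by_cases hb : b = 0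
  · have hpos : 0 < l.s₀ - l.ε₀ := sub_pos.2 l.ε₀_lt
    have : l.taper =ᶠ[𝓝 b] fun _ => 0 := by
      filter_upwards [(isOpen_lt continuous_abs continuous_const).mem_nhds
        (show |b| < l.s₀ - l.ε₀ by simpa [hb] using hpos)] with s hs
      rw [taper, l.P_zero _ (le_of_lt hs), zero_div]
    exact contDiffAt_const.congr_of_eventuallyEq this
  · exact (l.P_smooth.contDiffAt.comp b (contDiffAt_abs hb)).div contDiffAt_id hb

/-- The slope as a function of the horizontal and the vertical density gradient. -/
def ratio (q : ℝ × ℝ) : ℝ := -(q.1 * l.taper q.2)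

theorem contDiff_ratio : ContDiff ℝ ∞ l.ratio :=
  (contDiff_fst.mul (l.contDiff_taper.comp contDiff_snd)).neg

end Limiter

section Cutoff

variable {D : Domain} (k : Kernel) (l : Limiter D)

open Classical in
/-- The cut-off function, extended by zero outside `Ω`. -/
def cutoffExt (x : E3) : ℝ := if x ∈ D.Ω then cutoff k l x else 0

theorem cutoffExt_mem_Icc (x : E3) : cutoffExt k l x ∈ Icc (0 : ℝ) 1 := by
  unfold cutoffExt
  split_ifs
  · exact l.ξ_mem_Icc _
  · simp

theorem lt_d_of_cutoffExt_ne_zero {x : E3} (hx : cutoffExt k l x ≠ 0) :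
    x ∈ D.Ω ∧ k.η < l.d x := by
  unfold cutoffExt at hx
  split_ifs at hx with h
  · refine ⟨h, ?_⟩
    by_contra hc
    refine hx ?_
    have h1 : l.d x / k.η ≤ 1 := (div_le_one k.η_pos).2 (not_lt.1 hc)
    rcases h1.lt_or_eq with h2 | h2
    · exact l.ξ_zero _ h2
    · rw [cutoff, h2, l.ξ_at_one]
  · exact absurd rfl hx

theorem cutoffExt_eq_zero {x : E3} (hx : x ∉ D.core k.η) : cutoffExt k l x = 0 := by
  by_contra h
  obtain ⟨h1, h2⟩ := lt_d_of_cutoffExt_ne_zero k l h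
  exact hx ⟨h1, h2.le.trans (l.d_le x h1)⟩

theorem hasCompactSupport_cutoffExt : HasCompactSupport (cutoffExt k l) :=
  HasCompactSupport.intro (D.isCompact_core k.η_pos) fun _ hx => cutoffExt_eq_zero k l hx

theorem contDiff_cutoffExt {n : ℕ∞ω} (h : ContDiffOn ℝ n (cutoff k l) D.Ω) :
    ContDiff ℝ n (cutoffExt k l) := by
  rw [contDiff_iff_contDiffAt]
  intro x
  by_cases hx : x ∈ D.Ω
  · refine (h.contDiffAt (D.isOpen_Ω.mem_nhds hx)).congr_of_eventuallyEq ?_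
    filter_upwards [D.isOpen_Ω.mem_nhds hx] with y hy
    rw [cutoffExt, if_pos hy]
  · have : cutoffExt k l =ᶠ[𝓝 x] fun _ => 0 := by
      filter_upwards [(D.isCompact_core k.η_pos).isClosed.isOpen_compl.mem_nhds
        fun h => hx h.1] with y hy
      exact cutoffExt_eq_zero k l hy
    exact contDiffAt_const.congr_of_eventuallyEq this

theorem continuous_cutoffExt : Continuous (cutoffExt k l) := by
  refine (contDiff_cutoffExt k l (n := 0) (contDiffOn_zero.2 ?_)).continuous
  exact l.ξ_smooth.continuous.comp_continuousOn (l.d_cont.div_const _)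

/-- The pair of functionals giving the `i`-th horizontal and the vertical derivative of the
regularized density at `x`. -/
def gradForm (D : Domain) (i : Fin 2) (x : E3) : Lp ℝ 1 D.μ →L[ℝ] ℝ × ℝ :=
  (k.form D i.castSucc x).prod (k.form D 2 x)

theorem contDiff_gradForm (i : Fin 2) : ContDiff ℝ ∞ (gradForm k D i) := by
  have h : gradForm k D i = fun x =>
      (ContinuousLinearMap.inl ℝ ℝ ℝ).comp (k.form D i.castSucc x) +
        (ContinuousLinearMap.inr ℝ ℝ ℝ).comp (k.form D 2 x) := by
    ext x r <;> simp [gradForm]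
  rw [h]
  exact (contDiff_const.clm_comp (k.contDiff_form D i.castSucc)).add
    (contDiff_const.clm_comp (k.contDiff_form D 2))

theorem exists_norm_gradForm_le :
    ∃ C, 0 ≤ C ∧ ∀ (D : Domain) (i : Fin 2) (x : E3), ‖gradForm k D i x‖ ≤ C := by
  obtain ⟨C, hC0, hC⟩ := k.exists_norm_form_le
  refine ⟨C, hC0, fun D i x => ?_⟩
  rw [gradForm, ContinuousLinearMap.opNorm_prod]
  exact max_le (hC _ _ _) (hC _ _ _)

theorem pd_regDensity {ρ : E3 → ℝ} {r : Lp ℝ 1 D.μ} (hr : r =ᵐ[D.μ] ρ) {x : E3} (hx : x ∈ D.Ω)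
    (hd : k.η / 2 < l.d x) (i : Fin 3) : pd i (regDensity k l ρ) x = k.form D i x r := by
  have h : regDensity k l ρ =ᶠ[𝓝 x] fun x => kernelForm D.μ k.jη k.contDiff_jη
      k.hasCompactSupport_jη x r := by
    have hopen := l.d_cont.isOpen_inter_preimage D.isOpen_Ω (isOpen_Ioi (a := k.η / 2))
    filter_upwards [hopen.mem_nhds ⟨hx, hd⟩] with y hy
    rw [regDensity, if_pos (show y ∈ D.Ω ∧ k.η / 2 < l.d y from hy), kernelForm_apply]
    exact integral_congr_ae (hr.mono fun z hz => by simp only [hz])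
  rw [pd, h.fderiv_eq]
  exact pd_kernelForm _ _ i r x

/-- The slope is a smooth function of finitely many functionals of the density, multiplied by the
cut-off. -/
theorem slope_eq {ρ : E3 → ℝ} {r : Lp ℝ 1 D.μ} (hr : r =ᵐ[D.μ] ρ) (i : Fin 2) (x : E3) :
    slope k l ρ i x = cutoffExt k l x * l.ratio (gradForm k D i x r) := by
  by_cases h0 : cutoffExt k l x = 0
  · rw [h0, zero_mul, slope]
    split_ifs with h
    · have : cutoff k l x = 0 := by rwa [cutoffExt, if_pos h.1] at h0
      rw [this]
      ring
    · rfl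
  · obtain ⟨hx, hd⟩ := lt_d_of_cutoffExt_ne_zero k l h0
    have hd' : k.η / 2 < l.d x := by linarith [k.η_pos]
    have hc : cutoffExt k l x = cutoff k l x := if_pos hx
    rw [slope, pd_regDensity k l hr hx hd', pd_regDensity k l hr hx hd', hc]
    simp only [gradForm, ContinuousLinearMap.prod_apply, Limiter.ratio, Limiter.taper]
    split_ifs with h
    · ring
    · rw [l.P_zero _ (not_lt.1 fun hlt => h ⟨hx, hlt⟩)]
      ring

end Cutoff

/-! ### The density -/

namespace EOS

variable {D : Domain} (e : EOS D)

theorem contDiff_poly : ContDiff ℝ ∞ fun q : ℝ × ℝ × ℝ =>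
    ∑ i, ∑ j, ∑ k, e.c i j k * q.2.1 ^ (i : ℕ) * q.1 ^ (j : ℕ) * q.2.2 ^ (k : ℕ) := by
  fun_prop

theorem measurable_rho : Measurable fun q : ℝ × ℝ × ℝ => e.rho q.1 q.2.1 q.2.2 :=
  e.contDiff_poly.continuous.measurable.inv

/-- On the admissible box the density agrees with a smooth function of compact support. -/
theorem exists_smooth_rho : ∃ g : ℝ × ℝ × ℝ → ℝ, ContDiff ℝ ∞ g ∧ HasCompactSupport g ∧
    ∀ θ ∈ Icc (-e.K₁) e.K₂, ∀ S ∈ Icc e.L₁ e.L₂, ∀ p ∈ Icc e.M₁ e.M₂,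
      g (θ, S, p) = e.rho θ S p := by
  obtain ⟨g, hg, hs, heq⟩ := exists_smooth_extension
    (K := Icc (-e.K₁) e.K₂ ×ˢ (Icc e.L₁ e.L₂ ×ˢ Icc e.M₁ e.M₂))
    (U := {q : ℝ × ℝ × ℝ |
      ∑ i, ∑ j, ∑ k, e.c i j k * q.2.1 ^ (i : ℕ) * q.1 ^ (j : ℕ) * q.2.2 ^ (k : ℕ) ≠ 0})
    (f := fun q => e.rho q.1 q.2.1 q.2.2)
    (isCompact_Icc.prod (isCompact_Icc.prod isCompact_Icc))
    (isOpen_ne_fun e.contDiff_poly.continuous continuous_const)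
    (fun q hq h0 => by
      have := (e.density_range q.1 hq.1 q.2.1 hq.2.1 q.2.2 hq.2.2).1
      rw [h0, inv_zero] at this
      exact absurd this (not_le.2 e.R₁_pos))
    (e.contDiff_poly.contDiffOn.inv fun q hq => hq)
  exact ⟨g, hg, hs, fun θ hθ S hS p hp => heq ⟨hθ, hS, hp⟩⟩

theorem pst_mem {x : E3} (hx : x ∈ D.Ω) : e.pst (x 2) ∈ Icc e.M₁ e.M₂ :=
  e.pressure_range _ hx.2

theorem aestronglyMeasurable_density (θ S : Jet 1 D) :
    AEStronglyMeasurable (e.density θ S) D.μ := by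
  have h : Measurable fun x : E3 => (θ.val x, S.val x, e.pst (x 2)) :=
    (Lp.stronglyMeasurable θ.val).measurable.prodMk
      ((Lp.stronglyMeasurable S.val).measurable.prodMk (by unfold pst; fun_prop))
  exact (e.measurable_rho.comp h).aestronglyMeasurable

theorem density_mem {θ S : Jet 1 D} (hθ : ∀ᵐ x ∂D.μ, θ.val x ∈ Icc (-e.K₁) e.K₂)
    (hS : ∀ᵐ x ∂D.μ, S.val x ∈ Icc e.L₁ e.L₂) :
    ∀ᵐ x ∂D.μ, e.density θ S x ∈ Icc e.R₁ e.R₂ := by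
  filter_upwards [hθ, hS, D.ae_mem_Ω] with x h1 h2 h3
  exact e.density_range _ h1 _ h2 _ (e.pst_mem h3)

theorem memLp_density {θ S : Jet 1 D} (hθ : ∀ᵐ x ∂D.μ, θ.val x ∈ Icc (-e.K₁) e.K₂)
    (hS : ∀ᵐ x ∂D.μ, S.val x ∈ Icc e.L₁ e.L₂) (p : ENNReal) :
    MemLp (e.density θ S) p D.μ := by
  refine MemLp.of_bound (e.aestronglyMeasurable_density θ S) e.R₂ ?_
  filter_upwards [e.density_mem hθ hS] with x hx
  rw [Real.norm_eq_abs, abs_of_pos (e.R₁_pos.trans_le hx.1)]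
  exact hx.2

end EOS

/-! ### Lipschitz estimate for the slope -/

theorem integral_pd_eq_zero {f : E3 → ℝ} (hf : ContDiff ℝ 1 f) (hs : HasCompactSupport f)
    (i : Fin 3) : ∫ x, pd i f x = 0 := by
  have hc : Continuous (pd i f) := (contDiff_pd (m := 0) hf (by norm_num) i).continuous
  have h := integral_mul_fderiv_eq_neg_fderiv_mul_of_integrable (μ := (volume : Measure E3))
    (f := fun _ : E3 => (1 : ℝ)) (g := f) (v := EuclideanSpace.single i (1 : ℝ)) (by simp)
    (by
      simp only [one_mul]
      exact hc.integrable_of_hasCompactSupport (hasCompactSupport_pd hs i))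
    (by simpa using hf.continuous.integrable_of_hasCompactSupport hs)
    (fun x _ => differentiableAt_const _) (fun x _ => hf.differentiable (by norm_num) x)
  simpa [pd] using h

theorem setIntegral_eq_of_isTest {D : Domain} {f : E3 → ℝ} (hf : tsupport f ⊆ D.Ω) (g : E3 → ℝ) :
    ∫ x, g x * f x ∂D.μ = ∫ x, g x * f x :=
  setIntegral_eq_integral_of_forall_compl_eq_zero fun x hx => by
    rw [image_eq_zero_of_notMem_tsupport fun h => hx (hf h), mul_zero]

/-- The derivatives of the regularized density are controlled by the oscillation of the density,
because the derivatives of the kernel have mean zero. -/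
theorem Kernel.exists_abs_form_le_osc (k : Kernel) (D : Domain) :
    ∃ C, 0 ≤ C ∧ ∀ (i : Fin 3), ∀ x ∈ D.core k.η, ∀ (r : Lp ℝ 1 D.μ) (a b : ℝ),
      (∀ᵐ y ∂D.μ, r y ∈ Icc a b) → |k.form D i x r| ≤ C * (b - a) := by
  obtain ⟨B, hB0, hB⟩ : ∃ B, 0 ≤ B ∧ ∀ i x, |pd i k.jη x| ≤ B := by
    choose B hB using fun i => (hasCompactSupport_pd k.hasCompactSupport_jη i
      ).exists_bound_of_continuous (contDiff_pd_infty k.contDiff_jη i).continuous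
    have h0 : ∀ i, 0 ≤ B i := fun i => (norm_nonneg _).trans (hB i 0)
    exact ⟨∑ i, B i, Finset.sum_nonneg fun i _ => h0 i, fun i x => (hB i x).trans
      (Finset.single_le_sum (fun i _ => h0 i) (Finset.mem_univ i))⟩
  refine ⟨B * D.μ.real univ, by positivity, fun i x hx r a b hr => ?_⟩
  have hz : ∫ y, pd i k.jη (x - y) ∂D.μ = 0 := by
    have h1 := setIntegral_eq_of_isTest (k.isTest_pd_jη hx i).2.2 fun _ => 1
    simp only [one_mul] at h1
    rw [h1, integral_sub_left_eq_self (fun y => pd i k.jη y) volume x]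
    exact integral_pd_eq_zero (k.contDiff_jη.of_le (by norm_cast)) k.hasCompactSupport_jη i
  have hc : Continuous fun y => pd i k.jη (x - y) :=
    (contDiff_pd_infty k.contDiff_jη i).continuous.comp (by fun_prop)
  have hi : ∀ f : E3 → ℝ, Integrable f D.μ → Integrable (fun y => pd i k.jη (x - y) * f y) D.μ :=
    fun f hf => hf.bdd_mul (c := B) hc.aestronglyMeasurable (ae_of_all _ fun y => hB i _)
  have he : k.form D i x r = ∫ y, pd i k.jη (x - y) * (r y - a) ∂D.μ := by
    simp_rw [mul_sub]
    rw [integral_sub (hi _ (L1.integrable_coeFn r)) (hi _ (integrable_const a)),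
      integral_mul_const, hz, k.form_apply]
    ring
  rw [he, ← Real.norm_eq_abs]
  refine (norm_integral_le_of_norm_le_const (C := B * (b - a)) ?_).trans_eq (by ring)
  filter_upwards [hr] with y hy
  rw [norm_mul, Real.norm_eq_abs, Real.norm_eq_abs, abs_of_nonneg (sub_nonneg.2 hy.1)]
  exact mul_le_mul (hB i _) (by linarith [hy.2]) (sub_nonneg.2 hy.1) hB0

namespace Limiter

variable {D : Domain} (l : Limiter D)

theorem s₀_pos : 0 < l.s₀ := l.ε₀_pos.trans l.ε₀_lt

theorem taper_eq_zero {b : ℝ} (hb : |b| ≤ l.s₀ - l.ε₀) : l.taper b = 0 := by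
  rw [taper, l.P_zero _ hb, zero_div]

theorem abs_taper_le {q b : ℝ} (hq : 0 < q) (hqs : q ≤ l.s₀ - l.ε₀) : |l.taper b| ≤ 1 / q := by
  rcases le_or_gt |b| (l.s₀ - l.ε₀) with h | h
  · rw [l.taper_eq_zero h, abs_zero]
    positivity
  · rw [taper, abs_div, abs_of_nonneg (l.P_mem_Icc _).1]
    exact div_le_div₀ zero_le_one (l.P_mem_Icc _).2 hq (hqs.trans h.le)

/-- The taper vanishes where `|b| ≤ q`, and its derivative is estimated where `q ≤ |b|`. -/
theorem abs_taper_sub_le {q B : ℝ} (hq : 0 < q) (hqs : q ≤ l.s₀ - l.ε₀)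
    (hB : ∀ s, l.s₀ * |deriv l.P s| ≤ B) (b b' : ℝ) :
    |l.taper b - l.taper b'| ≤ (B / (l.s₀ * q) + 1 / q ^ 2) * |b - b'| := by
  have hs := l.s₀_pos
  have hB0 : 0 ≤ B := (mul_nonneg hs.le (abs_nonneg _)).trans (hB 0)
  refine convex_univ.norm_image_sub_le_of_norm_deriv_le (𝕜 := ℝ) (f := l.taper) (x := b') (y := b)
    (fun s _ => l.contDiff_taper.differentiable (by simp) s) (fun s _ => ?_) (mem_univ _)
    (mem_univ _)
  rcases lt_or_ge |s| q with h | h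
  · have : l.taper =ᶠ[𝓝 s] fun _ => 0 := by
      filter_upwards [(isOpen_lt continuous_abs continuous_const).mem_nhds h] with y hy
      exact l.taper_eq_zero ((le_of_lt hy).trans hqs)
    rw [this.deriv_eq, deriv_const, norm_zero]
    positivity
  · have hs0 : s ≠ 0 := by
      rintro rfl
      simp at h
      linarith
    have hP : HasDerivAt (fun y => l.P |y|) (deriv l.P |s| * SignType.sign s) s :=
      (l.P_smooth.differentiable (by simp) |s|).hasDerivAt.comp s (hasDerivAt_abs hs0)
    have hd : HasDerivAt l.taper _ s := hP.div (hasDerivAt_id s) hs0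
    have hP' : |deriv l.P (|s|)| ≤ B / l.s₀ := by
      rw [le_div_iff₀ hs, mul_comm]
      exact hB _
    have hP1 := l.P_mem_Icc |s|
    have hsg : |((SignType.sign s : SignType) : ℝ)| = 1 := by
      rcases hs0.lt_or_gt with h | h <;> simp [h]
    have hsq : |s| ≠ 0 := abs_ne_zero.2 hs0
    rw [hd.deriv, mul_one, sub_div, Real.norm_eq_abs]
    refine (abs_sub _ _).trans (add_le_add ?_ ?_)
    · rw [pow_two, mul_div_mul_right _ _ hs0, abs_div, abs_mul, hsg, mul_one, ← div_div]
      gcongr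
    · rw [abs_div, abs_of_nonneg hP1.1, abs_pow]
      gcongr
      exact hP1.2

/-- The Lipschitz estimate for the slope as a function of the density gradients, in terms of the
bound `A` for the gradients. The taper is active only if `A` exceeds `(1 - r) s₀`. -/
theorem abs_ratio_sub_le {r B A N a a' b b' : ℝ} (hr : r < 1) (hε : l.ε₀ ≤ r * l.s₀)
    (hB : ∀ s, l.s₀ * |deriv l.P s| ≤ B) (ha' : |a'| ≤ A) (hb : |b| ≤ A)
    (haa : |a - a'| ≤ N) (hbb : |b - b'| ≤ N) :
    |l.ratio (a, b) - l.ratio (a', b')| ≤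
      (2 / (1 - r) ^ 2 + B / (1 - r)) * A * N / l.s₀ ^ 2 := by
  have hs := l.s₀_pos
  have hr' : 0 < 1 - r := sub_pos.2 hr
  have hA : 0 ≤ A := (abs_nonneg _).trans ha'
  have hN : 0 ≤ N := (abs_nonneg _).trans haa
  have hB0 : 0 ≤ B := (mul_nonneg hs.le (abs_nonneg _)).trans (hB 0)
  set q := (1 - r) * l.s₀ with hq
  have hq0 : 0 < q := mul_pos hr' hs
  have hqs : q ≤ l.s₀ - l.ε₀ := by rw [hq]; linarith
  have h1 : |(a - a') * l.taper b| ≤ N * (A / q ^ 2) := by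
    rw [abs_mul]
    refine mul_le_mul haa ?_ (abs_nonneg _) hN
    rcases le_or_gt |b| q with h | h
    · rw [l.taper_eq_zero (h.trans hqs), abs_zero]
      positivity
    · refine (l.abs_taper_le hq0 hqs).trans ?_
      rw [div_le_div_iff₀ hq0 (by positivity), one_mul, pow_two]
      gcongr
      exact h.le.trans hb
  have h2 : |a' * (l.taper b - l.taper b')| ≤ A * ((B / (l.s₀ * q) + 1 / q ^ 2) * N) := by
    rw [abs_mul]
    refine mul_le_mul ha' ((l.abs_taper_sub_le hq0 hqs hB b b').trans ?_) (abs_nonneg _) hA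
    gcongr
  have e : l.ratio (a, b) - l.ratio (a', b') =
      -((a - a') * l.taper b + a' * (l.taper b - l.taper b')) := by
    simp only [ratio]
    ring
  rw [e, abs_neg]
  refine (abs_add_le _ _).trans ((add_le_add h1 h2).trans_eq ?_)
  rw [hq]
  field_simp
  ring

end Limiter

theorem norm_slopeVec_sub_le {D : Domain} (k : Kernel) (l : Limiter D) (ρ ρ' : E3 → ℝ) (x : E3) :
    ‖slopeVec k l ρ x - slopeVec k l ρ' x‖ ≤
      |slope k l ρ 0 x - slope k l ρ' 0 x| + |slope k l ρ 1 x - slope k l ρ' 1 x| := by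
  rw [EuclideanSpace.norm_eq, Fin.sum_univ_two]
  refine Real.sqrt_le_iff.2 ⟨by positivity, ?_⟩
  simp only [slopeVec, PiLp.sub_apply, Real.norm_eq_abs]
  nlinarith [abs_nonneg (slope k l ρ 0 x - slope k l ρ' 0 x),
    abs_nonneg (slope k l ρ 1 x - slope k l ρ' 1 x)]

/-- The tapered slope is Lipschitz in the density gradients with a constant proportional to their
size, which is at most a multiple of the oscillation `R₂ - R₁`; the gradients themselves are bounded
functionals of the density. -/
theorem exists_slope_lipschitz_bound (D : Domain) (k : Kernel) (r B : ℝ) (hr : r < 1) :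
    ∃ C : ℝ, ∀ l : Limiter D, l.ε₀ ≤ r * l.s₀ → (∀ s, l.s₀ * |deriv l.P s| ≤ B) →
      ∀ (R₁ R₂ : ℝ) (ρ₁ ρ₂ : E3 → ℝ), AEStronglyMeasurable ρ₁ D.μ → AEStronglyMeasurable ρ₂ D.μ →
        (∀ᵐ x ∂D.μ, ρ₁ x ∈ Icc R₁ R₂) → (∀ᵐ x ∂D.μ, ρ₂ x ∈ Icc R₁ R₂) →
        eLpNorm (fun x => slopeVec k l ρ₁ x - slopeVec k l ρ₂ x) ⊤ D.μ ≤
          ENNReal.ofReal (C * (1 / l.s₀ + 1 / l.s₀ ^ 2) * (R₂ - R₁)) *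
            eLpNorm (fun x => ρ₁ x - ρ₂ x) 2 D.μ := by
  obtain ⟨C₁, hC₁0, hC₁⟩ := k.exists_abs_form_le_osc D
  obtain ⟨C₂, hC₂0, hC₂⟩ := k.exists_norm_form_le
  set V : ℝ := (D.μ univ).toReal ^ (1 / 2 : ℝ) with hV
  have hV0 : 0 ≤ V := by positivity
  refine ⟨2 * ((2 / (1 - r) ^ 2 + |B| / (1 - r)) * C₁ * (C₂ * V)),
    fun l hε hB R₁ R₂ ρ₁ ρ₂ hm₁ hm₂ h₁ h₂ => ?_⟩
  have hs := l.s₀_pos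
  have hr' : 0 < 1 - r := sub_pos.2 hr
  have hB0 : 0 ≤ B := (mul_nonneg hs.le (abs_nonneg _)).trans (hB 0)
  rw [abs_of_nonneg hB0]
  have hbd : ∀ {ρ : E3 → ℝ}, (∀ᵐ x ∂D.μ, ρ x ∈ Icc R₁ R₂) → ∀ᵐ x ∂D.μ, ‖ρ x‖ ≤ max |R₁| |R₂| :=
    fun h => h.mono fun x hx => abs_le_max_abs_abs hx.1 hx.2
  have hp₁ : ∀ p, MemLp ρ₁ p D.μ := fun p => MemLp.of_bound hm₁ _ (hbd h₁)
  have hp₂ : ∀ p, MemLp ρ₂ p D.μ := fun p => MemLp.of_bound hm₂ _ (hbd h₂)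
  have hfin : eLpNorm (fun x => ρ₁ x - ρ₂ x) 2 D.μ ≠ ⊤ := ((hp₁ 2).sub (hp₂ 2)).2.ne
  set N := (eLpNorm (fun x => ρ₁ x - ρ₂ x) 2 D.μ).toReal with hN
  have hN0 : 0 ≤ N := ENNReal.toReal_nonneg
  set r₁ := (hp₁ 1).toLp ρ₁
  set r₂ := (hp₂ 1).toLp ρ₂
  have e₁ : r₁ =ᵐ[D.μ] ρ₁ := MemLp.coeFn_toLp _
  have e₂ : r₂ =ᵐ[D.μ] ρ₂ := MemLp.coeFn_toLp _
  have hR : 0 ≤ R₂ - R₁ := by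
    have : NeZero D.μ := ⟨fun h => by simpa [h] using D.measure_univ_pos⟩
    obtain ⟨x, hx⟩ := h₁.exists
    linarith [hx.1, hx.2]
  have hnorm : ‖r₁ - r₂‖ ≤ V * N := by
    rw [← MemLp.toLp_sub, Lp.norm_toLp]
    have h := eLpNorm_le_eLpNorm_mul_rpow_measure_univ (μ := D.μ) (p := 1) (q := 2)
      (f := fun x => ρ₁ x - ρ₂ x) one_le_two (hm₁.sub hm₂)
    have h' := ENNReal.toReal_mono (ENNReal.mul_ne_top hfin
      (ENNReal.rpow_ne_top_of_nonneg (by norm_num) (measure_ne_top _ _))) h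
    rw [ENNReal.toReal_mul, ← ENNReal.toReal_rpow] at h'
    refine h'.trans_eq ?_
    rw [mul_comm, hV, ← hN]
    norm_num
  have hform : ∀ i x, |k.form D i x r₁ - k.form D i x r₂| ≤ C₂ * V * N := fun i x => by
    rw [← map_sub, ← Real.norm_eq_abs, mul_assoc]
    refine (ContinuousLinearMap.le_opNorm _ _).trans ?_
    exact mul_le_mul (hC₂ D i x) hnorm (norm_nonneg _) hC₂0
  set Z := (2 / (1 - r) ^ 2 + B / (1 - r)) * (C₁ * (R₂ - R₁)) * (C₂ * V * N) / l.s₀ ^ 2 with hZ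
  have hZ0 : 0 ≤ Z := by positivity
  have hslope : ∀ i x, |slope k l ρ₁ i x - slope k l ρ₂ i x| ≤ Z := by
    intro i x
    rw [slope_eq k l e₁, slope_eq k l e₂, ← mul_sub, abs_mul]
    by_cases hx : x ∈ D.core k.η
    · have hc := cutoffExt_mem_Icc k l x
      rw [abs_of_nonneg hc.1]
      refine (mul_le_of_le_one_left (abs_nonneg _) hc.2).trans ?_
      exact l.abs_ratio_sub_le hr hε hB
        (hC₁ _ x hx r₂ R₁ R₂ (by filter_upwards [e₂, h₂] with y hy hy'; rwa [hy]))
        (hC₁ _ x hx r₁ R₁ R₂ (by filter_upwards [e₁, h₁] with y hy hy'; rwa [hy]))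
        (hform _ _) (hform _ _)
    · rw [cutoffExt_eq_zero k l hx, abs_zero, zero_mul]
      exact hZ0
  rw [← ENNReal.ofReal_toReal hfin, ← hN, ← ENNReal.ofReal_mul (by positivity), eLpNorm_exponent_top]
  refine (eLpNormEssSup_le_of_ae_bound (C := Z + Z) (ae_of_all _ fun x =>
    (norm_slopeVec_sub_le k l ρ₁ ρ₂ x).trans (add_le_add (hslope 0 x) (hslope 1 x)))).trans ?_
  refine ENNReal.ofReal_le_ofReal ?_
  rw [hZ]
  set W := (2 / (1 - r) ^ 2 + B / (1 - r)) * C₁ * (C₂ * V) * (R₂ - R₁) * N with hW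
  have hW0 : 0 ≤ W := by positivity
  have h3 : 0 ≤ W * (1 / l.s₀) := by positivity
  calc _ = 2 * (W * (1 / l.s₀ ^ 2)) := by rw [hW]; ring
    _ ≤ 2 * (W * (1 / l.s₀) + W * (1 / l.s₀ ^ 2)) := by linarith
    _ = _ := by rw [hW]; ring

/-! ### Superposition operators -/

theorem hasFDerivAt_of_quadratic_bound {E F : Type*} [NormedAddCommGroup E] [NormedSpace ℝ E]
    [NormedAddCommGroup F] [NormedSpace ℝ F] {f : E → F} {L : E →L[ℝ] F} {x : E} {C : ℝ}
    (h : ∀ v, ‖f (x + v) - f x - L v‖ ≤ C * ‖v‖ ^ 2) : HasFDerivAt f L x := by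
  rw [hasFDerivAt_iff_isLittleO_nhds_zero]
  refine (Asymptotics.IsBigO.of_bound C (g := fun v : E => ‖v‖ ^ 2)
    (Eventually.of_forall fun v => ?_)).trans_isLittleO (Asymptotics.isLittleO_norm_pow_id one_lt_two)
  rw [Real.norm_eq_abs, abs_of_nonneg (by positivity : (0 : ℝ) ≤ ‖v‖ ^ 2)]
  exact h v

section Lp

variable {α : Type*} [MeasurableSpace α] {μ : Measure α}

theorem integral_abs_mul_abs_le (A B : Lp ℝ 2 μ) :
    Integrable (fun x => |A x| * |B x|) μ ∧ ∫ x, |A x| * |B x| ∂μ ≤ ‖A‖ * ‖B‖ := by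
  have e : (fun x => inner ℝ ((|B| : Lp ℝ 2 μ) x) ((|A| : Lp ℝ 2 μ) x)) =ᵐ[μ]
      fun x => |A x| * |B x| := by
    filter_upwards [Lp.coeFn_abs A, Lp.coeFn_abs B] with x hA hB
    simp [hA, hB]
  refine ⟨(L2.integrable_inner _ _).congr e, ?_⟩
  rw [← integral_congr_ae e, ← L2.inner_def]
  refine (real_inner_le_norm _ _).trans_eq ?_
  rw [norm_abs_eq_norm, norm_abs_eq_norm, mul_comm]

theorem norm_L1_le_of_abs_le {F : Lp ℝ 1 μ} {A B : Lp ℝ 2 μ} {c : ℝ} (hc : 0 ≤ c)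
    (h : ∀ᵐ x ∂μ, |F x| ≤ c * (|A x| * |B x|)) : ‖F‖ ≤ c * (‖A‖ * ‖B‖) := by
  have hAB := integral_abs_mul_abs_le A B
  rw [L1.norm_eq_integral_norm]
  refine (integral_mono_ae (L1.integrable_coeFn F).norm (hAB.1.const_mul c) h).trans ?_
  rw [integral_const_mul]
  exact mul_le_mul_of_nonneg_left hAB.2 hc

end Lp

variable {D : Domain}

/-- The superposition operator `(θ, S) ↦ g (θ, S, b)` of a smooth function of compact support, from
`L² × L²` to `L¹`, has a bounded and Lipschitz derivative. (With values in `L²` it is in general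
not differentiable.) -/
theorem exists_superposition {g : ℝ × ℝ × ℝ → ℝ} (hg : ContDiff ℝ ∞ g) (hs : HasCompactSupport g)
    {b : E3 → ℝ} (hb : Measurable b) :
    ∃ (N : L2 D × L2 D → Lp ℝ 1 D.μ) (N' : L2 D × L2 D → L2 D × L2 D →L[ℝ] Lp ℝ 1 D.μ) (C : ℝ),
      (∀ u, N u =ᵐ[D.μ] fun x => g (u.1 x, u.2 x, b x)) ∧
      (∀ u h, N' u h =ᵐ[D.μ] fun x => fderiv ℝ g (u.1 x, u.2 x, b x) (h.1 x, h.2 x, 0)) ∧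
      (∀ u, HasFDerivAt N (N' u) u) ∧ (∀ u, ‖N' u‖ ≤ C) ∧
      ∀ u w, ‖N' u - N' w‖ ≤ C * ‖u - w‖ := by
  obtain ⟨C, hC0, hCb, hC1, -, hC2, hC3⟩ := exists_taylor_bound (hg.of_le (by norm_cast)) hs
  have hmeas : ∀ u : L2 D × L2 D, Measurable fun x => (u.1 x, u.2 x, b x) := fun u =>
    (Lp.stronglyMeasurable u.1).measurable.prodMk ((Lp.stronglyMeasurable u.2).measurable.prodMk hb)
  have hN : ∀ u : L2 D × L2 D, MemLp (fun x => g (u.1 x, u.2 x, b x)) 1 D.μ := fun u =>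
    MemLp.of_bound (hg.continuous.measurable.comp (hmeas u)).aestronglyMeasurable C
      (ae_of_all _ fun x => hCb _)
  have hnorm : ∀ p q : ℝ, ‖((p, q, 0) : ℝ × ℝ × ℝ)‖ ≤ |p| + |q| := fun p q => by
    have h1 := abs_nonneg p
    have h2 := abs_nonneg q
    simp only [Prod.norm_def, Real.norm_eq_abs, abs_zero]
    exact max_le (by linarith) (max_le (by linarith) (by linarith))
  have hN' : ∀ u h : L2 D × L2 D,
      MemLp (fun x => fderiv ℝ g (u.1 x, u.2 x, b x) (h.1 x, h.2 x, 0)) 1 D.μ := fun u h => by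
    have hm : Measurable fun x => ((h.1 x, h.2 x, 0) : ℝ × ℝ × ℝ) :=
      (Lp.stronglyMeasurable h.1).measurable.prodMk
        ((Lp.stronglyMeasurable h.2).measurable.prodMk measurable_const)
    have hi : ∀ h : L2 D, Integrable (fun x => |h x|) D.μ := fun h =>
      ((Lp.memLp h).integrable one_le_two).abs
    refine memLp_one_iff_integrable.2 ((((hi h.1).add (hi h.2)).const_mul C).mono' ?_
      (ae_of_all _ fun x => ?_))
    · exact (isBoundedBilinearMap_apply.continuous.measurable.comp
        (((hg.continuous_fderiv (by simp)).measurable.comp (hmeas u)).prodMk hm)).aestronglyMeasurable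
    · refine ((fderiv ℝ g _).le_of_opNorm_le (hC1 _) _).trans ?_
      exact mul_le_mul_of_nonneg_left (hnorm _ _) hC0
  -- `M h` is the function `|h₁| + |h₂|`, and `O` the constant `1`.
  set M : L2 D × L2 D → L2 D := fun h => |h.1| + |h.2| with hM
  set O : L2 D := Lp.const 2 D.μ (1 : ℝ) with hO
  have hMx : ∀ h : L2 D × L2 D, ∀ᵐ x ∂D.μ, |M h x| = |h.1 x| + |h.2 x| := fun h => by
    filter_upwards [Lp.coeFn_add |h.1| |h.2|, Lp.coeFn_abs h.1, Lp.coeFn_abs h.2] with x h1 h2 h3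
    rw [hM]
    simp only
    rw [h1, Pi.add_apply, h2, h3, abs_of_nonneg (by positivity)]
  have hMn : ∀ h : L2 D × L2 D, ‖M h‖ ≤ 2 * ‖h‖ := fun h => by
    refine (norm_add_le _ _).trans ?_
    rw [norm_abs_eq_norm, norm_abs_eq_norm]
    linarith [norm_fst_le h, norm_snd_le h]
  have hOx : ∀ᵐ x ∂D.μ, |O x| = 1 := by
    filter_upwards [Lp.coeFn_const 2 D.μ (1 : ℝ)] with x hx
    rw [hO, hx]
    simp
  let N : L2 D × L2 D → Lp ℝ 1 D.μ := fun u => (hN u).toLp _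
  have hNx : ∀ u, N u =ᵐ[D.μ] fun x => g (u.1 x, u.2 x, b x) := fun u => (hN u).coeFn_toLp
  have hbound : ∀ u h : L2 D × L2 D, ‖(hN' u h).toLp _‖ ≤ 2 * C * ‖O‖ * ‖h‖ := fun u h => by
    refine (norm_L1_le_of_abs_le (A := M h) (B := O) hC0 ?_).trans ?_
    · filter_upwards [(hN' u h).coeFn_toLp, hMx h, hOx] with x h1 h2 h3
      rw [h1, h2, h3, mul_one]
      refine ((fderiv ℝ g _).le_of_opNorm_le (hC1 _) _).trans ?_
      exact mul_le_mul_of_nonneg_left (hnorm _ _) hC0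
    · calc C * (‖M h‖ * ‖O‖) ≤ C * (2 * ‖h‖ * ‖O‖) := by gcongr; exact hMn h
        _ = _ := by ring
  let N' : L2 D × L2 D → L2 D × L2 D →L[ℝ] Lp ℝ 1 D.μ := fun u =>
    LinearMap.mkContinuous
      { toFun := fun h => (hN' u h).toLp _
        map_add' := fun h h' => by
          refine Lp.ext ?_
          filter_upwards [(hN' u (h + h')).coeFn_toLp, (hN' u h).coeFn_toLp, (hN' u h').coeFn_toLp,
            Lp.coeFn_add ((hN' u h).toLp _) ((hN' u h').toLp _), Lp.coeFn_add h.1 h'.1,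
            Lp.coeFn_add h.2 h'.2] with x h1 h2 h3 h4 h5 h6
          rw [h4, h1, Pi.add_apply, h2, h3, ← map_add, Prod.fst_add, Prod.snd_add, h5, h6]
          simp
        map_smul' := fun c h => by
          refine Lp.ext ?_
          filter_upwards [(hN' u (c • h)).coeFn_toLp, (hN' u h).coeFn_toLp,
            Lp.coeFn_smul c ((hN' u h).toLp _), Lp.coeFn_smul c h.1, Lp.coeFn_smul c h.2]
            with x h1 h2 h3 h4 h5
          rw [RingHom.id_apply, h3, h1, Pi.smul_apply, h2, ← map_smul, Prod.smul_fst,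
            Prod.smul_snd, h4, h5]
          simp }
      (2 * C * ‖O‖) (hbound u)
  have hN'x : ∀ u h, N' u h =ᵐ[D.μ]
      fun x => fderiv ℝ g (u.1 x, u.2 x, b x) (h.1 x, h.2 x, 0) := fun u h => (hN' u h).coeFn_toLp
  refine ⟨N, N', 2 * C * ‖O‖ + 4 * C, hNx, hN'x, fun u => ?_, fun u => ?_, fun u w => ?_⟩
  · refine hasFDerivAt_of_quadratic_bound (C := 4 * C) fun h => ?_
    refine (norm_L1_le_of_abs_le (A := M h) (B := M h) hC0 ?_).trans ?_
    · filter_upwards [Lp.coeFn_sub (N (u + h) - N u) (N' u h), Lp.coeFn_sub (N (u + h)) (N u),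
        hNx (u + h), hNx u, hN'x u h, hMx h, Lp.coeFn_add u.1 h.1, Lp.coeFn_add u.2 h.2]
        with x h1 h2 h3 h4 h5 h6 h7 h8
      rw [h1, Pi.sub_apply, h2, Pi.sub_apply, h3, h4, h5, h6, Prod.fst_add, Prod.snd_add, h7, h8]
      have := hC3 (u.1 x, u.2 x, b x) (h.1 x, h.2 x, 0)
      simp only [Prod.mk_add_mk, add_zero] at this
      refine this.trans ?_
      rw [← pow_two]
      gcongr
      exact hnorm _ _
    · calc C * (‖M h‖ * ‖M h‖) ≤ C * ((2 * ‖h‖) * (2 * ‖h‖)) := by gcongr <;> exact hMn h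
        _ = _ := by ring
  · refine (LinearMap.mkContinuous_norm_le _ (by positivity) _).trans ?_
    linarith
  · refine ContinuousLinearMap.opNorm_le_bound _ (by positivity) fun h => ?_
    refine (norm_L1_le_of_abs_le (A := M (u - w)) (B := M h) hC0 ?_).trans ?_
    · rw [sub_apply]
      filter_upwards [Lp.coeFn_sub (N' u h) (N' w h), hN'x u h, hN'x w h, hMx (u - w), hMx h,
        Lp.coeFn_sub u.1 w.1, Lp.coeFn_sub u.2 w.2] with x h1 h2 h3 h4 h5 h6 h7
      rw [h1, Pi.sub_apply, h2, h3, h4, h5, Prod.fst_sub, Prod.snd_sub, h6, h7, ← sub_apply,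
        ← mul_assoc]
      refine ((fderiv ℝ g (u.1 x, u.2 x, b x) - fderiv ℝ g (w.1 x, w.2 x, b x)).le_opNorm
        (h.1 x, h.2 x, 0)).trans ?_
      refine mul_le_mul ((hC2 _ _).trans ?_) (hnorm _ _) (norm_nonneg _) (by positivity)
      gcongr
      simp
    · calc C * (‖M (u - w)‖ * ‖M h‖) ≤ C * ((2 * ‖u - w‖) * (2 * ‖h‖)) := by
            gcongr <;> exact hMn _
        _ ≤ (2 * C * ‖O‖) * ‖u - w‖ * ‖h‖ + C * ((2 * ‖u - w‖) * (2 * ‖h‖)) := by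
            have : 0 ≤ (2 * C * ‖O‖) * ‖u - w‖ * ‖h‖ := by positivity
            linarith
        _ = _ := by ring

/-- The operator `ρ ↦ χ F (A ρ)`, for a bounded continuous family `A` of pairs of functionals, has
a bounded and Lipschitz derivative. -/
theorem exists_familySuperposition {X : Type*} [NormedAddCommGroup X] [NormedSpace ℝ X]
    {F : ℝ × ℝ → ℝ} (hF : ContDiff ℝ ∞ F) (hs : HasCompactSupport F)
    {A : E3 → X →L[ℝ] ℝ × ℝ} (hA : Continuous A) {c : ℝ} (hAc : ∀ x, ‖A x‖ ≤ c)
    {χ : E3 → ℝ} (hχ : Continuous χ) (hχ1 : ∀ x, χ x ∈ Icc (0 : ℝ) 1) :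
    ∃ (N : X → L2 D) (N' : X → X →L[ℝ] L2 D) (C : ℝ),
      (∀ u, N u =ᵐ[D.μ] fun x => χ x * F (A x u)) ∧
      (∀ u h, N' u h =ᵐ[D.μ] fun x => χ x * fderiv ℝ F (A x u) (A x h)) ∧
      (∀ u, HasFDerivAt N (N' u) u) ∧ (∀ u, ‖N' u‖ ≤ C) ∧
      ∀ u w, ‖N' u - N' w‖ ≤ C * ‖u - w‖ := by
  obtain ⟨C, hC0, hCb, hC1, -, hC2, hC3⟩ := exists_taylor_bound (hF.of_le (by norm_cast)) hs
  have hc0 : 0 ≤ c := (norm_nonneg _).trans (hAc 0)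
  have hAu : ∀ u, Continuous fun x => A x u := fun u => hA.clm_apply continuous_const
  have hAle : ∀ x u, ‖A x u‖ ≤ c * ‖u‖ := fun x u => (A x).le_of_opNorm_le (hAc x) u
  have hmul : ∀ {x : E3} {y B : ℝ}, |y| ≤ B → |χ x * y| ≤ B := fun {x y B} h => by
    rw [abs_mul, abs_of_nonneg (hχ1 x).1]
    exact (mul_le_of_le_one_left (abs_nonneg _) (hχ1 x).2).trans h
  have hN : ∀ u, MemLp (fun x => χ x * F (A x u)) 2 D.μ := fun u =>
    MemLp.of_bound (hχ.mul (hF.continuous.comp (hAu u))).aestronglyMeasurable C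
      (ae_of_all _ fun x => hmul (hCb _))
  have hdb : ∀ x u h, |χ x * fderiv ℝ F (A x u) (A x h)| ≤ C * c * ‖h‖ := fun x u h => by
    refine hmul (((fderiv ℝ F _).le_of_opNorm_le (hC1 _) _).trans ?_)
    rw [mul_assoc]
    gcongr
    exact hAle x h
  have hN' : ∀ u h, MemLp (fun x => χ x * fderiv ℝ F (A x u) (A x h)) 2 D.μ := fun u h =>
    MemLp.of_bound (hχ.mul (((hF.continuous_fderiv (by simp)).comp (hAu u)).clm_apply
      (hAu h))).aestronglyMeasurable _ (ae_of_all _ fun x => hdb x u h)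
  set V : ℝ := (measureUnivNNReal D.μ : ℝ) ^ (ENNReal.toReal 2)⁻¹ with hV
  have hV0 : 0 ≤ V := by positivity
  have hle : ∀ {f : L2 D} {B : ℝ}, 0 ≤ B → (∀ᵐ x ∂D.μ, ‖f x‖ ≤ B) → ‖f‖ ≤ V * B :=
    fun hB h => Lp.norm_le_of_ae_bound hB h
  let N : X → L2 D := fun u => (hN u).toLp _
  have hNx : ∀ u, N u =ᵐ[D.μ] fun x => χ x * F (A x u) := fun u => (hN u).coeFn_toLp
  let N' : X → X →L[ℝ] L2 D := fun u =>
    LinearMap.mkContinuous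
      { toFun := fun h => (hN' u h).toLp _
        map_add' := fun h h' => by
          rw [← MemLp.toLp_add]
          refine MemLp.toLp_congr _ _ (ae_of_all _ fun x => ?_)
          simp [mul_add]
        map_smul' := fun a h => by
          rw [RingHom.id_apply, ← MemLp.toLp_const_smul]
          refine MemLp.toLp_congr _ _ (ae_of_all _ fun x => ?_)
          simp [mul_left_comm] }
      (V * (C * c)) (fun h => by
        rw [mul_assoc]
        refine hle (by positivity) ?_
        filter_upwards [(hN' u h).coeFn_toLp] with x hx
        rw [LinearMap.coe_mk, AddHom.coe_mk, hx]
        exact hdb x u h)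
  have hN'x : ∀ u h, N' u h =ᵐ[D.μ] fun x => χ x * fderiv ℝ F (A x u) (A x h) :=
    fun u h => (hN' u h).coeFn_toLp
  refine ⟨N, N', V * (C * c) + V * (C * c ^ 2), hNx, hN'x, fun u => ?_, fun u => ?_, fun u w => ?_⟩
  · refine hasFDerivAt_of_quadratic_bound (C := V * (C * c ^ 2)) fun h => ?_
    rw [mul_assoc]
    refine hle (by positivity) ?_
    filter_upwards [Lp.coeFn_sub (N (u + h) - N u) (N' u h), Lp.coeFn_sub (N (u + h)) (N u),
      hNx (u + h), hNx u, hN'x u h] with x h1 h2 h3 h4 h5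
    rw [h1, Pi.sub_apply, h2, Pi.sub_apply, h3, h4, h5, ← mul_sub, ← mul_sub, map_add]
    refine hmul ((hC3 _ _).trans ?_)
    calc C * ‖A x h‖ ^ 2 ≤ C * (c * ‖h‖) ^ 2 := by gcongr; exact hAle x h
      _ = _ := by ring
  · refine (LinearMap.mkContinuous_norm_le _ (by positivity) _).trans ?_
    have : 0 ≤ V * (C * c ^ 2) := by positivity
    linarith
  · refine ContinuousLinearMap.opNorm_le_bound _ (by positivity) fun h => ?_
    have key : ‖(N' u - N' w) h‖ ≤ V * (C * (c * ‖u - w‖) * (c * ‖h‖)) := by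
      refine hle (by positivity) ?_
      rw [sub_apply]
      filter_upwards [Lp.coeFn_sub (N' u h) (N' w h), hN'x u h, hN'x w h] with x h1 h2 h3
      rw [h1, Pi.sub_apply, h2, h3, ← mul_sub, ← sub_apply]
      refine hmul (((fderiv ℝ F (A x u) - fderiv ℝ F (A x w)).le_opNorm (A x h)).trans ?_)
      refine mul_le_mul ((hC2 _ _).trans ?_) (hAle x h) (norm_nonneg _) (by positivity)
      rw [← map_sub]
      gcongr
      exact hAle x _
    have : 0 ≤ V * (C * c) * ‖u - w‖ * ‖h‖ := by positivity
    calc _ ≤ _ := key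
      _ = V * (C * c ^ 2) * ‖u - w‖ * ‖h‖ := by ring
      _ ≤ _ := by linarith

/-! ### Jets of classically differentiable functions -/

theorem contDiff_iterate_pd {m : ℕ∞ω} (i : Fin 3) : ∀ (n : ℕ) {f : E3 → ℝ},
    ContDiff ℝ (m + n) f → ContDiff ℝ m ((pd i)^[n] f)
  | 0, f, hf => by simpa using hf
  | n + 1, f, hf => by
    rw [Function.iterate_succ_apply]
    exact contDiff_iterate_pd i n (contDiff_pd hf (by push_cast; rw [add_assoc]) i)

theorem hasCompactSupport_iterate_pd (i : Fin 3) (n : ℕ) {f : E3 → ℝ} (hf : HasCompactSupport f) :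
    HasCompactSupport ((pd i)^[n] f) := by
  induction n generalizing f with
  | zero => exact hf
  | succ n ih => exact ih (hasCompactSupport_pd hf i)

theorem MultiIdx.sum_le {k : ℕ} (α : MultiIdx k) :
    (α.1 0 : ℕ) + (α.1 1 : ℕ) + (α.1 2 : ℕ) ≤ k := by
  have := α.2
  rwa [Fin.sum_univ_three] at this

theorem contDiff_of_multiIdx {k : ℕ} (α : MultiIdx k) {E : Type*} [NormedAddCommGroup E]
    [NormedSpace ℝ E] {f : E → ℝ} (hf : ContDiff ℝ k f) :
    ContDiff ℝ ((0 : ℕ∞ω) + (α.1 0 : ℕ) + (α.1 1 : ℕ) + (α.1 2 : ℕ)) f :=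
  hf.of_le (by rw [zero_add]; exact_mod_cast α.sum_le)

theorem continuous_mpd {k : ℕ} (α : MultiIdx k) {f : E3 → ℝ} (hf : ContDiff ℝ k f) :
    Continuous (mpd α f) :=
  (contDiff_iterate_pd (m := 0) 0 _ (contDiff_iterate_pd 1 _ (contDiff_iterate_pd 2 _
    (contDiff_of_multiIdx α hf)))).continuous

theorem memLp_of_continuous (D : Domain) {f : E3 → ℝ} (hf : Continuous f) (p : ENNReal) :
    MemLp f p D.μ := by
  obtain ⟨C, hC⟩ := D.isBounded_Ω.isCompact_closure.exists_bound_of_continuousOn hf.continuousOn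
  exact MemLp.of_bound hf.aestronglyMeasurable C
    (D.ae_mem_Ω.mono fun x hx => hC x (subset_closure hx))

theorem memLp_mpd {k : ℕ} (D : Domain) (α : MultiIdx k) {f : E3 → ℝ} (hf : ContDiff ℝ k f) :
    MemLp (mpd α f) 2 D.μ :=
  memLp_of_continuous D (continuous_mpd α hf) 2

/-- The jet of a `C^k` function. -/
def jetOf (k : ℕ) (D : Domain) (f : E3 → ℝ) (hf : ContDiff ℝ k f) : Jet k D :=
  WithLp.toLp 2 fun α => (memLp_mpd D α hf).toLp (mpd α f)

theorem isJetOf_jetOf {k : ℕ} {D : Domain} {f : E3 → ℝ} (hf : ContDiff ℝ k f) :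
    IsJetOf (jetOf k D f hf) f :=
  fun α => (memLp_mpd D α hf).coeFn_toLp

theorem integral_mul_pd {f φ : E3 → ℝ} (hf : ContDiff ℝ 1 f) (hs : HasCompactSupport φ)
    (hφ : ContDiff ℝ 1 φ) (i : Fin 3) : ∫ x, f x * pd i φ x = -∫ x, pd i f x * φ x := by
  have h1 : Continuous (pd i f) := (contDiff_pd (m := 0) hf (by norm_num) i).continuous
  have h2 : Continuous (pd i φ) := (contDiff_pd (m := 0) hφ (by norm_num) i).continuous
  refine integral_mul_fderiv_eq_neg_fderiv_mul_of_integrable (μ := (volume : Measure E3))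
    (v := EuclideanSpace.single i (1 : ℝ)) ?_ ?_ ?_
    (fun x _ => hf.differentiable (by norm_num) x) (fun x _ => hφ.differentiable (by norm_num) x)
  · exact (h1.mul hφ.continuous).integrable_of_hasCompactSupport hs.mul_left
  · exact (hf.continuous.mul h2).integrable_of_hasCompactSupport (hasCompactSupport_pd hs i).mul_left
  · exact (hf.continuous.mul hφ.continuous).integrable_of_hasCompactSupport hs.mul_left

theorem contDiff_iterate_pd_infty {φ : E3 → ℝ} (hφ : ContDiff ℝ ∞ φ) (i : Fin 3) (n : ℕ) :
    ContDiff ℝ ∞ ((pd i)^[n] φ) := by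
  induction n generalizing φ with
  | zero => exact hφ
  | succ n ih => exact ih (contDiff_pd_infty hφ i)

theorem integral_mul_iterate_pd (i : Fin 3) : ∀ (n : ℕ) {f φ : E3 → ℝ}, ContDiff ℝ n f →
    HasCompactSupport φ → ContDiff ℝ ∞ φ →
    ∫ x, f x * (pd i)^[n] φ x = (-1) ^ n * ∫ x, (pd i)^[n] f x * φ x
  | 0, f, φ, _, _, _ => by simp
  | n + 1, f, φ, hf, hs, hφ => by
    have hf' : ContDiff ℝ 1 ((pd i)^[n] f) :=
      contDiff_iterate_pd i n (by rw [add_comm]; exact_mod_cast hf)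
    rw [Function.iterate_succ_apply, integral_mul_iterate_pd i n
      (hf.of_le (by exact_mod_cast Nat.le_succ n)) (hasCompactSupport_pd hs i)
      (contDiff_pd_infty hφ i), integral_mul_pd hf' hs (hφ.of_le (by norm_cast)),
      Function.iterate_succ_apply', pow_succ]
    ring

theorem pd_comm {f : E3 → ℝ} (hf : ContDiff ℝ ∞ f) (i j : Fin 3) :
    pd i (pd j f) = pd j (pd i f) := by
  funext x
  have hd : DifferentiableAt ℝ (fderiv ℝ f) x :=
    ((hf.fderiv_right (m := 1) (by norm_cast)).differentiable (by norm_num)) x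
  have h : ∀ i j : Fin 3, pd i (pd j f) x =
      fderiv ℝ (fderiv ℝ f) x (EuclideanSpace.single i 1) (EuclideanSpace.single j 1) :=
    fun i j => by
      unfold pd
      rw [fderiv_clm_apply hd (differentiableAt_const _)]
      simp
  have hsymm : IsSymmSndFDerivAt ℝ f x :=
    (hf.of_le (by norm_cast) : ContDiff ℝ 2 f).contDiffAt.isSymmSndFDerivAt (by simp)
  rw [h, h, hsymm.eq]

theorem iterate_pd_comm {f : E3 → ℝ} (hf : ContDiff ℝ ∞ f) (i j : Fin 3) (m n : ℕ) :
    (pd i)^[m] ((pd j)^[n] f) = (pd j)^[n] ((pd i)^[m] f) := by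
  have h1 : ∀ (n : ℕ) {f : E3 → ℝ}, ContDiff ℝ ∞ f → pd i ((pd j)^[n] f) = (pd j)^[n] (pd i f) := by
    intro n
    induction n with
    | zero => intro f _; rfl
    | succ n ih =>
      intro f hf
      rw [Function.iterate_succ_apply, Function.iterate_succ_apply, ih (contDiff_pd_infty hf j),
        pd_comm hf]
  induction m generalizing f with
  | zero => rfl
  | succ m ih =>
    rw [Function.iterate_succ_apply, Function.iterate_succ_apply, h1 n hf,
      ih (contDiff_pd_infty hf i)]

/-- Classical derivatives are weak derivatives. -/
theorem jetOf_mem_sobolev {k : ℕ} {D : Domain} {f : E3 → ℝ} (hf : ContDiff ℝ k f) :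
    jetOf k D f hf ∈ Sobolev k D := by
  intro α φ hφ
  have hg := contDiff_of_multiIdx α hf
  have e1 : ∫ x, (jetOf k D f hf).val x * mpd α φ x ∂D.μ = ∫ x, f x * mpd α φ x := by
    have hsub : tsupport (mpd α φ) ⊆ D.Ω := by
      refine subset_trans ?_ hφ.2.2
      have : ∀ (i : Fin 3) (n : ℕ) (g : E3 → ℝ), tsupport ((pd i)^[n] g) ⊆ tsupport g := by
        intro i n
        induction n with
        | zero => exact fun g => Subset.rfl
        | succ n ih => exact fun g => (ih _).trans (tsupport_pd_subset g i)
      exact (this _ _ _).trans ((this _ _ _).trans (this _ _ _))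
    rw [← setIntegral_eq_of_isTest hsub]
    exact integral_congr_ae ((isJetOf_jetOf hf (MultiIdx.zero k)).mono fun x hx => by
      simp only [Jet.val, hx]
      rfl)
  have e2 : ∫ x, jetOf k D f hf α x * φ x ∂D.μ = ∫ x, mpd α f x * φ x := by
    rw [← setIntegral_eq_of_isTest hφ.2.2]
    exact integral_congr_ae ((isJetOf_jetOf hf α).mono fun x hx => by simp only [hx])
  have c1 := hφ.1
  have c2 := hφ.2.1
  rw [e1, e2, mpd, iterate_pd_comm c1 1 2, iterate_pd_comm (contDiff_iterate_pd_infty c1 1 _) 0 2,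
    iterate_pd_comm c1 0 1,
    integral_mul_iterate_pd 2 _ (hf.of_le (by exact_mod_cast (by have := α.sum_le; omega)))
      (hasCompactSupport_iterate_pd _ _ (hasCompactSupport_iterate_pd _ _ c2))
      (contDiff_iterate_pd_infty (contDiff_iterate_pd_infty c1 _ _) _ _),
    integral_mul_iterate_pd 1 _
      ((contDiff_iterate_pd 2 _ hg).of_le (by rw [zero_add]; exact_mod_cast Nat.le_add_left _ _))
      (hasCompactSupport_iterate_pd _ _ c2) (contDiff_iterate_pd_infty c1 _ _),
    integral_mul_iterate_pd 0 _
      ((contDiff_iterate_pd 1 _ (contDiff_iterate_pd 2 _ hg)).of_le (by rw [zero_add])) c2 c1]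
  rw [MultiIdx.order, Fin.sum_univ_three, pow_add, pow_add, mpd]
  ring

/-! ### Families of jets -/

section Family

variable {X : Type*} [NormedAddCommGroup X] [NormedSpace ℝ X]

theorem contDiff_family_pd {m n : ℕ∞ω} {G : X × E3 → ℝ} (hG : ContDiff ℝ n G) (hmn : m + 1 ≤ n)
    (i : Fin 3) : ContDiff ℝ m fun q : X × E3 => pd i (fun x => G (q.1, x)) q.2 := by
  have h : (fun q : X × E3 => pd i (fun x => G (q.1, x)) q.2) =
      fun q => fderiv ℝ G q (0, EuclideanSpace.single i 1) := by
    funext q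
    have hd : HasFDerivAt (fun x => G (q.1, x))
        ((fderiv ℝ G q).comp (ContinuousLinearMap.inr ℝ X E3)) q.2 :=
      ((hG.differentiable (by rintro rfl; simp at hmn) q).hasFDerivAt).comp q.2
        (hasFDerivAt_prodMk_right q.1 q.2)
    rw [pd, hd.fderiv]
    simp
  rw [h]
  exact (hG.fderiv_right hmn).clm_apply contDiff_const

theorem contDiff_family_iterate_pd {m : ℕ∞ω} (i : Fin 3) : ∀ (n : ℕ) {G : X × E3 → ℝ},
    ContDiff ℝ (m + n) G →
    ContDiff ℝ m fun q : X × E3 => (pd i)^[n] (fun x => G (q.1, x)) q.2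
  | 0, G, hG => by simpa using hG
  | n + 1, G, hG => by
    simp only [Function.iterate_succ_apply]
    exact contDiff_family_iterate_pd i n
      (G := fun q : X × E3 => pd i (fun x => G (q.1, x)) q.2)
      (contDiff_family_pd hG (by push_cast; rw [add_assoc]) i)

theorem continuous_family_mpd {k : ℕ} (α : MultiIdx k) {G : X × E3 → ℝ} (hG : ContDiff ℝ k G) :
    Continuous fun q : X × E3 => mpd α (fun x => G (q.1, x)) q.2 := by
  have h2 := contDiff_family_iterate_pd 2 _ (contDiff_of_multiIdx α hG)
  exact (contDiff_family_iterate_pd (m := 0) 0 _ (contDiff_family_iterate_pd 1 _ h2)).continuous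

theorem norm_L2_le_of_abs_le {D : Domain} {f : L2 D} {B : ℝ} (hB : 0 ≤ B)
    (h : ∀ᵐ x ∂D.μ, ‖f x‖ ≤ B) :
    ‖f‖ ≤ (measureUnivNNReal D.μ : ℝ) ^ (ENNReal.toReal 2)⁻¹ * B :=
  Lp.norm_le_of_ae_bound hB h

/-- A jointly continuous family of functions supported in a fixed compact set is continuous with
values in `L²`. -/
theorem continuous_toLp_family {Y : Type*} [TopologicalSpace Y] {D : Domain} {G : Y → E3 → ℝ}
    (hG : Continuous fun q : Y × E3 => G q.1 q.2) {K : Set E3} (hK : IsCompact K)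
    (h0 : ∀ y, ∀ x ∉ K, G y x = 0) (hm : ∀ y, MemLp (G y) 2 D.μ) :
    Continuous fun y => (hm y).toLp (G y) := by
  rw [continuous_iff_continuousAt]
  intro y
  rw [Metric.continuousAt_iff']
  intro ε hε
  set V : ℝ := (measureUnivNNReal D.μ : ℝ) ^ (ENNReal.toReal 2)⁻¹ with hV
  have hV0 : 0 ≤ V := by positivity
  have hδ : 0 < ε / (V + 1) := by positivity
  obtain ⟨v, hv, hv'⟩ := hK.mem_uniformity_of_prod (f := G) (s := univ) (q := y)
    hG.continuousOn (mem_univ _) (Metric.dist_mem_uniformity hδ)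
  rw [nhdsWithin_univ] at hv
  filter_upwards [hv] with z hz
  rw [dist_eq_norm]
  refine (norm_L2_le_of_abs_le (B := ε / (V + 1)) hδ.le ?_).trans_lt ?_
  · filter_upwards [Lp.coeFn_sub ((hm z).toLp (G z)) ((hm y).toLp (G y)), (hm z).coeFn_toLp,
      (hm y).coeFn_toLp] with x h1 h2 h3
    rw [h1, Pi.sub_apply, h2, h3]
    by_cases hx : x ∈ K
    · have := hv' z hz x hx
      rw [Set.mem_ofPred_eq, dist_eq_norm] at this
      exact this.le
    · rw [h0 _ x hx, h0 _ x hx, sub_zero, norm_zero]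
      exact hδ.le
  · rw [mul_div_assoc', div_lt_iff₀ (by positivity)]
    nlinarith

end Family

theorem norm_iteratedFDeriv_pd_le {f : E3 → ℝ} (i : Fin 3) {n : ℕ}
    (hf : ContDiff ℝ (n + 1) f) (x : E3) :
    ‖iteratedFDeriv ℝ n (pd i f) x‖ ≤ ‖iteratedFDeriv ℝ (n + 1) f x‖ := by
  have h := norm_iteratedFDeriv_clm_apply_const (c := EuclideanSpace.single i (1 : ℝ))
    (hf.fderiv_right (m := n) le_rfl).contDiffAt (x := x) (n := n) le_rfl
  rw [norm_iteratedFDeriv_fderiv] at h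
  exact h.trans (by simp)

theorem norm_iteratedFDeriv_iterate_pd_le (i : Fin 3) : ∀ (m : ℕ) {n : ℕ} {f : E3 → ℝ},
    ContDiff ℝ ((n + m : ℕ) : ℕ∞ω) f → ∀ x,
    ‖iteratedFDeriv ℝ n ((pd i)^[m] f) x‖ ≤ ‖iteratedFDeriv ℝ (n + m) f x‖
  | 0, _, _, _, _ => le_rfl
  | m + 1, n, f, hf, x => by
    rw [Function.iterate_succ_apply]
    refine (norm_iteratedFDeriv_iterate_pd_le i m (f := pd i f) (n := n)
      (contDiff_pd hf (by norm_cast) i) x).trans ?_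
    exact norm_iteratedFDeriv_pd_le i (n := n + m) (by exact_mod_cast hf) x

theorem abs_mpd_le {k : ℕ} (α : MultiIdx k) {f : E3 → ℝ} (hf : ContDiff ℝ k f) (x : E3) :
    |mpd α f x| ≤ ‖iteratedFDeriv ℝ ((α.1 0 : ℕ) + (α.1 1 : ℕ) + (α.1 2 : ℕ)) f x‖ := by
  have hg := contDiff_of_multiIdx α hf
  rw [zero_add] at hg
  have h0 : |mpd α f x| = ‖iteratedFDeriv ℝ 0 (mpd α f) x‖ := by
    rw [norm_iteratedFDeriv_zero, Real.norm_eq_abs]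
  rw [h0, mpd]
  have hg1 := contDiff_iterate_pd 2 _ hg
  have hg0 := contDiff_iterate_pd 1 _ hg1
  refine (norm_iteratedFDeriv_iterate_pd_le 0 _ (by simpa using hg0) x).trans ?_
  rw [zero_add]
  refine (norm_iteratedFDeriv_iterate_pd_le 1 _ (by exact_mod_cast hg1) x).trans ?_
  exact norm_iteratedFDeriv_iterate_pd_le 2 _ (by exact_mod_cast hg) x

theorem PiLp.norm_le_sum {ι : Type*} [Fintype ι] {β : ι → Type*}
    [∀ i, SeminormedAddCommGroup (β i)] (x : PiLp 2 β) : ‖x‖ ≤ ∑ i, ‖x i‖ := by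
  rw [PiLp.norm_eq_of_L2]
  refine Real.sqrt_le_iff.2 ⟨Finset.sum_nonneg fun _ _ => norm_nonneg _, ?_⟩
  exact Finset.sum_sq_le_sq_sum_of_nonneg fun _ _ => norm_nonneg _

/-! ### The slope in `H²` -/

theorem natCast_le_infty (n : ℕ) : (n : ℕ∞ω) ≤ ∞ := by
  exact_mod_cast le_top

/-- Uniform bounds for the derivatives of `χ F (A ρ)` as a function of `x`, for a smooth family `A`
of functionals and `ρ` in a ball. -/
theorem exists_bound_iteratedFDeriv_family {X : Type*} [NormedAddCommGroup X] [NormedSpace ℝ X]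
    {F : ℝ × ℝ → ℝ} (hF : ContDiff ℝ ∞ F) (hs : HasCompactSupport F)
    {A : E3 → X →L[ℝ] ℝ × ℝ} (hA : ContDiff ℝ ∞ A) {n : ℕ} {χ : E3 → ℝ} (hχ : ContDiff ℝ n χ)
    (hχs : HasCompactSupport χ) (R : ℝ) {j : ℕ} (hj : j ≤ n) :
    ∃ B, 0 ≤ B ∧ ∀ ρ : X, ‖ρ‖ ≤ R → ∀ x,
      ‖iteratedFDeriv ℝ j (fun x => χ x * F (A x ρ)) x‖ ≤ B := by
  choose a ha using fun i : ℕ => hχs.isCompact.exists_bound_of_continuousOn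
    (hA.continuous_iteratedFDeriv (m := i) (natCast_le_infty _)).continuousOn
  choose f hf using fun i : ℕ => (hs.iteratedFDeriv (𝕜 := ℝ) i).exists_bound_of_continuous
    (hF.continuous_iteratedFDeriv (m := i) (natCast_le_infty _))
  have hcb : ∀ i : ℕ, ∃ c, 0 ≤ c ∧ (i ≤ n → ∀ x, ‖iteratedFDeriv ℝ i χ x‖ ≤ c) := fun i => by
    by_cases hi : i ≤ n
    · obtain ⟨c, hc⟩ := (hχs.iteratedFDeriv (𝕜 := ℝ) i).exists_bound_of_continuous
        (hχ.continuous_iteratedFDeriv (m := i) (by exact_mod_cast hi))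
      exact ⟨c, (norm_nonneg _).trans (hc 0), fun _ => hc⟩
    · exact ⟨0, le_rfl, fun h => absurd h hi⟩
  choose c hc0 hc using hcb
  have hf0 : ∀ i, 0 ≤ f i := fun i => (norm_nonneg _).trans (hf i 0)
  set Cf := ∑ i ∈ Finset.range (j + 1), f i with hCf
  have hCf0 : 0 ≤ Cf := Finset.sum_nonneg fun i _ => hf0 i
  set Dd := 1 + ∑ i ∈ Finset.range (j + 1), |R| * |a i| with hDd
  have hD1 : 1 ≤ Dd := by
    have : 0 ≤ ∑ i ∈ Finset.range (j + 1), |R| * |a i| :=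
      Finset.sum_nonneg fun i _ => by positivity
    linarith
  refine ⟨∑ i ∈ Finset.range (j + 1),
    (j.choose i : ℝ) * c i * (((j - i).factorial : ℝ) * Cf * Dd ^ (j - i)),
    Finset.sum_nonneg fun i _ => by have := hc0 i; positivity, fun ρ hρ x => ?_⟩
  have hAρ : ContDiff ℝ ∞ fun x => A x ρ := hA.clm_apply contDiff_const
  by_cases hx : x ∈ tsupport χ
  · refine (norm_iteratedFDeriv_mul_le hχ ((hF.comp hAρ).of_le (m := n) (natCast_le_infty _))
      x (by exact_mod_cast hj)).trans (Finset.sum_le_sum fun i hi => ?_)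
    have hij : i ≤ j := Nat.lt_succ_iff.1 (Finset.mem_range.1 hi)
    have := hc0 i
    gcongr
    · exact hc i (hij.trans hj) x
    · refine norm_iteratedFDeriv_comp_le hF hAρ (natCast_le_infty _) x (fun m hm => ?_)
        (fun m hm1 hm => ?_)
      · exact (hf m _).trans (Finset.single_le_sum (fun i _ => hf0 i)
          (Finset.mem_range.2 (by omega)))
      · have h1 := norm_iteratedFDeriv_clm_apply_const (c := ρ) (n := m) (N := ∞)
          hA.contDiffAt (x := x) (natCast_le_infty _)
        refine h1.trans (le_trans ?_ (le_self_pow₀ hD1 (by omega)))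
        calc ‖ρ‖ * ‖iteratedFDeriv ℝ m A x‖ ≤ |R| * |a m| := by
              gcongr
              · exact hρ.trans (le_abs_self R)
              · exact (ha m x hx).trans (le_abs_self _)
          _ ≤ ∑ i ∈ Finset.range (j + 1), |R| * |a i| :=
              Finset.single_le_sum (f := fun i => |R| * |a i|) (fun i _ => by positivity)
                (Finset.mem_range.2 (by omega))
          _ ≤ Dd := by linarith
  · have h0 : iteratedFDeriv ℝ j (fun x => χ x * F (A x ρ)) x = 0 := by
      refine image_eq_zero_of_notMem_tsupport fun h => hx ?_
      exact tsupport_mul_subset_left (tsupport_iteratedFDeriv_subset j h)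
    rw [h0, norm_zero]
    exact Finset.sum_nonneg fun i _ => by have := hc0 i; positivity

/-- The functions `χ F (∇ρ̃)`, as elements of `H²` that depend continuously on `ρ` and are bounded for
`ρ` in a ball. -/
theorem exists_slope_jets {D : Domain} {k : Kernel} {l : Limiter D}
    (hcut : ContDiffOn ℝ 2 (cutoff k l) D.Ω) {F : ℝ × ℝ → ℝ} (hF : ContDiff ℝ ∞ F)
    (hs : HasCompactSupport F) (R : ℝ) :
    ∃ (Λ : Lp ℝ 1 D.μ → VJet 2 D) (C : ℝ), Continuous Λ ∧ 0 ≤ C ∧ (∀ ρ, ‖ρ‖ ≤ R → ‖Λ ρ‖ ≤ C) ∧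
      ∀ ρ i, Λ ρ i ∈ Sobolev 2 D ∧
        (Λ ρ i).val =ᵐ[D.μ] fun x => cutoffExt k l x * F (gradForm k D i x ρ) := by
  have hχ : ContDiff ℝ ((2 : ℕ) : ℕ∞ω) (cutoffExt k l) := contDiff_cutoffExt k l hcut
  have hχs := hasCompactSupport_cutoffExt k l
  set Ψ : Fin 2 → Lp ℝ 1 D.μ → E3 → ℝ :=
    fun i ρ x => cutoffExt k l x * F (gradForm k D i x ρ) with hΨ
  have hjoint : ∀ i, ContDiff ℝ ((2 : ℕ) : ℕ∞ω) fun q : Lp ℝ 1 D.μ × E3 => Ψ i q.1 q.2 := fun i =>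
    (hχ.comp contDiff_snd).mul ((hF.of_le (by norm_cast)).comp
      ((((contDiff_gradForm k i).of_le (by norm_cast)).comp contDiff_snd).clm_apply contDiff_fst))
  have hd : ∀ i ρ, ContDiff ℝ ((2 : ℕ) : ℕ∞ω) (Ψ i ρ) := fun i ρ =>
    (hjoint i).comp (contDiff_const.prodMk contDiff_id)
  have hsub : ∀ (i : Fin 2) (ρ : Lp ℝ 1 D.μ) (α : MultiIdx 2), ∀ x ∉ tsupport (cutoffExt k l),
      mpd α (Ψ i ρ) x = 0 := by
    intro i ρ α x hx
    have h := abs_mpd_le α (hd i ρ) x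
    rw [image_eq_zero_of_notMem_tsupport (f := iteratedFDeriv ℝ _ (Ψ i ρ)) fun h =>
      hx (tsupport_mul_subset_left (tsupport_iteratedFDeriv_subset _ h)), norm_zero] at h
    exact abs_nonpos_iff.1 h
  choose B hB0 hB using fun (i : Fin 2) (α : MultiIdx 2) =>
    exists_bound_iteratedFDeriv_family hF hs (contDiff_gradForm k (D := D) i) hχ hχs R α.sum_le
  set V : ℝ := (measureUnivNNReal D.μ : ℝ) ^ (ENNReal.toReal 2)⁻¹ with hV
  have hV0 : 0 ≤ V := by positivity
  refine ⟨fun ρ => WithLp.toLp 2 fun i => jetOf 2 D (Ψ i ρ) (hd i ρ),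
    ∑ i, ∑ α, V * B i α, ?_, ?_, fun ρ hρ => ?_, fun ρ i => ⟨jetOf_mem_sobolev (hd i ρ), ?_⟩⟩
  · refine (PiLp.continuous_toLp 2 _).comp (continuous_pi fun i => ?_)
    refine (PiLp.continuous_toLp 2 _).comp (continuous_pi fun α => ?_)
    exact continuous_toLp_family (G := fun ρ => mpd α (Ψ i ρ))
      (continuous_family_mpd α (hjoint i)) hχs.isCompact (fun ρ x hx => hsub i ρ α x hx)
      fun ρ => memLp_mpd D α (hd i ρ)
  · exact Finset.sum_nonneg fun i _ => Finset.sum_nonneg fun α _ => mul_nonneg hV0 (hB0 i α)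
  · refine (PiLp.norm_le_sum _).trans (Finset.sum_le_sum fun i _ => ?_)
    refine (PiLp.norm_le_sum _).trans (Finset.sum_le_sum fun α _ => ?_)
    refine norm_L2_le_of_abs_le (hB0 i α) ?_
    filter_upwards [isJetOf_jetOf (D := D) (hd i ρ) α] with x hx
    exact (congrArg norm hx).trans_le ((abs_mpd_le α (hd i ρ) x).trans (hB i α ρ hρ x))
  · exact isJetOf_jetOf (D := D) (hd i ρ) (MultiIdx.zero 2)

/-- The slope of a density with `L¹` norm at most `R`, in terms of a compactly supported function of
the density gradients. -/
theorem exists_slope_eq_family (D : Domain) (k : Kernel) (l : Limiter D) (R : ℝ) :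
    ∃ F : ℝ × ℝ → ℝ, ContDiff ℝ ∞ F ∧ HasCompactSupport F ∧
      ∀ (ρ : E3 → ℝ) (r : Lp ℝ 1 D.μ), r =ᵐ[D.μ] ρ → ‖r‖ ≤ R → ∀ i x,
        slope k l ρ i x = cutoffExt k l x * F (gradForm k D i x r) := by
  obtain ⟨c, hc0, hc⟩ := exists_norm_gradForm_le k
  obtain ⟨F, hF, hs, heq⟩ := exists_smooth_extension (isCompact_closedBall (0 : ℝ × ℝ) (c * R))
    isOpen_univ (subset_univ _) l.contDiff_ratio.contDiffOn
  refine ⟨F, hF, hs, fun ρ r hr hR i x => ?_⟩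
  rw [slope_eq k l hr, heq]
  rw [mem_closedBall_zero_iff]
  exact ((gradForm k D i x).le_of_opNorm_le (hc D i x) r).trans (by gcongr)

theorem norm_le_of_mem_Icc {D : Domain} {r : Lp ℝ 1 D.μ} {R₁ R₂ : ℝ} (hR : 0 < R₁)
    (h : ∀ᵐ x ∂D.μ, r x ∈ Icc R₁ R₂) : ‖r‖ ≤ R₂ * D.μ.real univ := by
  rw [L1.norm_eq_integral_norm, ← Real.norm_of_nonneg (integral_nonneg fun _ => norm_nonneg _)]
  refine norm_integral_le_of_norm_le_const ?_
  filter_upwards [h] with x hx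
  rw [norm_norm, Real.norm_eq_abs, abs_of_pos (hR.trans_le hx.1)]
  exact hx.2

theorem Jet.continuous_val {k : ℕ} {D : Domain} : Continuous (Jet.val : Jet k D → L2 D) :=
  PiLp.continuous_apply 2 _ _

theorem EOS.measurable_pst {D : Domain} (e : EOS D) : Measurable fun x : E3 => e.pst (x 2) := by
  unfold EOS.pst
  fun_prop

/-- The slope is bounded in `H²` in terms of the range of the density. As the density is at least
`R₁ > 0`, its `L²` norm is bounded below, so that any bound can be written as a multiple of the
square of this norm. -/
theorem slope_mem_H2 (D : Domain) (k : Kernel) (l : Limiter D)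
    (hcut : ContDiffOn ℝ 2 (cutoff k l) D.Ω) (R₁ R₂ : ℝ) :
    ∃ C : ℝ, ∀ e : EOS D, e.R₁ = R₁ → e.R₂ = R₂ →
      ∀ (kθ m T : ℝ), 0 < T → ∀ θ S : ℝ → Jet 1 D,
        IsTemperature e kθ T θ → IsSalinity e m T S →
        ∃ Λ : ℝ → VJet 2 D,
          MemLp Λ ⊤ (volume.restrict (Icc 0 T)) ∧
          ∀ᵐ t ∂volume.restrict (Icc 0 T),
            (∀ i, Λ t i ∈ Sobolev 2 D ∧
              (Λ t i).val =ᵐ[D.μ] slope k l (e.density (θ t) (S t)) i) ∧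
            MemLp (e.density (θ t) (S t)) 2 D.μ ∧
            ‖Λ t‖ ≤ C * (eLpNorm (e.density (θ t) (S t)) 2 D.μ).toReal ^ 2 := by
  set R := R₂ * D.μ.real univ with hR
  obtain ⟨F, hF, hs, hslope⟩ := exists_slope_eq_family D k l R
  obtain ⟨Λ, C, hΛc, hC0, hΛ, hΛ'⟩ := exists_slope_jets hcut hF hs R
  set W := R₁ * (D.μ univ).toReal ^ (1 / 2 : ℝ) with hW
  refine ⟨C / W ^ 2, fun e e1 e2 kθ m T hT θ S hθ hS => ?_⟩
  obtain ⟨g, hg, hgs, hgeq⟩ := e.exists_smooth_rho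
  obtain ⟨N, N', C', hN, -, hN', -⟩ := exists_superposition (D := D) hg hgs e.measurable_pst
  have hNc : Continuous N := continuous_iff_continuousAt.2 fun u => (hN' u).continuousAt
  have hR₁ : 0 < R₁ := e1 ▸ e.R₁_pos
  have hvol : 0 < (D.μ univ).toReal := ENNReal.toReal_pos D.measure_univ_pos.ne' (measure_ne_top _ _)
  have hW0 : 0 < W := by positivity
  have key : ∀ᵐ t ∂volume.restrict (Icc 0 T),
      (N ((θ t).val, (S t).val) =ᵐ[D.μ] e.density (θ t) (S t)) ∧
      (∀ᵐ x ∂D.μ, e.density (θ t) (S t) x ∈ Icc R₁ R₂) ∧ ‖N ((θ t).val, (S t).val)‖ ≤ R := by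
    filter_upwards [hθ.2, hS.2] with t h1 h2
    have hNe : N ((θ t).val, (S t).val) =ᵐ[D.μ] e.density (θ t) (S t) := by
      filter_upwards [hN ((θ t).val, (S t).val), h1.2, h2.2, D.ae_mem_Ω] with x h3 h4 h5 h6
      rw [h3]
      exact hgeq _ h4 _ h5 _ (e.pst_mem h6)
    have hd := e.density_mem h1.2 h2.2
    rw [e1, e2] at hd
    refine ⟨hNe, hd, norm_le_of_mem_Icc hR₁ ?_⟩
    filter_upwards [hNe, hd] with x h3 h4
    rwa [h3]
  refine ⟨fun t => Λ (N ((θ t).val, (S t).val)), MemLp.of_bound ?_ C ?_, ?_⟩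
  · exact hΛc.comp_aestronglyMeasurable (hNc.comp_aestronglyMeasurable
      ((Jet.continuous_val.comp_aestronglyMeasurable hθ.1.1).prodMk
        (Jet.continuous_val.comp_aestronglyMeasurable hS.1.1)))
  · filter_upwards [key] with t ht using hΛ _ ht.2.2
  · filter_upwards [key, hθ.2, hS.2] with t ⟨h1, h2, h3⟩ h4 h5
    have hmem := e.memLp_density h4.2 h5.2 2
    refine ⟨fun i => ⟨(hΛ' _ i).1, (hΛ' _ i).2.trans (ae_of_all _ fun x => ?_)⟩, hmem, ?_⟩
    · exact (hslope _ _ h1 h3 i x).symm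
    · refine (hΛ _ h3).trans ?_
      -- The density is at least `R₁`, so that its `L²` norm is at least `W`.
      have hlow : W ≤ (eLpNorm (e.density (θ t) (S t)) 2 D.μ).toReal := by
        have hc : eLpNorm (fun _ : E3 => R₁) 2 D.μ ≤ eLpNorm (e.density (θ t) (S t)) 2 D.μ := by
          refine eLpNorm_mono_ae ?_
          filter_upwards [h2] with x hx
          rw [Real.norm_eq_abs, Real.norm_eq_abs, abs_of_pos hR₁, abs_of_pos (hR₁.trans_le hx.1)]
          exact hx.1
        have h6 := ENNReal.toReal_mono hmem.2.ne hc
        rw [eLpNorm_const' _ (by norm_num) (by norm_num), ENNReal.toReal_mul,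
          ← ENNReal.toReal_rpow, toReal_enorm, Real.norm_of_nonneg hR₁.le] at h6
        simpa [hW] using h6
      rw [div_mul_eq_mul_div, le_div_iff₀ (by positivity)]
      gcongr

/-! ### The vertical velocity -/

theorem continuous_lift3 : Continuous fun q : E2 × ℝ => lift3 q.1 q.2 := by
  unfold lift3
  refine (PiLp.continuous_toLp 2 _).comp (continuous_pi fun i => ?_)
  fin_cases i
  · exact (by fun_prop : Continuous fun q : E2 × ℝ => q.1 0)
  · exact (by fun_prop : Continuous fun q : E2 × ℝ => q.1 1)
  · exact continuous_snd

theorem lift3_hor (x : E3) : lift3 (hor x) (x 2) = x := by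
  ext i
  fin_cases i <;> rfl

theorem measurePreserving_hor_prod :
    MeasurePreserving (fun x : E3 => (hor x, x 2)) (volume : Measure E3)
      ((volume : Measure E2).prod (volume : Measure ℝ)) := by
  have h1 : MeasurePreserving _ (volume : Measure E3) volume := PiLp.volume_preserving_ofLp (Fin 3)
  have h2 := volume_preserving_piFinSuccAbove (fun _ : Fin 3 => ℝ) 2
  have h3 : MeasurePreserving _ ((volume : Measure ℝ).prod (volume : Measure (Fin 2 → ℝ))) _ :=
    Measure.measurePreserving_swap
  have h4 : MeasurePreserving _ (volume : Measure (Fin 2 → ℝ)) (volume : Measure E2) :=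
    PiLp.volume_preserving_toLp (Fin 2)
  have h5 := h4.prod (MeasurePreserving.id (volume : Measure ℝ))
  convert h5.comp (h3.comp (h2.comp h1)) using 1
  funext x
  refine Prod.ext ?_ rfl
  ext i
  fin_cases i <;> rfl

/-- Fubini's theorem on the cylinder `Ω`. -/
theorem Domain.lintegral_eq (D : Domain) {f : E3 → ENNReal} (hf : Measurable f) :
    ∫⁻ x, f x ∂D.μ = ∫⁻ p, (∫⁻ z in Ioo (-D.h) 0, f (lift3 p z)) ∂D.μM := by
  have hs : MeasurableSet (D.M ×ˢ Ioo (-D.h) 0) := D.isOpen_M.measurableSet.prod measurableSet_Ioo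
  have h := measurePreserving_hor_prod.restrict_preimage hs
  rw [← Measure.prod_restrict] at h
  have hm : Measurable fun q : E2 × ℝ => f (lift3 q.1 q.2) := hf.comp continuous_lift3.measurable
  rw [← lintegral_prod _ hm.aemeasurable, ← h.lintegral_comp hm]
  simp only [lift3_hor]
  rfl

/-- The square of an integral is at most the total mass times the integral of the square. -/
theorem lintegral_rpow_two_le {α : Type*} [MeasurableSpace α] {ν : Measure α} {f : α → ENNReal}
    (hf : AEMeasurable f ν) :
    (∫⁻ x, f x ∂ν) ^ (2 : ℝ) ≤ ν univ * ∫⁻ x, f x ^ (2 : ℝ) ∂ν := by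
  have h := ENNReal.lintegral_mul_le_Lp_mul_Lq ν Real.HolderConjugate.two_two hf
    (aemeasurable_const (b := (1 : ENNReal)))
  simp only [Pi.mul_apply, mul_one, ENNReal.one_rpow, lintegral_const, one_mul] at h
  refine (ENNReal.rpow_le_rpow h (by norm_num : (0 : ℝ) ≤ 2)).trans_eq ?_
  rw [ENNReal.mul_rpow_of_nonneg _ _ (by norm_num), ← ENNReal.rpow_mul, ← ENNReal.rpow_mul]
  norm_num
  rw [mul_comm]

/-- The vertical velocity is controlled in `L²` by the horizontal velocity in `H¹`, in a form that
does not mention its measurability. -/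
theorem lintegral_vertVel_mul_le {D : Domain} (v : VJet 1 D) (q : L2 D) :
    ∫⁻ x, ‖vertVel v x‖ₑ * ‖q x‖ₑ ∂D.μ ≤
      ENNReal.ofReal (D.h * (‖(v 0).grad 0‖ + ‖(v 1).grad 1‖) * ‖q‖) := by
  set d : E3 → ℝ := fun x => (v 0).grad 0 x + (v 1).grad 1 x with hd
  have hdm : Measurable d := (Lp.stronglyMeasurable ((v 0).grad 0)).measurable.add
    (Lp.stronglyMeasurable ((v 1).grad 1)).measurable
  set W : E2 → ENNReal := fun p => ∫⁻ z in Ioo (-D.h) 0, ‖d (lift3 p z)‖ₑ with hW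
  have hdl : Measurable fun r : E2 × ℝ => ‖d (lift3 r.1 r.2)‖ₑ :=
    (hdm.comp continuous_lift3.measurable).enorm
  have hWm : Measurable W := hdl.lintegral_prod_right'
  have hWh : Measurable fun x : E3 => W (hor x) := hWm.comp continuous_hor.measurable
  have hpt : ∀ᵐ x ∂D.μ, ‖vertVel v x‖ₑ * ‖q x‖ₑ ≤ W (hor x) * ‖q x‖ₑ := by
    filter_upwards [D.ae_mem_Ω] with x hx
    gcongr
    rw [vertVel, enorm_neg, intervalIntegral.integral_of_le hx.2.1.le]
    refine (enorm_integral_le_lintegral_enorm _).trans ?_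
    exact lintegral_mono_set fun ζ hζ => ⟨hζ.1, hζ.2.trans_lt hx.2.2⟩
  have hvol : (volume.restrict (Ioo (-D.h) 0)) univ = ENNReal.ofReal D.h := by simp
  have hW2 : ∫⁻ x, W (hor x) ^ (2 : ℝ) ∂D.μ ≤
      ENNReal.ofReal D.h ^ (2 : ℝ) * ∫⁻ x, ‖d x‖ₑ ^ (2 : ℝ) ∂D.μ := by
    rw [D.lintegral_eq (hWh.pow_const _), D.lintegral_eq (hdm.enorm.pow_const _),
      ← lintegral_const_mul _ ((hdl.pow_const _).lintegral_prod_right' (ν := volume.restrict (Ioo (-D.h) 0)))]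
    refine lintegral_mono fun p => ?_
    have hhor : ∀ z, hor (lift3 p z) = p := fun z => by
      ext i
      fin_cases i <;> rfl
    simp only [hhor, lintegral_const, hvol]
    have h := lintegral_rpow_two_le (ν := volume.restrict (Ioo (-D.h) 0))
      (f := fun z => ‖d (lift3 p z)‖ₑ) (hdl.comp measurable_prodMk_left).aemeasurable
    rw [hvol] at h
    calc W p ^ (2 : ℝ) * ENNReal.ofReal D.h
        ≤ (ENNReal.ofReal D.h * ∫⁻ z in Ioo (-D.h) 0, ‖d (lift3 p z)‖ₑ ^ (2 : ℝ)) *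
          ENNReal.ofReal D.h := by gcongr
      _ = _ := by
        rw [ENNReal.rpow_two, pow_two]
        ring
  have hhol := ENNReal.lintegral_mul_le_Lp_mul_Lq D.μ Real.HolderConjugate.two_two
    hWh.aemeasurable (Lp.stronglyMeasurable q).measurable.enorm.aemeasurable
  refine (lintegral_mono_ae hpt).trans (hhol.trans ?_)
  have hq : (∫⁻ x, ‖q x‖ₑ ^ (2 : ℝ) ∂D.μ) ^ (1 / 2 : ℝ) = ENNReal.ofReal ‖q‖ := by
    have := eLpNorm_eq_lintegral_rpow_enorm_toReal (f := q) (μ := D.μ) (p := 2) (by norm_num)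
      (by norm_num)
    rw [ENNReal.toReal_ofNat] at this
    rw [← this, Lp.norm_def, ENNReal.ofReal_toReal (Lp.eLpNorm_ne_top q)]
  have hd2 : (∫⁻ x, ‖d x‖ₑ ^ (2 : ℝ) ∂D.μ) ^ (1 / 2 : ℝ) ≤
      ENNReal.ofReal (‖(v 0).grad 0‖ + ‖(v 1).grad 1‖) := by
    have := eLpNorm_eq_lintegral_rpow_enorm_toReal (f := d) (μ := D.μ) (p := 2) (by norm_num)
      (by norm_num)
    rw [ENNReal.toReal_ofNat] at this
    rw [← this]
    refine (eLpNorm_add_le (Lp.aestronglyMeasurable _) (Lp.aestronglyMeasurable _)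
      one_le_two).trans_eq ?_
    rw [ENNReal.ofReal_add (norm_nonneg _) (norm_nonneg _), Lp.norm_def, Lp.norm_def,
      ENNReal.ofReal_toReal (Lp.eLpNorm_ne_top _), ENNReal.ofReal_toReal (Lp.eLpNorm_ne_top _)]
  have hh := D.h_pos.le
  rw [hq, ENNReal.ofReal_mul (by positivity), ENNReal.ofReal_mul hh]
  gcongr
  refine (ENNReal.rpow_le_rpow hW2 (by norm_num : (0 : ℝ) ≤ 1 / 2)).trans ?_
  rw [ENNReal.mul_rpow_of_nonneg _ _ (by norm_num), ← ENNReal.rpow_mul]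
  norm_num only [ENNReal.rpow_one]
  gcongr

/-! ### Estimates for the terms of the tracer equations -/

section Estimates

variable {D : Domain}

theorem Jet.norm_val_le {k : ℕ} (u : Jet k D) : ‖u.val‖ ≤ ‖u‖ := PiLp.norm_apply_le u _

theorem Jet.norm_grad_le (u : Jet 1 D) (i : Fin 3) : ‖u.grad i‖ ≤ ‖u‖ := PiLp.norm_apply_le u _

theorem lintegral_enorm_mul_enorm_le (a b : L2 D) :
    ∫⁻ x, ‖a x‖ₑ * ‖b x‖ₑ ∂D.μ ≤ ENNReal.ofReal (‖a‖ * ‖b‖) := by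
  obtain ⟨h1, h2⟩ := integral_abs_mul_abs_le a b
  refine le_trans (le_of_eq ?_) (ENNReal.ofReal_le_ofReal h2)
  rw [ofReal_integral_eq_lintegral_ofReal h1 (ae_of_all _ fun x => by positivity)]
  refine lintegral_congr fun x => ?_
  rw [ENNReal.ofReal_mul (abs_nonneg _), ← Real.norm_eq_abs, ← Real.norm_eq_abs, ofReal_norm,
    ofReal_norm]

/-- The transport term is only bounded in `L¹`; it has to be tested with bounded functions. -/
theorem lintegral_advect_le (v : VJet 1 D) (u : Jet 1 D) :
    ∫⁻ x, ‖advect v u x‖ₑ ∂D.μ ≤ ENNReal.ofReal ((2 + 2 * D.h) * (‖v‖ * ‖u‖)) := by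
  have hv : ∀ i, ‖v i‖ ≤ ‖v‖ := fun i => PiLp.norm_apply_le v i
  have hm : ∀ a b : L2 D, Measurable fun x => ‖a x‖ₑ * ‖b x‖ₑ := fun a b =>
    (Lp.stronglyMeasurable a).measurable.enorm.mul (Lp.stronglyMeasurable b).measurable.enorm
  have hpt : ∀ x, ‖advect v u x‖ₑ ≤ (‖(v 0).val x‖ₑ * ‖u.grad 0 x‖ₑ +
      ‖(v 1).val x‖ₑ * ‖u.grad 1 x‖ₑ) + ‖vertVel v x‖ₑ * ‖u.grad 2 x‖ₑ := fun x => by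
    rw [advect, ← enorm_mul, ← enorm_mul, ← enorm_mul]
    exact (enorm_add_le _ _).trans (add_le_add_left (enorm_add_le _ _) _)
  have hb : ∀ i j, ‖(v i).val‖ * ‖u.grad j‖ ≤ ‖v‖ * ‖u‖ := fun i j =>
    mul_le_mul ((Jet.norm_val_le _).trans (hv i)) (u.norm_grad_le j) (norm_nonneg _) (norm_nonneg _)
  have hw : D.h * (‖(v 0).grad 0‖ + ‖(v 1).grad 1‖) * ‖u.grad 2‖ ≤ 2 * D.h * (‖v‖ * ‖u‖) := by
    have := D.h_pos.le
    calc D.h * (‖(v 0).grad 0‖ + ‖(v 1).grad 1‖) * ‖u.grad 2‖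
        ≤ D.h * (‖v‖ + ‖v‖) * ‖u‖ := by
          gcongr
          · exact (Jet.norm_grad_le _ _).trans (hv 0)
          · exact (Jet.norm_grad_le _ _).trans (hv 1)
          · exact u.norm_grad_le 2
      _ = _ := by ring
  have hh := D.h_pos.le
  refine (lintegral_mono hpt).trans ?_
  have hm' : Measurable fun x => ‖(v 0).val x‖ₑ * ‖u.grad 0 x‖ₑ + ‖(v 1).val x‖ₑ * ‖u.grad 1 x‖ₑ :=
    (hm _ _).add (hm _ _)
  rw [lintegral_add_left hm', lintegral_add_left (hm _ _)]
  calc _ ≤ (ENNReal.ofReal (‖v‖ * ‖u‖) + ENNReal.ofReal (‖v‖ * ‖u‖)) +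
        ENNReal.ofReal (2 * D.h * (‖v‖ * ‖u‖)) := by
        refine add_le_add (add_le_add ?_ ?_) ?_
        · exact (lintegral_enorm_mul_enorm_le _ _).trans (ENNReal.ofReal_le_ofReal (hb _ _))
        · exact (lintegral_enorm_mul_enorm_le _ _).trans (ENNReal.ofReal_le_ofReal (hb _ _))
        · exact (lintegral_vertVel_mul_le v _).trans (ENNReal.ofReal_le_ofReal hw)
    _ = _ := by
      rw [← ENNReal.ofReal_add (by positivity) (by positivity),
        ← ENNReal.ofReal_add (by positivity) (by positivity)]
      ring_nf

theorem abs_integral_advect_mul_le (v : VJet 1 D) (u : Jet 1 D) {φ : L2 D} {a : ℝ} (ha : 0 ≤ a)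
    (hφ : ∀ᵐ x ∂D.μ, |φ x| ≤ a) :
    |∫ x, advect v u x * φ x ∂D.μ| ≤ a * ((2 + 2 * D.h) * (‖v‖ * ‖u‖)) := by
  have hh := D.h_pos.le
  rw [← Real.norm_eq_abs, ← ENNReal.ofReal_le_ofReal_iff (by positivity), ofReal_norm]
  refine (enorm_integral_le_lintegral_enorm _).trans ?_
  rw [ENNReal.ofReal_mul ha]
  have : ∀ᵐ x ∂D.μ, ‖advect v u x * φ x‖ₑ ≤ ENNReal.ofReal a * ‖advect v u x‖ₑ := by
    filter_upwards [hφ] with x hx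
    rw [enorm_mul, mul_comm]
    gcongr
    rw [← ofReal_norm]
    exact ENNReal.ofReal_le_ofReal hx
  refine (lintegral_mono_ae this).trans ?_
  rw [lintegral_const_mul' _ _ ENNReal.ofReal_ne_top]
  gcongr
  exact lintegral_advect_le v u

theorem abs_integral_fluxDot_le {K : E3 → Matrix (Fin 3) (Fin 3) ℝ} {κ : ℝ} (hκ : 0 ≤ κ)
    (hK : ∀ x i j, |K x i j| ≤ κ) (u φ : Jet 1 D) {b : ℝ} (hb : ∀ i, ‖φ.grad i‖ ≤ b) :
    |∫ x, fluxDot K u φ x ∂D.μ| ≤ 9 * κ * (‖u‖ * b) := by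
  have hint := fun i j => integral_abs_mul_abs_le (u.grad j) (φ.grad i)
  have hI : Integrable (fun x => κ * ∑ i, ∑ j, |u.grad j x| * |φ.grad i x|) D.μ :=
    (integrable_finsetSum _ fun i _ => integrable_finsetSum _ fun j _ => (hint i j).1).const_mul κ
  rw [← Real.norm_eq_abs]
  refine (norm_integral_le_of_norm_le hI (ae_of_all _ fun x => ?_)).trans ?_
  · rw [fluxDot, dotProduct, Finset.mul_sum]
    refine (norm_sum_le _ _).trans (Finset.sum_le_sum fun i _ => ?_)
    rw [Matrix.mulVec, dotProduct, Finset.sum_mul, Finset.mul_sum]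
    refine (norm_sum_le _ _).trans (Finset.sum_le_sum fun j _ => ?_)
    rw [norm_mul, norm_mul, mul_assoc]
    exact mul_le_mul_of_nonneg_right (hK x i j) (by positivity)
  · rw [integral_const_mul, integral_finsetSum _ fun i _ => integrable_finsetSum _ fun j _ =>
      (hint i j).1]
    have : ∀ i, ∫ x, ∑ j, |u.grad j x| * |φ.grad i x| ∂D.μ ≤ 3 * (‖u‖ * b) := fun i => by
      rw [integral_finsetSum _ fun j _ => (hint i j).1]
      refine (Finset.sum_le_card_nsmul _ _ (‖u‖ * b) fun j _ => (hint i j).2.trans ?_).trans_eq ?_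
      · exact mul_le_mul (u.norm_grad_le j) (hb i) (norm_nonneg _) (norm_nonneg _)
      · simp
    have h2 : ∑ i : Fin 3, ∫ x, ∑ j, |u.grad j x| * |φ.grad i x| ∂D.μ ≤ 9 * (‖u‖ * b) := by
      refine (Finset.sum_le_card_nsmul _ _ _ fun i _ => this i).trans_eq ?_
      simp
      ring
    calc _ ≤ κ * (9 * (‖u‖ * b)) := mul_le_mul_of_nonneg_left h2 hκ
      _ = _ := by ring

theorem exists_tensor_bound (p : Params) (L : ℝ) : ∃ κ, 0 ≤ κ ∧ ∀ a b : ℝ, |a| ≤ L → |b| ≤ L →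
    ∀ i j, |Kiso p a b i j| ≤ κ ∧ |Kgm p a b i j| ≤ κ := by
  have hc : ∀ i j, Continuous fun q : ℝ × ℝ => Kiso p q.1 q.2 i j := fun i j => by
    have h1 : Continuous fun q : ℝ × ℝ => p.KI / (1 + (q.1 ^ 2 + q.2 ^ 2)) :=
      continuous_const.div (by fun_prop) fun q => by positivity
    unfold Kiso
    simp only [Matrix.smul_apply, smul_eq_mul]
    refine h1.mul ?_
    fin_cases i <;> fin_cases j <;> simp <;> fun_prop
  have hc' : ∀ i j, Continuous fun q : ℝ × ℝ => Kgm p q.1 q.2 i j := fun i j => by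
    unfold Kgm
    simp only [Matrix.smul_apply, smul_eq_mul]
    refine continuous_const.mul ?_
    fin_cases i <;> fin_cases j <;> simp <;> fun_prop
  have hcomp : IsCompact (Icc (-L) L ×ˢ Icc (-L) L) := isCompact_Icc.prod isCompact_Icc
  choose A hA using fun i j => hcomp.exists_bound_of_continuousOn (hc i j).continuousOn
  choose B hB using fun i j => hcomp.exists_bound_of_continuousOn (hc' i j).continuousOn
  refine ⟨∑ i, ∑ j, (|A i j| + |B i j|), by positivity, fun a b ha hb i j => ?_⟩
  have hle : |A i j| + |B i j| ≤ ∑ i, ∑ j, (|A i j| + |B i j|) :=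
    (Finset.single_le_sum (f := fun j => |A i j| + |B i j|) (fun _ _ => by positivity)
      (Finset.mem_univ j)).trans
    (Finset.single_le_sum (f := fun i => ∑ j, (|A i j| + |B i j|)) (fun _ _ => by positivity)
      (Finset.mem_univ i))
  have hmem : (a, b) ∈ Icc (-L) L ×ˢ Icc (-L) L := ⟨abs_le.1 ha, abs_le.1 hb⟩
  have h1 := (hA i j (a, b) hmem).trans (le_abs_self _)
  have h2 := (hB i j (a, b) hmem).trans (le_abs_self _)
  rw [Real.norm_eq_abs] at h1 h2
  exact ⟨by linarith [abs_nonneg (B i j)], by linarith [abs_nonneg (A i j)]⟩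

/-- All terms of a tracer equation other than the one with the time derivative are controlled by
`H¹` norms and by the supremum of the test function. -/
theorem abs_tracerForm_sub_le {k : Kernel} {l : Limiter D} {p : Params} {ρ : E3 → ℝ} {L κ : ℝ}
    (hρ : ∀ i x, |slope k l ρ i x| ≤ L) (hκ : 0 ≤ κ)
    (hK : ∀ a b : ℝ, |a| ≤ L → |b| ≤ L → ∀ i j, |Kiso p a b i j| ≤ κ ∧ |Kgm p a b i j| ≤ κ)
    (v : VJet 1 D) (u : Jet 1 D) (ut : L2 D) (φ : Jet 1 D) {a b : ℝ} (ha : 0 ≤ a)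
    (hφ : ∀ᵐ x ∂D.μ, |φ.val x| ≤ a) (hb : ∀ i, ‖φ.grad i‖ ≤ b) :
    |tracerForm k l p ρ v u ut φ - ∫ x, ut x * φ.val x ∂D.μ| ≤
      a * ((2 + 2 * D.h) * (‖v‖ * ‖u‖)) + 18 * κ * (‖u‖ * b) := by
  have h1 := abs_integral_advect_mul_le v u ha hφ
  have h2 := abs_integral_fluxDot_le (K := fun y => Kiso p (slope k l ρ 0 y) (slope k l ρ 1 y)) hκ
    (fun x i j => (hK _ _ (hρ 0 x) (hρ 1 x) i j).1) u φ hb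
  have h3 := abs_integral_fluxDot_le (K := fun y => Kgm p (slope k l ρ 0 y) (slope k l ρ 1 y)) hκ
    (fun x i j => (hK _ _ (hρ 0 x) (hρ 1 x) i j).2) u φ hb
  unfold tracerForm
  rw [abs_le] at h1 h2 h3 ⊢
  constructor <;> linarith [h1.1, h1.2, h2.1, h2.2, h3.1, h3.2]

end Estimates

/-! ### Test functions -/

section Test

variable {D : Domain}

/-- The first-order jet of a smooth function. -/
def smoothJet (D : Domain) (f : E3 → ℝ) (hf : ContDiff ℝ ∞ f) : Jet 1 D :=
  jetOf 1 D f (hf.of_le (natCast_le_infty 1))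

theorem isJetOf_smoothJet {f : E3 → ℝ} (hf : ContDiff ℝ ∞ f) : IsJetOf (smoothJet D f hf) f :=
  isJetOf_jetOf _

theorem IsJetOf.val_eq {u : Jet 1 D} {f : E3 → ℝ} (h : IsJetOf u f) : u.val =ᵐ[D.μ] f :=
  h (MultiIdx.zero 1)

theorem IsJetOf.grad_eq {u : Jet 1 D} {f : E3 → ℝ} (h : IsJetOf u f) (i : Fin 3) :
    u.grad i =ᵐ[D.μ] pd i f := by
  have h := h (MultiIdx.unit i)
  have e : mpd (MultiIdx.unit i) f = pd i f := by
    fin_cases i <;> rfl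
  rwa [e] at h

theorem IsTest.eq_zero {f : E3 → ℝ} (hf : IsTest D.Ω f) {x : E3} (hx : x ∉ D.Ω) : f x = 0 :=
  image_eq_zero_of_notMem_tsupport fun h => hx (hf.2.2 h)

theorem IsTest.pd_eq_zero {f : E3 → ℝ} (hf : IsTest D.Ω f) {x : E3} (hx : x ∉ D.Ω) (i : Fin 3) :
    pd i f x = 0 :=
  pd_eq_zero_of_notMem_tsupport (fun h => hx (hf.2.2 h)) i

/-- The condition `∂_z φ = -k_θ φ` at the surface is compatible with subtracting a constant only if
`k_θ = 0`. -/
theorem IsTest.tempBC_sub_const {f : E3 → ℝ} (hf : IsTest D.Ω f) (kθ c : ℝ) (h : kθ = 0 ∨ c = 0) :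
    TempBC D kθ fun x => f x - c := by
  have hpd : ∀ i, pd i (fun x => f x - c) = pd i f := fun i => by
    funext x
    rw [pd, pd, fderiv_sub_const]
  have htop : ∀ p, lift3 p 0 ∉ D.Ω := fun p hp => lt_irrefl (0 : ℝ) hp.2.2
  have hbot : ∀ p, lift3 p (-D.h) ∉ D.Ω := fun p hp => lt_irrefl (-D.h) hp.2.1
  have hside : ∀ p ∈ frontier D.M, ∀ z, lift3 p z ∉ D.Ω := fun p hp z hz => by
    have : hor (lift3 p z) = p := by
      ext i
      fin_cases i <;> rfl
    rw [D.isOpen_M.frontier_eq] at hp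
    exact hp.2 (this ▸ hz.1)
  refine ⟨fun p _ => ?_, fun p _ => ?_, fun p hp n _ z _ => ?_⟩
  · show _ = -kθ * (f (lift3 p 0) - c)
    rw [hpd, hf.pd_eq_zero (htop p), hf.eq_zero (htop p)]
    rcases h with rfl | rfl <;> simp
  · rw [hpd, hf.pd_eq_zero (hbot p)]
  · rw [hpd, hpd, hf.pd_eq_zero (hside p hp z), hf.pd_eq_zero (hside p hp z)]
    simp

theorem IsTest.smoothJet_mem_Vθ {f : E3 → ℝ} (hf : IsTest D.Ω f) (kθ : ℝ) :
    smoothJet D f hf.1 ∈ Vθ D kθ :=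
  subset_closure ⟨f, hf.1, by simpa using hf.tempBC_sub_const kθ 0 (Or.inr rfl),
    isJetOf_smoothJet hf.1⟩

theorem IsTest.isSurfaceTrace_zero {f : E3 → ℝ} (hf : IsTest D.Ω f) :
    IsSurfaceTrace D (smoothJet D f hf.1) 0 := by
  refine ⟨MemLp.zero', fun φ hφ => ?_⟩
  have hj := isJetOf_smoothJet (D := D) hf.1
  have hf1 : ContDiff ℝ 1 f := hf.1.of_le (natCast_le_infty 1)
  have hφ1 : ContDiff ℝ 1 φ := hφ.1.of_le (natCast_le_infty 1)
  have hpf : Continuous (pd 2 f) := (contDiff_pd_infty hf.1 2).continuous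
  have hpφ : Continuous (pd 2 φ) := (contDiff_pd_infty hφ.1 2).continuous
  have e : ∫ x, ((smoothJet D f hf.1).grad 2 x * φ x + (smoothJet D f hf.1).val x * pd 2 φ x) ∂D.μ =
      ∫ x, (pd 2 f x * φ x + f x * pd 2 φ x) := by
    have h0 : ∫ x, (pd 2 f x * φ x + f x * pd 2 φ x) ∂D.μ =
        ∫ x, (pd 2 f x * φ x + f x * pd 2 φ x) :=
      setIntegral_eq_integral_of_forall_compl_eq_zero fun x hx => by
        rw [hf.pd_eq_zero hx, hf.eq_zero hx, zero_mul, zero_mul, add_zero]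
    rw [← h0]
    refine integral_congr_ae ?_
    filter_upwards [hj.grad_eq 2, hj.val_eq] with x h1 h2
    rw [h1, h2]
  rw [e, integral_add, integral_mul_pd hf1 hφ.2.1 hφ1]
  · simp
  · exact (hpf.mul hφ.1.continuous).integrable_of_hasCompactSupport hφ.2.1.mul_left
  · exact (hf.1.continuous.mul hpφ).integrable_of_hasCompactSupport
      (hasCompactSupport_pd hφ.2.1 2).mul_left

/-- Subtracting its mean turns a test function into an admissible test function for salinity: the
gradient, and with it the boundary conditions, are not affected. -/
theorem IsTest.exists_mean_free {f : E3 → ℝ} (hf : IsTest D.Ω f) {a : ℝ} (ha : ∀ x, |f x| ≤ a) :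
    ∃ (c : ℝ) (hc : ContDiff ℝ ∞ fun x => f x - c), |c| ≤ a ∧
      smoothJet D (fun x => f x - c) hc ∈ VS D 0 := by
  have hi : Integrable f D.μ := (memLp_of_continuous D hf.1.continuous 1).integrable le_rfl
  have hpos : 0 < D.μ.real univ := ENNReal.toReal_pos D.measure_univ_pos.ne' (measure_ne_top _ _)
  have hc : ContDiff ℝ ∞ fun x => f x - (∫ y, f y ∂D.μ) / D.μ.real univ := hf.1.sub contDiff_const
  refine ⟨(∫ y, f y ∂D.μ) / D.μ.real univ, hc, ?_, subset_closure ⟨_, hc,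
    hf.tempBC_sub_const 0 _ (Or.inl rfl), ?_, isJetOf_smoothJet hc⟩⟩
  · rw [abs_div, abs_of_pos hpos, div_le_iff₀ hpos]
    exact norm_integral_le_of_norm_le_const (μ := D.μ) (C := a) (ae_of_all _ fun x => by
      rw [Real.norm_eq_abs]
      exact ha x)
  · rw [integral_sub hi (integrable_const _), integral_const, smul_eq_mul]
    field_simp
    ring

theorem integrable_L2_mul_of_bounded (c : L2 D) {f : E3 → ℝ} (hf : AEStronglyMeasurable f D.μ)
    {B : ℝ} (hB : ∀ᵐ x ∂D.μ, |f x| ≤ B) : Integrable (fun x => c x * f x) D.μ :=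
  ((Lp.memLp c).integrable one_le_two).mul_bdd (c := B) hf hB

/-- A bound for `∫ c f` in terms of the supremum and the gradient of the test function `f` extends
to the functions `ψ R (θ, S, z)` with `θ` and `S` in `H¹`, by approximation of `θ` and `S`. -/
theorem abs_integral_mul_superposition_le {R : ℝ × ℝ × ℝ → ℝ} (hR : ContDiff ℝ ∞ R) {CR : ℝ}
    (hR0 : ∀ q, |R q| ≤ CR) (hR1 : ∀ q, ‖fderiv ℝ R q‖ ≤ CR)
    (hR2 : ∀ q q', |R q - R q'| ≤ CR * ‖q - q'‖) (β : ℝ)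
    {θ S : Jet 1 D} (hθ : θ ∈ closure {u : Jet 1 D | ∃ f : E3 → ℝ, ContDiff ℝ ∞ f ∧ IsJetOf u f})
    (hS : S ∈ closure {u : Jet 1 D | ∃ f : E3 → ℝ, ContDiff ℝ ∞ f ∧ IsJetOf u f})
    {ψ : E3 → ℝ} (hψ : IsTest D.Ω ψ) {a₀ : ℝ} (hψ0 : ∀ x, |ψ x| ≤ a₀)
    (hψ1 : ∀ i x, |pd i ψ x| ≤ a₀) {c : L2 D} {K₁ K₂ : ℝ}
    (hc : ∀ (f : E3 → ℝ) (hf : IsTest D.Ω f) (a b : ℝ), (∀ x, |f x| ≤ a) →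
      (∀ i, ‖(smoothJet D f hf.1).grad i‖ ≤ b) → |∫ x, c x * f x ∂D.μ| ≤ K₁ * a + K₂ * b) :
    |∫ x, c x * (ψ x * R (θ.val x, S.val x, β * x 2)) ∂D.μ| ≤
      K₁ * (a₀ * CR) + K₂ * (a₀ * CR * ((1 + |β|) * ‖(Lp.const 2 D.μ (1 : ℝ) : L2 D)‖ +
        (‖θ‖ + ‖S‖ + 2))) + 2 * (a₀ * CR) := by
  have ha₀ : 0 ≤ a₀ := (abs_nonneg _).trans (hψ0 0)
  have hCR : 0 ≤ CR := (abs_nonneg _).trans (hR0 0)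
  -- The approximation error is multiplied by `‖c‖`.
  set ε : ℝ := 1 / (1 + ‖c‖) with hε
  have hε0 : 0 < ε := by positivity
  have hε1 : ε ≤ 1 := by
    rw [hε, div_le_one (by positivity)]
    linarith [norm_nonneg c]
  have hcε : ‖c‖ * ε ≤ 1 := by
    rw [hε, mul_one_div, div_le_one (by positivity)]
    linarith
  obtain ⟨u, ⟨f₁, hf₁, hu⟩, hθu⟩ := Metric.mem_closure_iff.1 hθ ε hε0
  obtain ⟨s, ⟨f₂, hf₂, hs⟩, hSs⟩ := Metric.mem_closure_iff.1 hS ε hε0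
  rw [dist_eq_norm] at hθu hSs
  have hun : ‖u‖ ≤ ‖θ‖ + 1 := by
    have := norm_sub_norm_le u θ
    rw [norm_sub_rev] at this
    linarith
  have hsn : ‖s‖ ≤ ‖S‖ + 1 := by
    have := norm_sub_norm_le s S
    rw [norm_sub_rev] at this
    linarith
  set q : E3 → ℝ × ℝ × ℝ := fun x => (f₁ x, f₂ x, β * x 2) with hq
  have hqc : ContDiff ℝ ∞ q :=
    hf₁.prodMk (hf₂.prodMk (contDiff_const.mul (EuclideanSpace.proj (2 : Fin 3) :
      E3 →L[ℝ] ℝ).contDiff))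
  have hRq : ContDiff ℝ ∞ fun x => R (q x) := hR.comp hqc
  set f : E3 → ℝ := fun x => ψ x * R (q x) with hf
  have hft : IsTest D.Ω f := ⟨hψ.1.mul hRq, hψ.2.1.mul_right,
    (tsupport_mul_subset_left (f := ψ)).trans hψ.2.2⟩
  have hbound : ∀ {x : E3} (y : ℝ × ℝ × ℝ), |ψ x * R y| ≤ a₀ * CR := fun {x} y => by
    rw [abs_mul]
    exact mul_le_mul (hψ0 x) (hR0 y) (abs_nonneg _) ha₀
  have hpdR : ∀ i x, |pd i (fun x => R (q x)) x| ≤ CR * (|pd i f₁ x| + |pd i f₂ x| + |β|) := by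
    intro i x
    have h1 : HasFDerivAt f₁ (fderiv ℝ f₁ x) x := (hf₁.differentiable (by simp) x).hasFDerivAt
    have h2 : HasFDerivAt f₂ (fderiv ℝ f₂ x) x := (hf₂.differentiable (by simp) x).hasFDerivAt
    have h3 : HasFDerivAt (fun x : E3 => β * x 2)
        (β • (EuclideanSpace.proj (2 : Fin 3) : E3 →L[ℝ] ℝ)) x :=
      (EuclideanSpace.proj (2 : Fin 3) : E3 →L[ℝ] ℝ).hasFDerivAt.const_mul β
    have h4 := (hR.differentiable (by simp) (q x)).hasFDerivAt.comp x (h1.prodMk (h2.prodMk h3))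
    have h5 : pd i (fun x => R (q x)) x = fderiv ℝ R (q x)
        (pd i f₁ x, pd i f₂ x, β * (EuclideanSpace.single i (1 : ℝ) : E3) 2) := by
      rw [pd]
      erw [h4.fderiv]
      simp [pd]
    rw [h5]
    refine ((fderiv ℝ R _).le_of_opNorm_le (hR1 _) _).trans ?_
    have h6 : |(EuclideanSpace.single i (1 : ℝ) : E3) 2| ≤ 1 := by
      fin_cases i <;> simp
    have h7 : |β * (EuclideanSpace.single i (1 : ℝ) : E3) 2| ≤ |β| := by
      rw [abs_mul]
      exact mul_le_of_le_one_right (abs_nonneg _) h6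
    gcongr
    simp only [Prod.norm_def, Real.norm_eq_abs]
    have := abs_nonneg (pd i f₁ x)
    have := abs_nonneg (pd i f₂ x)
    have := abs_nonneg β
    exact max_le (by linarith) (max_le (by linarith) (by linarith))
  have hpdf : ∀ i x, |pd i f x| ≤ a₀ * CR * (1 + |β|) + a₀ * CR * (|pd i f₁ x| + |pd i f₂ x|) := by
    intro i x
    rw [hf, pd_mul (hψ.1.differentiable (by simp) x) (hRq.differentiable (by simp) x)]
    refine (abs_add_le _ _).trans ?_
    rw [abs_mul, abs_mul]
    calc |ψ x| * |pd i (fun x => R (q x)) x| + |R (q x)| * |pd i ψ x|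
        ≤ a₀ * (CR * (|pd i f₁ x| + |pd i f₂ x| + |β|)) + CR * a₀ := by
          gcongr
          · exact hψ0 x
          · exact hpdR i x
          · exact hR0 _
          · exact hψ1 i x
      _ = _ := by ring
  have hgrad : ∀ i, ‖(smoothJet D f hft.1).grad i‖ ≤
      a₀ * CR * ((1 + |β|) * ‖(Lp.const 2 D.μ (1 : ℝ) : L2 D)‖ + (‖θ‖ + ‖S‖ + 2)) := by
    intro i
    set O : L2 D := Lp.const 2 D.μ (1 : ℝ) with hO
    set A : L2 D := (a₀ * CR * (1 + |β|)) • O + (a₀ * CR) • (|u.grad i| + |s.grad i|) with hA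
    have hle : ‖(smoothJet D f hft.1).grad i‖ ≤ ‖A‖ := by
      refine Lp.norm_le_norm_of_ae_le ?_
      filter_upwards [(isJetOf_smoothJet (D := D) hft.1).grad_eq i, hu.grad_eq i, hs.grad_eq i,
        Lp.coeFn_add ((a₀ * CR * (1 + |β|)) • O) ((a₀ * CR) • (|u.grad i| + |s.grad i|)),
        Lp.coeFn_smul (a₀ * CR * (1 + |β|)) O, Lp.coeFn_smul (a₀ * CR) (|u.grad i| + |s.grad i|),
        Lp.coeFn_add |u.grad i| |s.grad i|, Lp.coeFn_abs (u.grad i), Lp.coeFn_abs (s.grad i),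
        Lp.coeFn_const 2 D.μ (1 : ℝ)] with x h1 h2 h3 h4 h5 h6 h7 h8 h9 h10
      rw [h1, hA, h4, Pi.add_apply, h5, h6, Pi.smul_apply, Pi.smul_apply, h7, Pi.add_apply, h8, h9,
        hO, h10, h2, h3]
      refine (hpdf i x).trans (le_trans (le_of_eq ?_) (le_abs_self _))
      simp
    refine hle.trans ((norm_add_le _ _).trans ?_)
    rw [norm_smul, norm_smul, Real.norm_of_nonneg (by positivity), Real.norm_of_nonneg (by positivity)]
    have h1 : ‖|u.grad i| + |s.grad i|‖ ≤ ‖θ‖ + ‖S‖ + 2 := by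
      refine (norm_add_le _ _).trans ?_
      rw [norm_abs_eq_norm, norm_abs_eq_norm]
      linarith [u.norm_grad_le i, s.norm_grad_le i]
    calc _ ≤ a₀ * CR * (1 + |β|) * ‖O‖ + a₀ * CR * (‖θ‖ + ‖S‖ + 2) := by gcongr
      _ = _ := by ring
  have hmain := hc f hft (a₀ * CR) _ (fun x => hbound (q x)) hgrad
  have herr : |∫ x, c x * (ψ x * R (θ.val x, S.val x, β * x 2)) ∂D.μ - ∫ x, c x * f x ∂D.μ| ≤
      2 * (a₀ * CR) := by
    have hmeas : Measurable fun x : E3 => (θ.val x, S.val x, β * x 2) :=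
      (Lp.stronglyMeasurable θ.val).measurable.prodMk
        ((Lp.stronglyMeasurable S.val).measurable.prodMk (by fun_prop))
    have i1 : Integrable (fun x => c x * (ψ x * R (θ.val x, S.val x, β * x 2))) D.μ :=
      integrable_L2_mul_of_bounded c (hψ.1.continuous.measurable.mul
        (hR.continuous.measurable.comp hmeas)).aestronglyMeasurable
        (ae_of_all _ fun x => hbound _)
    have i2 : Integrable (fun x => c x * f x) D.μ :=
      integrable_L2_mul_of_bounded c hft.1.continuous.aestronglyMeasurable
        (ae_of_all _ fun x => hbound _)
    obtain ⟨j1, k1⟩ := integral_abs_mul_abs_le c (θ.val - u.val)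
    obtain ⟨j2, k2⟩ := integral_abs_mul_abs_le c (S.val - s.val)
    rw [← integral_sub i1 i2, ← Real.norm_eq_abs]
    refine (norm_integral_le_of_norm_le (((j1.add j2).const_mul (a₀ * CR))) ?_).trans ?_
    · filter_upwards [hu.val_eq, hs.val_eq, Lp.coeFn_sub θ.val u.val, Lp.coeFn_sub S.val s.val]
        with x h1 h2 h3 h4
      rw [Pi.add_apply, h3, h4, Pi.sub_apply, Pi.sub_apply, h1, h2, ← mul_sub, hf, ← mul_sub,
        norm_mul, norm_mul, Real.norm_eq_abs, Real.norm_eq_abs, Real.norm_eq_abs]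
      have h5 := hR2 (θ.val x, S.val x, β * x 2) (q x)
      have h6 : ‖((θ.val x, S.val x, β * x 2) : ℝ × ℝ × ℝ) - q x‖ ≤
          |θ.val x - f₁ x| + |S.val x - f₂ x| := by
        have := abs_nonneg (θ.val x - f₁ x)
        have := abs_nonneg (S.val x - f₂ x)
        simp only [hq, Prod.mk_sub_mk, sub_self, Prod.norm_def, Real.norm_eq_abs, abs_zero]
        exact max_le (by linarith) (max_le (by linarith) (by linarith))
      calc |c x| * (|ψ x| * |R (θ.val x, S.val x, β * x 2) - R (q x)|)
          ≤ |c x| * (a₀ * (CR * (|θ.val x - f₁ x| + |S.val x - f₂ x|))) := by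
            gcongr
            · exact hψ0 x
            · exact h5.trans (by gcongr)
        _ = _ := by ring
    · rw [integral_const_mul]
      simp only [Pi.add_apply]
      rw [integral_add j1 j2]
      have e1 : ‖θ.val - u.val‖ ≤ ε := by
        refine le_trans ?_ hθu.le
        exact Jet.norm_val_le (θ - u)
      have e2 : ‖S.val - s.val‖ ≤ ε := by
        refine le_trans ?_ hSs.le
        exact Jet.norm_val_le (S - s)
      have e3 : ‖c‖ * ‖θ.val - u.val‖ ≤ 1 := le_trans (by gcongr) hcε
      have e4 : ‖c‖ * ‖S.val - s.val‖ ≤ 1 := le_trans (by gcongr) hcε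
      have := mul_nonneg ha₀ hCR
      calc _ ≤ a₀ * CR * (1 + 1) := by
            gcongr
            · exact k1.trans e3
            · exact k2.trans e4
        _ = _ := by ring
  rw [abs_le] at hmain herr ⊢
  constructor <;> linarith [hmain.1, hmain.2, herr.1, herr.2]

end Test

/-! ### Time derivative of the slope -/

section TimeDeriv

variable {D : Domain}

/-- The functional `u ↦ ∫ u` on `L²(Ω)`. -/
def integralForm (D : Domain) : L2 D →L[ℝ] ℝ := innerSL ℝ (Lp.const 2 D.μ (1 : ℝ) : L2 D)

theorem integralForm_apply (u : L2 D) : integralForm D u = ∫ x, u x ∂D.μ := by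
  rw [integralForm, innerSL_apply_apply, L2.inner_def]
  refine integral_congr_ae ?_
  filter_upwards [Lp.coeFn_const 2 D.μ (1 : ℝ)] with x hx
  rw [hx]
  simp

theorem integral_eq_of_mem_VS {m : ℝ} {u : Jet 1 D} (hu : u ∈ VS D m) :
    ∫ x, u.val x ∂D.μ = m := by
  have hcl : IsClosed {u : Jet 1 D | integralForm D u.val = m} :=
    isClosed_eq ((integralForm D).continuous.comp Jet.continuous_val) continuous_const
  rw [← integralForm_apply]
  refine closure_minimal ?_ hcl hu
  rintro w ⟨f, -, -, hm, hw⟩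
  show integralForm D w.val = m
  rw [integralForm_apply, ← hm]
  exact integral_congr_ae hw.val_eq

section Estimates

variable {k : Kernel} {l : Limiter D} {p : Params} {ρ : E3 → ℝ} {L κ M : ℝ}

/-- The temperature equation, tested with a smooth function of compact support, for which the
surface term vanishes. -/
theorem abs_integral_temperatureDeriv_mul_le (hρ : ∀ i x, |slope k l ρ i x| ≤ L) (hκ : 0 ≤ κ)
    (hK : ∀ a b : ℝ, |a| ≤ L → |b| ≤ L → ∀ i j, |Kiso p a b i j| ≤ κ ∧ |Kgm p a b i j| ≤ κ)
    {v : VJet 1 D} {u : Jet 1 D} {ut : L2 D} (hv : ‖v‖ ≤ M) (hu : ‖u‖ ≤ M) {τ : E2 → ℝ}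
    (heq : ∀ φ ∈ Vθ D p.kθ, ∀ σ, IsSurfaceTrace D φ σ →
      tracerForm k l p ρ v u ut φ + p.kθ * ∫ q, τ q * σ q ∂D.μM = 0)
    {f : E3 → ℝ} (hf : IsTest D.Ω f) {a b : ℝ} (ha : ∀ x, |f x| ≤ a)
    (hb : ∀ i, ‖(smoothJet D f hf.1).grad i‖ ≤ b) :
    |∫ x, ut x * f x ∂D.μ| ≤ 2 * ((2 + 2 * D.h) * (M * M)) * a + 18 * κ * M * b := by
  have hM : 0 ≤ M := (norm_nonneg _).trans hv
  have hh := D.h_pos.le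
  have ha0 : 0 ≤ a := (abs_nonneg _).trans (ha 0)
  have hb0 : 0 ≤ b := (norm_nonneg _).trans (hb 0)
  have hval := (isJetOf_smoothJet (D := D) hf.1).val_eq
  have h1 := abs_tracerForm_sub_le hρ hκ hK v u ut (smoothJet D f hf.1) ha0
    (hval.mono fun x hx => by rw [hx]; exact ha x) hb
  have h2 := heq _ (hf.smoothJet_mem_Vθ _) 0 hf.isSurfaceTrace_zero
  simp only [Pi.zero_apply, mul_zero, integral_zero, add_zero] at h2
  rw [h2, zero_sub, abs_neg] at h1
  have h3 : ∫ x, ut x * (smoothJet D f hf.1).val x ∂D.μ = ∫ x, ut x * f x ∂D.μ :=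
    integral_congr_ae (hval.mono fun x hx => by simp only [hx])
  rw [h3] at h1
  refine h1.trans ?_
  have h4 : ‖v‖ * ‖u‖ ≤ M * M := by gcongr
  have h5 : a * ((2 + 2 * D.h) * (‖v‖ * ‖u‖)) ≤ a * ((2 + 2 * D.h) * (M * M)) := by gcongr
  have h6 : 18 * κ * (‖u‖ * b) ≤ 18 * κ * (M * b) := by gcongr
  have h7 : 0 ≤ a * ((2 + 2 * D.h) * (M * M)) := by positivity
  linarith

/-- The salinity equation only admits test functions of mean zero. As the time derivative has mean
zero, the mean of a test function can be subtracted. -/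
theorem abs_integral_salinityDeriv_mul_le (hρ : ∀ i x, |slope k l ρ i x| ≤ L) (hκ : 0 ≤ κ)
    (hK : ∀ a b : ℝ, |a| ≤ L → |b| ≤ L → ∀ i j, |Kiso p a b i j| ≤ κ ∧ |Kgm p a b i j| ≤ κ)
    {v : VJet 1 D} {u : Jet 1 D} {ut : L2 D} (hv : ‖v‖ ≤ M) (hu : ‖u‖ ≤ M)
    (hmean : ∫ x, ut x ∂D.μ = 0)
    (heq : ∀ φ ∈ VS D 0, tracerForm k l p ρ v u ut φ = 0)
    {f : E3 → ℝ} (hf : IsTest D.Ω f) {a b : ℝ} (ha : ∀ x, |f x| ≤ a)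
    (hb : ∀ i, ‖(smoothJet D f hf.1).grad i‖ ≤ b) :
    |∫ x, ut x * f x ∂D.μ| ≤ 2 * ((2 + 2 * D.h) * (M * M)) * a + 18 * κ * M * b := by
  have hM : 0 ≤ M := (norm_nonneg _).trans hv
  have hh := D.h_pos.le
  have ha0 : 0 ≤ a := (abs_nonneg _).trans (ha 0)
  have hb0 : 0 ≤ b := (norm_nonneg _).trans (hb 0)
  obtain ⟨c, hc, hca, hmem⟩ := hf.exists_mean_free ha
  have hval := (isJetOf_smoothJet (D := D) hc).val_eq
  have hgrad : ∀ i, (smoothJet D _ hc).grad i = (smoothJet D f hf.1).grad i := fun i => by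
    refine Lp.ext ?_
    filter_upwards [(isJetOf_smoothJet (D := D) hc).grad_eq i,
      (isJetOf_smoothJet (D := D) hf.1).grad_eq i] with x h1 h2
    rw [h1, h2, pd, pd, fderiv_sub_const]
  have h1 := abs_tracerForm_sub_le (a := 2 * a) hρ hκ hK v u ut (smoothJet D _ hc) (by positivity)
    (hval.mono fun x hx => by
      rw [hx]
      exact (abs_sub _ _).trans (by linarith [ha x])) (fun i => by rw [hgrad]; exact hb i)
  rw [heq _ hmem, zero_sub, abs_neg] at h1
  have hi : Integrable (ut : E3 → ℝ) D.μ := (Lp.memLp ut).integrable one_le_two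
  have h3 : ∫ x, ut x * (smoothJet D _ hc).val x ∂D.μ = ∫ x, ut x * f x ∂D.μ := by
    have h4 : ∫ x, ut x * (smoothJet D _ hc).val x ∂D.μ =
        ∫ x, (ut x * f x - ut x * c) ∂D.μ :=
      integral_congr_ae (hval.mono fun x hx => by simp only [hx, mul_sub])
    rw [h4, integral_sub (integrable_L2_mul_of_bounded ut hf.1.continuous.aestronglyMeasurable
      (ae_of_all _ ha)) (hi.mul_const c), integral_mul_const, hmean, zero_mul, sub_zero]
  rw [h3] at h1
  refine h1.trans ?_
  have h4 : ‖v‖ * ‖u‖ ≤ M * M := by gcongr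
  have h5 : 2 * a * ((2 + 2 * D.h) * (‖v‖ * ‖u‖)) ≤ 2 * a * ((2 + 2 * D.h) * (M * M)) := by gcongr
  have h6 : 18 * κ * (‖u‖ * b) ≤ 18 * κ * (M * b) := by gcongr
  linarith

end Estimates

theorem Kernel.exists_pd_bound (k : Kernel) : ∃ a, ∀ (j : Fin 3) (x y : E3),
    |pd j k.jη (x - y)| ≤ a ∧ ∀ i, |pd i (fun y => pd j k.jη (x - y)) y| ≤ a := by
  have hs := fun j => hasCompactSupport_pd k.hasCompactSupport_jη j
  have hc := fun j => contDiff_pd_infty k.contDiff_jη j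
  choose A hA using fun j => (hs j).exists_bound_of_continuous (hc j).continuous
  choose B hB using fun j i => (hasCompactSupport_pd (hs j) i).exists_bound_of_continuous
    (contDiff_pd_infty (hc j) i).continuous
  have hA0 : ∀ j, 0 ≤ A j := fun j => (norm_nonneg _).trans (hA j 0)
  have hB0 : ∀ j i, 0 ≤ B j i := fun j i => (norm_nonneg _).trans (hB j i 0)
  have hAs : ∀ j, A j ≤ ∑ j, A j := fun j =>
    Finset.single_le_sum (fun j _ => hA0 j) (Finset.mem_univ j)
  have hBs : ∀ j i, B j i ≤ ∑ j, ∑ i, B j i := fun j i =>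
    (Finset.single_le_sum (fun i _ => hB0 j i) (Finset.mem_univ i)).trans
      (Finset.single_le_sum (f := fun j => ∑ i, B j i)
        (fun j _ => Finset.sum_nonneg fun i _ => hB0 j i) (Finset.mem_univ j))
  have hA1 : 0 ≤ ∑ j, A j := (hA0 0).trans (hAs 0)
  have hB1 : 0 ≤ ∑ j, ∑ i, B j i := (hB0 0 0).trans (hBs 0 0)
  refine ⟨(∑ j, A j) + ∑ j, ∑ i, B j i, fun j x y => ⟨?_, fun i => ?_⟩⟩
  · exact (hA j _).trans ((hAs j).trans (by linarith))
  · have h : HasFDerivAt (fun y => pd j k.jη (x - y))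
        ((fderiv ℝ (pd j k.jη) (x - y)).comp (-(ContinuousLinearMap.id ℝ E3))) y :=
      (((hc j).differentiable (by simp)) (x - y)).hasFDerivAt.comp y
        ((hasFDerivAt_id y).const_sub x)
    have e : pd i (fun y => pd j k.jη (x - y)) y = -pd i (pd j k.jη) (x - y) := by
      rw [pd, h.fderiv]
      simp [pd]
    rw [e, abs_neg]
    exact (hB j i _).trans ((hBs j i).trans (by linarith))

/-- The functionals `∂ⱼ (j_η * ·) (x)`, evaluated at the time derivative of the density, are bounded
away from the boundary: they integrate the time derivatives of temperature and salinity against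
functions of the form `ψ R (θ, S, z)`. -/
theorem exists_form_bound (D : Domain) (k : Kernel) {g : ℝ × ℝ × ℝ → ℝ} (hg : ContDiff ℝ ∞ g)
    (hgs : HasCompactSupport g) (β M K₁ K₂ : ℝ) (hK₂ : 0 ≤ K₂) :
    ∃ C, 0 ≤ C ∧ ∀ (θ S : Jet 1 D) (ct cs : L2 D) (γ : Lp ℝ 1 D.μ),
      θ ∈ closure {u : Jet 1 D | ∃ f : E3 → ℝ, ContDiff ℝ ∞ f ∧ IsJetOf u f} →
      S ∈ closure {u : Jet 1 D | ∃ f : E3 → ℝ, ContDiff ℝ ∞ f ∧ IsJetOf u f} →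
      ‖θ‖ ≤ M → ‖S‖ ≤ M →
      (∀ (f : E3 → ℝ) (hf : IsTest D.Ω f) (a b : ℝ), (∀ x, |f x| ≤ a) →
        (∀ i, ‖(smoothJet D f hf.1).grad i‖ ≤ b) → |∫ x, ct x * f x ∂D.μ| ≤ K₁ * a + K₂ * b) →
      (∀ (f : E3 → ℝ) (hf : IsTest D.Ω f) (a b : ℝ), (∀ x, |f x| ≤ a) →
        (∀ i, ‖(smoothJet D f hf.1).grad i‖ ≤ b) → |∫ x, cs x * f x ∂D.μ| ≤ K₁ * a + K₂ * b) →
      (γ =ᵐ[D.μ] fun x => fderiv ℝ g (θ.val x, S.val x, β * x 2) (ct x, cs x, 0)) →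
      ∀ x ∈ D.core k.η, ∀ j, |k.form D j x γ| ≤ C := by
  obtain ⟨a₀, ha₀⟩ := k.exists_pd_bound
  have ha0 : 0 ≤ a₀ := (abs_nonneg _).trans (ha₀ 0 0 0).1
  have hgd : ∀ w, ContDiff ℝ ∞ fun q => fderiv ℝ g q w := fun w =>
    (hg.fderiv_right (by simp)).clm_apply contDiff_const
  have hgds : ∀ w, HasCompactSupport fun q => fderiv ℝ g q w := fun w => hgs.fderiv_apply ℝ w
  obtain ⟨C₁, hC₁, h10, h11, h12, -⟩ :=
    exists_taylor_bound ((hgd (1, 0, 0)).of_le (by norm_cast)) (hgds (1, 0, 0))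
  obtain ⟨C₂, hC₂, h20, h21, h22, -⟩ :=
    exists_taylor_bound ((hgd (0, 1, 0)).of_le (by norm_cast)) (hgds (0, 1, 0))
  set B : ℝ → ℝ := fun CR => |K₁| * (a₀ * CR) + K₂ * (a₀ * CR *
    ((1 + |β|) * ‖(Lp.const 2 D.μ (1 : ℝ) : L2 D)‖ + (|M| + |M| + 2))) + 2 * (a₀ * CR) with hB
  have hB0 : ∀ CR, 0 ≤ CR → 0 ≤ B CR := fun CR h => by
    simp only [hB]
    positivity
  refine ⟨B C₁ + B C₂, add_nonneg (hB0 _ hC₁) (hB0 _ hC₂), ?_⟩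
  intro θ S ct cs γ hθ hS hθM hSM hct hcs hγ x hx j
  set ψ : E3 → ℝ := fun y => pd j k.jη (x - y) with hψ
  have hψt : IsTest D.Ω ψ := k.isTest_pd_jη hx j
  have key : ∀ (c : L2 D), (∀ (f : E3 → ℝ) (hf : IsTest D.Ω f) (a b : ℝ), (∀ x, |f x| ≤ a) →
      (∀ i, ‖(smoothJet D f hf.1).grad i‖ ≤ b) → |∫ x, c x * f x ∂D.μ| ≤ K₁ * a + K₂ * b) →
      ∀ (R : ℝ × ℝ × ℝ → ℝ) (CR : ℝ), ContDiff ℝ ∞ R → 0 ≤ CR → (∀ q, ‖R q‖ ≤ CR) →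
      (∀ q, ‖fderiv ℝ R q‖ ≤ CR) → (∀ q q', ‖R q - R q'‖ ≤ CR * ‖q - q'‖) →
      |∫ y, c y * (ψ y * R (θ.val y, S.val y, β * y 2)) ∂D.μ| ≤ B CR := by
    intro c hc R CR hR hCR h0 h1 h2
    refine (abs_integral_mul_superposition_le hR h0 h1 h2 β hθ hS hψt (fun y => (ha₀ j x y).1)
      (fun i y => (ha₀ j x y).2 i) hc).trans ?_
    have e1 : K₁ ≤ |K₁| := le_abs_self _
    have e2 : ‖θ‖ ≤ |M| := hθM.trans (le_abs_self _)
    have e3 : ‖S‖ ≤ |M| := hSM.trans (le_abs_self _)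
    simp only [hB]
    gcongr
  have hmeas : Measurable fun y : E3 => (θ.val y, S.val y, β * y 2) :=
    (Lp.stronglyMeasurable θ.val).measurable.prodMk
      ((Lp.stronglyMeasurable S.val).measurable.prodMk (by fun_prop))
  have hint : ∀ (c : L2 D) (R : ℝ × ℝ × ℝ → ℝ) (CR : ℝ), Continuous R → (∀ q, ‖R q‖ ≤ CR) →
      Integrable (fun y => c y * (ψ y * R (θ.val y, S.val y, β * y 2))) D.μ := by
    intro c R CR hR h0
    refine integrable_L2_mul_of_bounded c (B := a₀ * CR) (hψt.1.continuous.measurable.mul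
      (hR.measurable.comp hmeas)).aestronglyMeasurable (ae_of_all _ fun y => ?_)
    rw [abs_mul]
    exact mul_le_mul (ha₀ j x y).1 (h0 _) (abs_nonneg _) ha0
  have e : k.form D j x γ =
      ∫ y, ct y * (ψ y * fderiv ℝ g (θ.val y, S.val y, β * y 2) (1, 0, 0)) ∂D.μ +
        ∫ y, cs y * (ψ y * fderiv ℝ g (θ.val y, S.val y, β * y 2) (0, 1, 0)) ∂D.μ := by
    rw [k.form_apply, ← integral_add (hint ct _ C₁ (hgd (1, 0, 0)).continuous h10)
      (hint cs _ C₂ (hgd (0, 1, 0)).continuous h20)]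
    refine integral_congr_ae ?_
    filter_upwards [hγ] with y hy
    have hsplit : ((ct y, cs y, 0) : ℝ × ℝ × ℝ) = ct y • (1, 0, 0) + cs y • (0, 1, 0) := by simp
    rw [hy, hsplit, map_add, map_smul, map_smul, smul_eq_mul, smul_eq_mul]
    simp only [hψ]
    ring
  rw [e]
  refine (abs_add_le _ _).trans (add_le_add ?_ ?_)
  · exact key ct hct _ C₁ (hgd (1, 0, 0)) hC₁ h10 h11 h12
  · exact key cs hcs _ C₂ (hgd (0, 1, 0)) hC₂ h20 h21 h22

end TimeDeriv

theorem HasWeakTimeDeriv.toLp {X : Type*} [NormedAddCommGroup X] [NormedSpace ℝ X]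
    [CompleteSpace X] {T : ℝ} {u u' : Fin 2 → ℝ → X} (h : ∀ i, HasWeakTimeDeriv T (u i) (u' i)) :
    HasWeakTimeDeriv T (fun t => (WithLp.toLp 2 fun i => u i t : PiLp 2 fun _ : Fin 2 => X))
      fun t => WithLp.toLp 2 fun i => u' i t := by
  obtain ⟨A, B, hAB⟩ : ∃ A B : X →L[ℝ] PiLp 2 fun _ : Fin 2 => X,
      ∀ w : Fin 2 → X, WithLp.toLp 2 w = A (w 0) + B (w 1) := by
    let P : (Fin 2 → X) →L[ℝ] PiLp 2 fun _ : Fin 2 => X :=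
      (PiLp.continuousLinearEquiv 2 ℝ fun _ : Fin 2 => X).symm.toContinuousLinearMap
    refine ⟨P.comp (ContinuousLinearMap.single ℝ (fun _ : Fin 2 => X) 0),
      P.comp (ContinuousLinearMap.single ℝ (fun _ : Fin 2 => X) 1), fun w => ?_⟩
    ext i
    fin_cases i <;> simp [P]
  simp only [hAB]
  exact ((h 0).clm_comp A).add ((h 1).clm_comp B)

/-- The slope is a function of temperature and salinity in `L²` with Lipschitz derivative. Its
weak time derivative is given by the chain rule, and it is bounded because it involves the time
derivatives of temperature and salinity only through the functionals of `exists_form_bound`. -/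
theorem exists_slope_weakTimeDeriv {D : Domain} (k : Kernel) (l : Limiter D) (e : EOS D)
    (p : Params) {m T : ℝ} (hT : 0 < T) {v : ℝ → VJet 1 D} {θ S : ℝ → Jet 1 D}
    (hθ : IsTemperature e p.kθ T θ) (hS : IsSalinity e m T S)
    (h : IsStrongSolution k l e p m T v θ S) :
    ∃ Λ G : ℝ → VL2 D,
      (∀ᵐ t ∂volume.restrict (Icc 0 T), ∀ i,
        Λ t i =ᵐ[D.μ] slope k l (e.density (θ t) (S t)) i) ∧
      HasWeakTimeDeriv T Λ G ∧ MemLp G ⊤ (volume.restrict (Icc 0 T)) := by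
  set R := e.R₂ * D.μ.real univ with hR
  obtain ⟨F, hF, hFs, hslope⟩ := exists_slope_eq_family D k l R
  obtain ⟨g, hg, hgs, hgeq⟩ := e.exists_smooth_rho
  obtain ⟨N, N', CN, hN, hN', hNd, hNC, hNL⟩ :=
    exists_superposition (D := D) hg hgs e.measurable_pst
  obtain ⟨c, hc0, hc⟩ := exists_norm_gradForm_le k
  choose Q Q' CQ hQ hQ' hQd hQC hQL using fun i : Fin 2 =>
    exists_familySuperposition (D := D) hF hFs (contDiff_gradForm k (D := D) i).continuous (hc D i)
      (continuous_cutoffExt k l) (cutoffExt_mem_Icc k l)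
  obtain ⟨vt, θt, St, -, hθt, hSt, heq⟩ := h.equations
  set r : ℝ → Lp ℝ 1 D.μ := fun t => N ((θ t).val, (S t).val) with hr
  set γ : ℝ → Lp ℝ 1 D.μ := fun t => N' ((θ t).val, (S t).val) (θt t, St t) with hγ
  have hrγ : HasWeakTimeDeriv T r γ := (hθt.prodMk hSt).comp hT hNd hNC hNL
  have hΛ := HasWeakTimeDeriv.toLp fun i => hrγ.comp hT (hQd i) (hQC i) (hQL i)
  have key : ∀ᵐ t ∂volume.restrict (Icc 0 T), r t =ᵐ[D.μ] e.density (θ t) (S t) ∧ ‖r t‖ ≤ R := by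
    filter_upwards [hθ.2, hS.2] with t h1 h2
    have hNe : r t =ᵐ[D.μ] e.density (θ t) (S t) := by
      filter_upwards [hN ((θ t).val, (S t).val), h1.2, h2.2, D.ae_mem_Ω] with x h3 h4 h5 h6
      rw [h3]
      exact hgeq _ h4 _ h5 _ (e.pst_mem h6)
    refine ⟨hNe, norm_le_of_mem_Icc e.R₁_pos ?_⟩
    filter_upwards [hNe, e.density_mem h1.2 h2.2] with x h3 h4
    rwa [h3]
  -- Uniform bounds for the solution and for the tensors.
  obtain ⟨M, hM⟩ : ∃ M, ∀ t ∈ Icc 0 T, ‖v t‖ ≤ M ∧ ‖θ t‖ ≤ M ∧ ‖S t‖ ≤ M := by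
    obtain ⟨M₁, h1⟩ := isCompact_Icc.exists_bound_of_continuousOn h.v_cont
    obtain ⟨M₂, h2⟩ := isCompact_Icc.exists_bound_of_continuousOn h.θ_cont
    obtain ⟨M₃, h3⟩ := isCompact_Icc.exists_bound_of_continuousOn h.S_cont
    exact ⟨max M₁ (max M₂ M₃), fun t ht => ⟨(h1 t ht).trans (le_max_left _ _),
      (h2 t ht).trans ((le_max_left _ _).trans (le_max_right _ _)),
      (h3 t ht).trans ((le_max_right _ _).trans (le_max_right _ _))⟩⟩
  obtain ⟨CF, hCF, hF0, hF1, -⟩ := exists_taylor_bound (hF.of_le (by norm_cast)) hFs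
  obtain ⟨κ, hκ, hK⟩ := exists_tensor_bound p CF
  have hM0 : 0 ≤ M := (norm_nonneg _).trans (hM 0 ⟨le_rfl, hT.le⟩).1
  obtain ⟨C, hC0, hC⟩ := exists_form_bound D k hg hgs (-e.g * e.ρ₀) M
    (2 * ((2 + 2 * D.h) * (M * M))) (18 * κ * M) (by positivity)
  have hmean : ∀ᵐ t ∂volume.restrict (Icc 0 T), integralForm D (St t) = 0 := by
    refine (hSt.clm_comp (integralForm D)).deriv_eq_zero_of_const (c := m) ?_
    filter_upwards [ae_restrict_mem measurableSet_Icc] with t ht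
    rw [integralForm_apply, integral_eq_of_mem_VS (h.S_mem t ht)]
  have hform : ∀ᵐ t ∂volume.restrict (Icc 0 T), ∀ x ∈ D.core k.η, ∀ j, |k.form D j x (γ t)| ≤ C := by
    filter_upwards [key, hmean, heq, ae_restrict_mem measurableSet_Icc] with t h1 h2 h3 ht
    obtain ⟨-, ⟨τ, -, htemp⟩, hsal⟩ := h3
    obtain ⟨b1, b2, b3⟩ := hM t ht
    have hsl : ∀ i x, |slope k l (e.density (θ t) (S t)) i x| ≤ CF := fun i x => by
      have hχ := cutoffExt_mem_Icc k l x
      rw [hslope _ _ h1.1 h1.2, abs_mul, abs_of_nonneg hχ.1]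
      exact (mul_le_of_le_one_left (abs_nonneg _) hχ.2).trans (hF0 _)
    rw [integralForm_apply] at h2
    refine hC (θ t) (S t) (θt t) (St t) (γ t) ?_ ?_ b2 b3 ?_ ?_ (hN' _ _)
    · refine closure_mono ?_ (h.θ_mem t ht)
      rintro u ⟨f, h4, -, h5⟩
      exact ⟨f, h4, h5⟩
    · refine closure_mono ?_ (h.S_mem t ht)
      rintro u ⟨f, h4, -, -, h5⟩
      exact ⟨f, h4, h5⟩
    · exact fun f hf a b ha hb =>
        abs_integral_temperatureDeriv_mul_le hsl hκ hK b1 b2 htemp hf ha hb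
    · exact fun f hf a b ha hb =>
        abs_integral_salinityDeriv_mul_le hsl hκ hK b1 b3 h2 hsal hf ha hb
  refine ⟨_, _, ?_, hΛ, ?_⟩
  · filter_upwards [key] with t ht i
    refine (hQ i (r t)).trans (ae_of_all _ fun x => ?_)
    exact (hslope _ _ ht.1 ht.2 i x).symm
  · refine MemLp.of_bound hΛ.2.1.aestronglyMeasurable
      (∑ _i : Fin 2, CF * C * ‖(Lp.const 2 D.μ (1 : ℝ) : L2 D)‖) ?_
    filter_upwards [hform] with t ht
    refine (Ocean.PiLp.norm_le_sum _).trans (Finset.sum_le_sum fun i _ => ?_)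
    have hle : ‖Q' i (r t) (γ t)‖ ≤ ‖(CF * C) • (Lp.const 2 D.μ (1 : ℝ) : L2 D)‖ := by
      refine Lp.norm_le_norm_of_ae_le ?_
      filter_upwards [hQ' i (r t) (γ t), Lp.coeFn_smul (CF * C) (Lp.const 2 D.μ (1 : ℝ) : L2 D),
        Lp.coeFn_const 2 D.μ (1 : ℝ)] with x h1 h2 h3
      rw [h1, h2, Pi.smul_apply, h3, Function.const_apply, smul_eq_mul, mul_one,
        Real.norm_of_nonneg (mul_nonneg hCF hC0)]
      by_cases hx : x ∈ D.core k.η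
      · have hχ := cutoffExt_mem_Icc k l x
        rw [norm_mul, Real.norm_of_nonneg hχ.1]
        refine (mul_le_of_le_one_left (norm_nonneg _) hχ.2).trans ?_
        refine (ContinuousLinearMap.le_of_opNorm_le _ (hF1 _) _).trans ?_
        gcongr
        exact max_le (ht x hx _) (ht x hx _)
      · rw [cutoffExt_eq_zero k l hx, zero_mul, norm_zero]
        positivity
    rwa [norm_smul, Real.norm_of_nonneg (mul_nonneg hCF hC0)] at hle

end Ocean

end

theorem mainTheorem6 (D : Ocean.Domain) (k : Ocean.Kernel) :
    -- (i)
    (∀ l : Ocean.Limiter D, ContDiffOn ℝ 2 (Ocean.cutoff k l) D.Ω →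
      ∀ R₁ R₂ : ℝ, ∃ C : ℝ, ∀ e : Ocean.EOS D, e.R₁ = R₁ → e.R₂ = R₂ →
      ∀ (kθ m T : ℝ), 0 < T → ∀ θ S : ℝ → Ocean.Jet 1 D,
        Ocean.IsTemperature e kθ T θ → Ocean.IsSalinity e m T S →
        ∃ Λ : ℝ → Ocean.VJet 2 D,
          MemLp Λ ⊤ (volume.restrict (Icc 0 T)) ∧
          ∀ᵐ t ∂volume.restrict (Icc 0 T),
            (∀ i, Λ t i ∈ Ocean.Sobolev 2 D ∧
              (Λ t i).val =ᵐ[D.μ] Ocean.slope k l (e.density (θ t) (S t)) i) ∧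
            MemLp (e.density (θ t) (S t)) 2 D.μ ∧
            ‖Λ t‖ ≤ C * (eLpNorm (e.density (θ t) (S t)) 2 D.μ).toReal ^ 2) ∧
    -- (ii)
    (∀ (l : Ocean.Limiter D) (e : Ocean.EOS D) (p : Ocean.Params) (m T : ℝ), 0 < T →
      ∀ (v : ℝ → Ocean.VJet 1 D) (θ S : ℝ → Ocean.Jet 1 D),
        Ocean.IsTemperature e p.kθ T θ → Ocean.IsSalinity e m T S →
        Ocean.IsStrongSolution k l e p m T v θ S →
        ∃ Λ G : ℝ → Ocean.VL2 D,
          (∀ᵐ t ∂volume.restrict (Icc 0 T), ∀ i,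
            Λ t i =ᵐ[D.μ] Ocean.slope k l (e.density (θ t) (S t)) i) ∧
          Ocean.HasWeakTimeDeriv T Λ G ∧
          MemLp G ⊤ (volume.restrict (Icc 0 T))) ∧
    -- (iii)
    (∀ r B : ℝ, r < 1 → ∃ C : ℝ, ∀ l : Ocean.Limiter D, l.ε₀ ≤ r * l.s₀ →
      (∀ s, l.s₀ * |deriv l.P s| ≤ B) →
      ∀ (e : Ocean.EOS D) (kθ m₁ m₂ T : ℝ), 0 < T →
      ∀ θ₁ S₁ θ₂ S₂ : ℝ → Ocean.Jet 1 D,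
        Ocean.IsTemperature e kθ T θ₁ → Ocean.IsSalinity e m₁ T S₁ →
        Ocean.IsTemperature e kθ T θ₂ → Ocean.IsSalinity e m₂ T S₂ →
        ∀ᵐ t ∂volume.restrict (Icc 0 T),
          eLpNorm (fun x => Ocean.slopeVec k l (e.density (θ₁ t) (S₁ t)) x
              - Ocean.slopeVec k l (e.density (θ₂ t) (S₂ t)) x) ⊤ D.μ ≤
            ENNReal.ofReal (C * (1 / l.s₀ + 1 / l.s₀ ^ 2) * (e.R₂ - e.R₁)) *
              eLpNorm (fun x => e.density (θ₁ t) (S₁ t) x - e.density (θ₂ t) (S₂ t) x) 2 D.μ) := by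
  refine ⟨fun l hcut R₁ R₂ => Ocean.slope_mem_H2 D k l hcut R₁ R₂, ?_, fun r B hr => ?_⟩
  · exact fun l e p m T hT v θ S hθ hS h => Ocean.exists_slope_weakTimeDeriv k l e p hT hθ hS h
  · obtain ⟨C, hC⟩ := Ocean.exists_slope_lipschitz_bound D k r B hr
    refine ⟨C, fun l hε hB e kθ m₁ m₂ T hT θ₁ S₁ θ₂ S₂ hθ₁ hS₁ hθ₂ hS₂ => ?_⟩
    filter_upwards [hθ₁.2, hS₁.2, hθ₂.2, hS₂.2] with t h1 h2 h3 h4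
    exact hC l hε hB e.R₁ e.R₂ _ _ (e.aestronglyMeasurable_density _ _)
      (e.aestronglyMeasurable_density _ _) (e.density_mem h1.2 h2.2) (e.density_mem h3.2 h4.2)
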